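/- All lattices are taken in a finite-dimensional real Euclidean space $V$. An $EE_8$-lattice is a lattice isometric to $\sqrt2\,E_8$, where $E_8$ is the root lattice of type $E_8$; an $EE_8$-sublattice of a lattice $L$ is a sublattice $Y\le L$ which is an $EE_8$-lattice. For a lattice $M$ in $V$ let $t_M\in O(V)$ be the involution which is $-1$ on $M$ and $1$ on $M^\perp$. A lattice $L$ is said to be of type $DIH_n(k)$ (written $L\cong DIH_n(k)$) if $L$ is integral, has no vectors of norm $\langle x,x\rangle=2$, has rank $k$, and $L=M+N$ for some $EE_8$-sublattices $M,N$ such that the group $\langle t_M,t_N\rangle$ is dihedral of order $n$. (1) Let $Q'\cong DIH_{12}(16)$, and let $M$ and $N$ be any $EE_8$-sublattices of $Q'$ with $Q'=M+N$. Put $h=t_Mt_N$, $g=h^2$, $u=h^3$, and let $E=\{x\in Q' : u(x)=-x\}$ be the $(-1)$-eigenlattice of $u$ in $Q'$. Then the $EE_8$-sublattices of $Q'$ are exactly $E$, $g^i(M)$ and $g^i(N)$ for $i=0,1,2$; that is, each of these is an $EE_8$-sublattice of $Q'$, and every $EE_8$-sublattice of $Q'$ is equal to one of them. (2) If $Q\cong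 DIH_6(14)$, then $Q$ contains exactly three $EE_8$-sublattices. -/

import Mathlib

open scoped InnerProductSpace

namespace EE8Lattice

variable {V : Type*} [NormedAddCommGroup V] [InnerProductSpace ℝ V]

/-- `L` is isometric to `√2` times the root lattice `E₈`: it has a `ℤ`-basis whose Gram
matrix is twice the Cartan matrix of type `E₈` (the Gram matrix of the simple roots). -/
def IsEE8 (L : Submodule ℤ V) : Prop :=
  ∃ b : Module.Basis (Fin 8) ℤ L,
    ∀ i j, ⟪(b i : V), (b j : V)⟫_ℝ = 2 * (CartanMatrix.E₈ i j : ℝ)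

/-- The lattice `L` is integral: all inner products are integers. -/
def IsIntegral (L : Submodule ℤ V) : Prop :=
  ∀ x ∈ L, ∀ y ∈ L, ∃ n : ℤ, ⟪x, y⟫_ℝ = n

/-- The lattice `L` is rootless: it has no vector of norm `⟪x, x⟫ = 2`. -/
def IsRootless (L : Submodule ℤ V) : Prop :=
  ∀ x ∈ L, ⟪x, x⟫_ℝ ≠ 2

/-- The image of the lattice `L` under the isometry `f`. -/
def image (f : V ≃ₗᵢ[ℝ] V) (L : Submodule ℤ V) : Submodule ℤ V :=
  L.map (f.toLinearEquiv.toLinearMap.restrictScalars ℤ)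

/-- The `(-1)`-eigenlattice of the isometry `f` in the lattice `L`. -/
def negEigenlattice (f : V ≃ₗᵢ[ℝ] V) (L : Submodule ℤ V) : Submodule ℤ V where
  carrier := {x | x ∈ L ∧ f x = -x}
  add_mem' := fun {x y} hx hy =>
    ⟨L.add_mem hx.1 hy.1, by rw [map_add, hx.2, hy.2, neg_add]⟩
  zero_mem' := ⟨L.zero_mem, by simp⟩
  smul_mem' := fun c x hx => ⟨L.smul_mem c hx.1, by rw [map_zsmul, hx.2, smul_neg]⟩

/-- The set of `EE₈`-sublattices of the lattice `L`. -/
def ee8Sublattices (L : Submodule ℤ V) : Set (Submodule ℤ V) :=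
  {Y | Y ≤ L ∧ IsEE8 Y}

variable [FiniteDimensional ℝ V]

/-- The involution `t_L` of the ambient Euclidean space: it is `-1` on (the real span of) `L`
and `1` on the orthogonal complement of `L`. -/
noncomputable def invol (L : Submodule ℤ V) : V ≃ₗᵢ[ℝ] V :=
  (Submodule.span ℝ (L : Set V))ᗮ.reflection

theorem invol_apply_of_mem {L : Submodule ℤ V} {x : V} (hx : x ∈ L) : invol L x = -x :=
  Submodule.reflection_mem_subspace_orthogonal_precomplement_eq_neg
    (Submodule.subset_span hx)

theorem invol_apply_of_orthogonal {L : Submodule ℤ V} {x : V}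
    (hx : ∀ y ∈ L, ⟪y, x⟫_ℝ = 0) : invol L x = x := by
  refine Submodule.reflection_mem_subspace_eq_self ?_
  rw [Submodule.mem_orthogonal]
  intro y hy
  induction hy using Submodule.span_induction with
  | mem y hy => exact hx y hy
  | zero => simp
  | add y z _ _ h1 h2 => rw [inner_add_left, h1, h2, add_zero]
  | smul c y _ h => rw [inner_smul_left, h, mul_zero]

/-- `Q` is a lattice of type `DIH_n(k)`: an integral rootless lattice of rank `k` which is the
sum of two `EE₈`-sublattices whose involutions generate a dihedral group of order `n`.
(`DihedralGroup m` is the dihedral group of order `2 * m`.) -/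
def IsDIH (n k : ℕ) (Q : Submodule ℤ V) : Prop :=
  IsIntegral Q ∧ IsRootless Q ∧ Module.finrank ℤ Q = k ∧
    ∃ M N : Submodule ℤ V, IsEE8 M ∧ IsEE8 N ∧ M ⊔ N = Q ∧
      ∃ m : ℕ, n = 2 * m ∧
        Nonempty (Subgroup.closure {invol M, invol N} ≃* DihedralGroup m)

end EE8Lattice

/-! Throughout, a root means a vector of norm 4. The dual of a lattice `Y` isometric to √2E₈ is
`Y/2`. So if `Y` lies in an integral lattice `Q`, then `x - t_Y x` lies in `Y` for every `x` in `Q`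
(`sub_invol_mem`), and its norm is divisible by 4. Since `Q` is even without vectors of norm 2, it
follows that `Y` is primitive in `Q` (`mem_of_invol_eq_neg`), hence determined by its real span, and
that a root `x` of `Q` outside `Y` has `⟨x, t_Y x⟩` equal to 4, 2 or 0 (`mem_or_inner_invol`).

Let `g` have order 3 and be inverted by `t_M`. Each root of `M` is fixed by `g`, or is killed by `1
+ g + g²`, or is orthogonal to its image (`IsInvertedBy.root_cases`). In the cases that matter `g`
fixes a sublattice √2A₂ of `M` spanned by the highest root and the last simple root; the first six
simple roots form an E₆-system orthogonal to it, and `1 + g + g²` kills them.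

An unknown EE₈-sublattice `Y` is located as follows. Let `r` be a root of `M` killed by `1 + g + g²`
with `g²r - gr` in `3Q*`. The three vectors `gⁱ(g²r - gr)/3` have norm 4/3 and sum zero, and `t_Y`
permutes them (`invol_mem_triple`). So `Y` is orthogonal to every `gⁱr`, or for some `i` it contains
`gⁱr` and is orthogonal to `gⁱ(g²r - gr)`. Inner products in `Y` are even, which makes the type of
`Y` constant along a connected diagram of such roots (`typeAt_family`).

For DIH₆(14) the diagram is E₆. The orthogonal type is contradictory, and otherwise a power of `g`
carries `Y` to `M` (`exists_eq_image`).

For DIH₁₂(16) the diagram is the D₄ inside E₆ fixed by the involution `u`; it is common to `M` and a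
translate of `N`. The orthogonal type gives the eigenlattice `E`. Otherwise a translate of `Y`
contains D₄, and the √2A₂ of `M` or of `N` decides which of the two it is; avoiding both is
impossible (`eq_or_eq_of_centre_mem`). That `E` is an EE₈-lattice is shown by matching the
D₄-systems seen from `M` and `N` and gluing the two complementary D₄'s (`isFrame_eigen`). An
arbitrary pair with sum `Q'` meets trivially by rank, and among the sublattices found this forces
the product of the involutions to have order six (`IsSixPair.pow_of_inf_eq_bot`). -/

open scoped InnerProductSpace

namespace EE8Lattice

open Matrix

/-! ### Frames of √2E₈, dominance, and vectors of small norm. -/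

section Vec

variable {G : Type*} [AddCommGroup G]

/-- The integral combination of the vectors `b i` with coefficients `c i`. -/
def vec (b : Fin 8 → G) (c : Fin 8 → ℤ) : G := ∑ i, c i • b i

theorem vec_add (b : Fin 8 → G) (c d : Fin 8 → ℤ) : vec b (c + d) = vec b c + vec b d := by
  simp [vec, add_smul, Finset.sum_add_distrib]

theorem vec_sub (b : Fin 8 → G) (c d : Fin 8 → ℤ) : vec b (c - d) = vec b c - vec b d := by
  simp [vec, sub_smul, Finset.sum_sub_distrib]

theorem vec_smul (b : Fin 8 → G) (n : ℤ) (c : Fin 8 → ℤ) : vec b (n • c) = n • vec b c := by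
  simp [vec, mul_smul, Finset.smul_sum]

theorem vec_single (b : Fin 8 → G) (i : Fin 8) : vec b (Pi.single i 1) = b i := by
  simp [vec, Pi.single_apply]

theorem map_vec {W : Type*} [AddCommGroup W] {F : Type*} [FunLike F G W] [AddMonoidHomClass F G W]
    (f : F) (b : Fin 8 → G) (c : Fin 8 → ℤ) : f (vec b c) = ∑ i, c i • f (b i) := by
  simp [vec, map_sum, map_zsmul]

end Vec

variable {V : Type*} [NormedAddCommGroup V] [InnerProductSpace ℝ V]

/-- The inverse of the Cartan matrix of type `E₈`. -/
def cartanInv : Matrix (Fin 8) (Fin 8) ℤ :=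
  !![4, 5, 7, 10, 8, 6, 4, 2;
     5, 8, 10, 15, 12, 9, 6, 3;
     7, 10, 14, 20, 16, 12, 8, 4;
     10, 15, 20, 30, 24, 18, 12, 6;
     8, 12, 16, 24, 20, 15, 10, 5;
     6, 9, 12, 18, 15, 12, 8, 4;
     4, 6, 8, 12, 10, 8, 6, 3;
     2, 3, 4, 6, 5, 4, 3, 2]

theorem cartanInv_mul : cartanInv * CartanMatrix.E₈ = 1 := by decide +kernel

theorem mul_cartanInv : CartanMatrix.E₈ * cartanInv = 1 := by decide +kernel

theorem E₈_symm (i j : Fin 8) : CartanMatrix.E₈ i j = CartanMatrix.E₈ j i := by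
  have h : CartanMatrix.E₈ᵀ = CartanMatrix.E₈ := by decide +kernel
  exact (congrFun (congrFun h i) j).symm

theorem E₈_diag (i : Fin 8) : CartanMatrix.E₈ i i = 2 := by
  revert i; decide +kernel

/-- This bounds the norm of a dominant weight below by a multiple of the square of its coordinate
sum. -/
theorem two_le_cartanInv (i j : Fin 8) : 2 ≤ cartanInv i j := by
  have h : ∀ p : Fin 8 × Fin 8, 2 ≤ cartanInv p.1 p.2 := by decide +kernel
  exact h (i, j)

/-- Coordinates of the highest root of `E₈`. -/
def highest : Fin 8 → ℤ := ![2, 3, 4, 6, 5, 4, 3, 2]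

/-- `b` is a `ℤ`-basis of `M` whose Gram matrix is twice the Cartan matrix of type `E₈`. -/
structure IsFrame (b : Fin 8 → V) (M : Submodule ℤ V) : Prop where
  gram : ∀ i j, ⟪b i, b j⟫_ℝ = 2 * (CartanMatrix.E₈ i j : ℝ)
  span_eq : Submodule.span ℤ (Set.range b) = M

theorem inner_zsmul_left (n : ℤ) (x y : V) : ⟪n • x, y⟫_ℝ = n * ⟪x, y⟫_ℝ := by
  rw [← Int.cast_smul_eq_zsmul ℝ, real_inner_smul_left]

theorem inner_zsmul_right (n : ℤ) (x y : V) : ⟪x, n • y⟫_ℝ = n * ⟪x, y⟫_ℝ := by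
  rw [← Int.cast_smul_eq_zsmul ℝ, real_inner_smul_right]

theorem inner_vec_right (x : V) (b : Fin 8 → V) (c : Fin 8 → ℤ) :
    ⟪x, vec b c⟫_ℝ = ∑ i, (c i : ℝ) * ⟪x, b i⟫_ℝ := by
  simp [vec, inner_sum, inner_zsmul_right]

theorem inner_vec_weights {x : V} {b : Fin 8 → V} {l : Fin 8 → ℤ}
    (h : ∀ i, ⟪x, b i⟫_ℝ = 2 * (l i : ℝ)) (c : Fin 8 → ℤ) :
    ⟪x, vec b c⟫_ℝ = ((2 * (l ⬝ᵥ c) : ℤ) : ℝ) := by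
  rw [inner_vec_right]
  simp only [h, dotProduct]
  push_cast
  rw [Finset.mul_sum]
  exact Finset.sum_congr rfl fun i _ => by ring

namespace IsFrame

variable {b : Fin 8 → V} {M : Submodule ℤ V} (hb : IsFrame b M)
include hb

theorem mem_iff (x : V) : x ∈ M ↔ ∃ c, vec b c = x := by
  rw [← hb.span_eq, Submodule.mem_span_range_iff_exists_fun]
  rfl

theorem vec_mem (c : Fin 8 → ℤ) : vec b c ∈ M := (hb.mem_iff _).2 ⟨c, rfl⟩

theorem mem (i : Fin 8) : b i ∈ M := hb.span_eq ▸ Submodule.subset_span ⟨i, rfl⟩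

theorem inner_vec_basis (c : Fin 8 → ℤ) (j : Fin 8) :
    ⟪vec b c, b j⟫_ℝ = 2 * (((CartanMatrix.E₈ *ᵥ c) j : ℤ) : ℝ) := by
  rw [real_inner_comm, inner_vec_right]
  simp only [hb.gram, mulVec, dotProduct]
  push_cast
  rw [Finset.mul_sum]
  exact Finset.sum_congr rfl fun i _ => by ring

theorem inner_vec (c d : Fin 8 → ℤ) :
    ⟪vec b c, vec b d⟫_ℝ = ((2 * ((CartanMatrix.E₈ *ᵥ c) ⬝ᵥ d) : ℤ) : ℝ) :=
  inner_vec_weights (fun i => hb.inner_vec_basis c i) d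

theorem vec_injective : Function.Injective (vec b) := by
  intro c d h
  have : CartanMatrix.E₈ *ᵥ c = CartanMatrix.E₈ *ᵥ d := by
    ext j
    have h1 := hb.inner_vec_basis c j
    rw [h, hb.inner_vec_basis d j] at h1
    have : (2 : ℝ) ≠ 0 := two_ne_zero
    exact_mod_cast (mul_left_cancel₀ this h1).symm
  have h2 := congrArg (fun v => cartanInv *ᵥ v) this
  simpa [mulVec_mulVec, cartanInv_mul] using h2

theorem exists_weights {x : V} (hx : x ∈ M) :
    ∃ l : Fin 8 → ℤ, ∀ i, ⟪x, b i⟫_ℝ = 2 * (l i : ℝ) := by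
  obtain ⟨c, rfl⟩ := (hb.mem_iff x).1 hx
  exact ⟨_, fun i => hb.inner_vec_basis c i⟩

/-- The Cartan matrix of E₈ is unimodular, so integral labels recover the coordinates. -/
theorem eq_vec {x : V} (hx : x ∈ M) {l : Fin 8 → ℤ} (h : ∀ i, ⟪x, b i⟫_ℝ = 2 * (l i : ℝ)) :
    x = vec b (cartanInv *ᵥ l) := by
  obtain ⟨c, rfl⟩ := (hb.mem_iff x).1 hx
  have : CartanMatrix.E₈ *ᵥ c = l := by
    ext j
    have h1 := h j
    rw [hb.inner_vec_basis c j] at h1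
    exact_mod_cast (mul_left_cancel₀ (two_ne_zero' ℝ) h1)
  rw [← this, mulVec_mulVec, cartanInv_mul, one_mulVec]

theorem inner_self_eq {x : V} (hx : x ∈ M) {l : Fin 8 → ℤ}
    (h : ∀ i, ⟪x, b i⟫_ℝ = 2 * (l i : ℝ)) :
    ⟪x, x⟫_ℝ = ((2 * (l ⬝ᵥ cartanInv *ᵥ l) : ℤ) : ℝ) := by
  conv_lhs => rw [hb.eq_vec hx h]
  rw [← hb.eq_vec hx h, hb.eq_vec hx h, hb.inner_vec, mulVec_mulVec, mul_cartanInv, one_mulVec]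

theorem exists_even_inner {x y : V} (hx : x ∈ M) (hy : y ∈ M) : ∃ n : ℤ, ⟪x, y⟫_ℝ = 2 * n := by
  obtain ⟨l, hl⟩ := hb.exists_weights hx
  obtain ⟨c, rfl⟩ := (hb.mem_iff y).1 hy
  exact ⟨_, by rw [inner_vec_weights hl]; push_cast; rfl⟩

theorem exists_four_dvd {x : V} (hx : x ∈ M) : ∃ n : ℤ, ⟪x, x⟫_ℝ = 4 * n := by
  obtain ⟨c, rfl⟩ := (hb.mem_iff x).1 hx
  have key : (CartanMatrix.E₈ *ᵥ c) ⬝ᵥ c = 2 * (c 0 ^ 2 + c 1 ^ 2 + c 2 ^ 2 + c 3 ^ 2 + c 4 ^ 2 +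
      c 5 ^ 2 + c 6 ^ 2 + c 7 ^ 2 - c 0 * c 2 - c 1 * c 3 - c 2 * c 3 - c 3 * c 4 - c 4 * c 5 -
      c 5 * c 6 - c 6 * c 7) := by
    simp [CartanMatrix.E₈, mulVec, dotProduct, Fin.sum_univ_eight]
    ring
  obtain ⟨n, hn⟩ : ∃ n, (CartanMatrix.E₈ *ᵥ c) ⬝ᵥ c = 2 * n := ⟨_, key⟩
  refine ⟨n, ?_⟩
  rw [hb.inner_vec, hn]
  push_cast
  ring

theorem isEE8 : IsEE8 M := by
  have hli : LinearIndependent ℤ b := by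
    rw [Fintype.linearIndependent_iff]
    intro c hc i
    have : c = 0 := hb.vec_injective (by rw [vec, hc]; simp [vec])
    rw [this]; rfl
  obtain rfl := hb.span_eq
  refine ⟨Module.Basis.span hli, fun i j => ?_⟩
  rw [Module.Basis.span_apply, Module.Basis.span_apply]
  exact hb.gram i j

/-- Reflection of a frame in its `i`-th member. -/
theorem reflect (i : Fin 8) : IsFrame (fun j => b j - CartanMatrix.E₈ i j • b i) M := by
  constructor
  · intro j k
    simp only [inner_sub_left, inner_sub_right, inner_zsmul_left, inner_zsmul_right, hb.gram,
      E₈_diag]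
    rw [E₈_symm j i]
    push_cast
    ring
  · apply le_antisymm
    · rw [Submodule.span_le]
      rintro _ ⟨j, rfl⟩
      exact M.sub_mem (hb.mem j) (M.smul_mem _ (hb.mem i))
    · set N := Submodule.span ℤ (Set.range fun j => b j - CartanMatrix.E₈ i j • b i) with hN
      have h1 : ∀ j, b j - CartanMatrix.E₈ i j • b i ∈ N := fun j => Submodule.subset_span ⟨j, rfl⟩
      have h2 : b i ∈ N := by
        have := N.neg_mem (h1 i)
        rw [E₈_diag, two_smul] at this
        simpa using this
      rw [← hb.span_eq, Submodule.span_le]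
      rintro _ ⟨j, rfl⟩
      simpa using N.add_mem (h1 j) (N.smul_mem (CartanMatrix.E₈ i j) h2)

/-- Every lattice vector can be made dominant for the simple roots in `S` by changing the frame
by an element of the parabolic subgroup of the Weyl group attached to `S`. -/
theorem exists_dominant (S : Set (Fin 8)) {x : V} (hx : x ∈ M) :
    ∃ b', IsFrame b' M ∧ (∀ z, (∀ i ∈ S, ⟪z, b i⟫_ℝ = 0) → ∀ j, ⟪z, b' j⟫_ℝ = ⟪z, b j⟫_ℝ) ∧
      ∀ i ∈ S, 0 ≤ ⟪x, b' i⟫_ℝ := by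
  -- The Weyl vector, which has label 1 at every node. Its inner product with `x` is maximized over
  -- the frames that pair like `b` with the vectors orthogonal to the members in `S`.
  set ρ : Fin 8 → ℤ := ![46, 68, 91, 135, 110, 84, 57, 29] with hρ
  have hCρ : CartanMatrix.E₈ *ᵥ ρ = fun _ => 1 := by decide +kernel
  let P : ℤ → Prop := fun n => ∃ b', IsFrame b' M ∧
    (∀ z, (∀ i ∈ S, ⟪z, b i⟫_ℝ = 0) → ∀ j, ⟪z, b' j⟫_ℝ = ⟪z, b j⟫_ℝ) ∧ ⟪x, vec b' ρ⟫_ℝ = n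
  have hint : ∀ b', IsFrame b' M → ∃ n : ℤ, ⟪x, vec b' ρ⟫_ℝ = n := fun b' h' => by
    obtain ⟨l, hl⟩ := h'.exists_weights hx
    exact ⟨_, inner_vec_weights hl ρ⟩
  obtain ⟨n, ⟨b', hb', htr, hn⟩, hmax⟩ := Int.exists_greatest_of_bdd (P := P)
    ⟨⌈⟪x, x⟫_ℝ + 1240⌉, fun n ⟨b', hb', _, hn⟩ => by
      -- Expanding the norm of `x - ρ` bounds the inner products to be maximized.
      have h1 : ⟪vec b' ρ, vec b' ρ⟫_ℝ = 1240 := by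
        rw [hb'.inner_vec, hCρ]
        have : (fun _ => 1 : Fin 8 → ℤ) ⬝ᵥ ρ = 620 := by decide +kernel
        rw [this]; norm_num
      have h2 : 0 ≤ ⟪x - vec b' ρ, x - vec b' ρ⟫_ℝ := real_inner_self_nonneg
      rw [inner_sub_left, inner_sub_right, inner_sub_right, real_inner_comm x (vec b' ρ), hn, h1] at h2
      have h3 : 0 ≤ ⟪x, x⟫_ℝ := real_inner_self_nonneg
      have h4 : (n : ℝ) ≤ ⟪x, x⟫_ℝ + 1240 := by linarith
      exact_mod_cast h4.trans (Int.le_ceil _)⟩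
    (by
      obtain ⟨n, hn⟩ := hint b hb
      exact ⟨n, b, hb, fun _ _ _ => rfl, hn⟩)
  refine ⟨b', hb', htr, fun i hi => ?_⟩
  have hr := hb'.reflect i
  -- A simple reflection moves ρ to ρ minus the simple root, so maximality makes the inner product
  -- of `x` with that root nonnegative.
  have hvec : vec (fun j => b' j - CartanMatrix.E₈ i j • b' i) ρ = vec b' ρ - b' i := by
    have h1 : ∑ j, CartanMatrix.E₈ i j * ρ j = 1 := congrFun hCρ i
    simp only [vec, smul_sub, Finset.sum_sub_distrib, smul_smul]
    rw [← Finset.sum_smul]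
    simp only [mul_comm (ρ _)]
    rw [h1, one_smul]
  obtain ⟨m, hm⟩ := hint _ hr
  have hle := hmax m ⟨_, hr, fun z hz j => by
    rw [inner_sub_right, inner_zsmul_right, htr z hz i, hz i hi, mul_zero, sub_zero, htr z hz j], hm⟩
  rw [hvec, inner_sub_right, hn] at hm
  have : (m : ℝ) ≤ n := by exact_mod_cast hle
  linarith

end IsFrame

theorem isEE8_iff_exists_isFrame {M : Submodule ℤ V} : IsEE8 M ↔ ∃ b, IsFrame b M := by
  refine ⟨fun ⟨b, hb⟩ => ⟨fun i => (b i : V), hb, ?_⟩, fun ⟨b, hb⟩ => hb.isEE8⟩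
  have h := congrArg (Submodule.map M.subtype) b.span_eq
  rw [Submodule.map_span, ← Set.range_comp, Submodule.map_top, Submodule.range_subtype] at h
  exact h

theorem eq_zero_or_single_of_sum_le_one {n : ℕ} {l : Fin n → ℤ} (h0 : ∀ i, 0 ≤ l i)
    (h1 : ∑ i, l i ≤ 1) : l = 0 ∨ ∃ i, l = Pi.single i 1 := by
  by_cases h : l = 0
  · exact Or.inl h
  obtain ⟨i, hi⟩ := Function.ne_iff.1 h
  refine Or.inr ⟨i, ?_⟩
  have hi' : 1 ≤ l i := by have := h0 i; simp only [Pi.zero_apply] at hi; omega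
  have hs := Finset.add_sum_erase Finset.univ l (Finset.mem_univ i)
  have hz : ∑ j ∈ Finset.univ.erase i, l j = 0 :=
    le_antisymm (by omega) (Finset.sum_nonneg fun j _ => h0 j)
  ext j
  by_cases hj : j = i
  · subst hj; rw [Pi.single_eq_same]; omega
  · rw [Pi.single_eq_of_ne hj]
    exact (Finset.sum_eq_zero_iff_of_nonneg (fun j _ => h0 j)).1 hz j (by simp [hj])

/-- A dominant weight of norm at most `6` is zero or fundamental. -/
theorem weight_eq_zero_or_single {l : Fin 8 → ℤ} (h0 : ∀ i, 0 ≤ l i)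
    (h6 : l ⬝ᵥ cartanInv *ᵥ l ≤ 6) : l = 0 ∨ ∃ i, l = Pi.single i 1 := by
  apply eq_zero_or_single_of_sum_le_one h0
  -- A coordinate sum of 2 would already give norm at least 8 here, beyond the allowed 6.
  have h1 : 2 * (∑ i, l i) * (∑ j, l j) ≤ l ⬝ᵥ cartanInv *ᵥ l := by
    simp only [mulVec, dotProduct, Finset.mul_sum, Finset.sum_mul]
    rw [Finset.sum_comm]
    refine Finset.sum_le_sum fun i _ => Finset.sum_le_sum fun j _ => ?_
    have := mul_nonneg (mul_nonneg (h0 i) (h0 j)) (sub_nonneg.2 (two_le_cartanInv i j))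
    linarith
  nlinarith [Finset.sum_nonneg fun i (_ : i ∈ Finset.univ) => h0 i]

namespace IsFrame

variable {b : Fin 8 → V} {M : Submodule ℤ V} (hb : IsFrame b M)
include hb

/-- A vector of norm at most `12` is zero or a fundamental weight for a suitable frame. -/
theorem exists_fundamental {x : V} (hx : x ∈ M) (h12 : ⟪x, x⟫_ℝ ≤ 12) (hx0 : x ≠ 0) :
    ∃ b', IsFrame b' M ∧ ∃ i, ⟪x, x⟫_ℝ = 2 * (cartanInv i i : ℝ) ∧
      ∀ j, ⟪x, b' j⟫_ℝ = 2 * ((Pi.single i 1 : Fin 8 → ℤ) j : ℝ) := by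
  obtain ⟨b', hb', -, hdom⟩ := hb.exists_dominant Set.univ hx
  obtain ⟨l, hl⟩ := hb'.exists_weights hx
  have hn := hb'.inner_self_eq hx hl
  have h0 : ∀ i, 0 ≤ l i := fun i => by
    have := hdom i trivial
    rw [hl] at this
    exact_mod_cast (by linarith : (0 : ℝ) ≤ l i)
  rw [hn] at h12
  have h6 : l ⬝ᵥ cartanInv *ᵥ l ≤ 6 := by
    have : 2 * (l ⬝ᵥ cartanInv *ᵥ l) ≤ 12 := by exact_mod_cast h12
    omega
  rcases weight_eq_zero_or_single h0 h6 with rfl | ⟨i, rfl⟩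
  · refine absurd ?_ hx0
    rw [hb'.eq_vec hx hl]; simp [vec]
  · refine ⟨b', hb', i, ?_, hl⟩
    rw [hn]
    simp

/-- Node 0 is the only one with diagonal entry 4 in the inverse Cartan matrix. -/
theorem exists_eq_weight_zero {x : V} (hx : x ∈ M) (h8 : ⟪x, x⟫_ℝ = 8) :
    ∃ b', IsFrame b' M ∧ ∀ j, ⟪x, b' j⟫_ℝ = 2 * ((Pi.single 0 1 : Fin 8 → ℤ) j : ℝ) := by
  obtain ⟨b', hb', i, hi, h⟩ := hb.exists_fundamental hx (by rw [h8]; norm_num)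
    (by rintro rfl; norm_num at h8)
  rw [h8] at hi
  have hi' : cartanInv i i = 4 := by exact_mod_cast (by linarith : (cartanInv i i : ℝ) = 4)
  have : i = 0 := by clear hi h; revert i; decide +kernel
  subst this
  exact ⟨b', hb', h⟩

theorem exists_eq_weight_six {x : V} (hx : x ∈ M) (h12 : ⟪x, x⟫_ℝ = 12) :
    ∃ b', IsFrame b' M ∧ ∀ j, ⟪x, b' j⟫_ℝ = 2 * ((Pi.single 6 1 : Fin 8 → ℤ) j : ℝ) := by
  obtain ⟨b', hb', i, hi, h⟩ := hb.exists_fundamental hx h12.le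
    (by rintro rfl; norm_num at h12)
  rw [h12] at hi
  have hi' : cartanInv i i = 6 := by exact_mod_cast (by linarith : (cartanInv i i : ℝ) = 6)
  have : i = 6 := by clear hi h; revert i; decide +kernel
  subst this
  exact ⟨b', hb', h⟩

theorem inner_highest_self : ⟪vec b highest, vec b highest⟫_ℝ = 4 := by
  rw [hb.inner_vec]
  have : (CartanMatrix.E₈ *ᵥ highest) ⬝ᵥ highest = 2 := by decide +kernel
  rw [this]; norm_num

theorem inner_basis_self (i : Fin 8) : ⟪b i, b i⟫_ℝ = 4 := by
  rw [hb.gram, E₈_diag]; norm_num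

theorem inner_highest_basis (j : Fin 8) :
    ⟪vec b highest, b j⟫_ℝ = 2 * ((Pi.single 7 1 : Fin 8 → ℤ) j : ℝ) := by
  rw [hb.inner_vec_basis]
  have : CartanMatrix.E₈ *ᵥ highest = Pi.single 7 1 := by decide +kernel
  rw [this]

/-- A vector of norm 12 is the fundamental weight at node 6 for some frame, and the highest root has
coefficient 3 there. -/
theorem exists_root_inner_eq_six {x : V} (hx : x ∈ M) (h12 : ⟪x, x⟫_ℝ = 12) :
    ∃ r ∈ M, ⟪r, r⟫_ℝ = 4 ∧ ⟪x, r⟫_ℝ = 6 := by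
  obtain ⟨b', hb', h⟩ := hb.exists_eq_weight_six hx h12
  refine ⟨vec b' highest, hb'.vec_mem _, hb'.inner_highest_self, ?_⟩
  rw [inner_vec_weights h]
  have : (Pi.single 6 1 : Fin 8 → ℤ) ⬝ᵥ highest = 3 := by decide +kernel
  rw [this]; norm_num

end IsFrame

end EE8Lattice

/-! ### EE₈-sublattices of even lattices without vectors of norm 2. -/

open scoped InnerProductSpace

namespace EE8Lattice

open Matrix

variable {V : Type*} [NormedAddCommGroup V] [InnerProductSpace ℝ V]

/-- An even integral lattice without vectors of norm `2`. -/
structure IsGood (Q : Submodule ℤ V) : Prop where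
  integral : IsIntegral Q
  even : ∀ x ∈ Q, ∃ n : ℤ, ⟪x, x⟫_ℝ = 2 * n
  rootless : IsRootless Q

theorem inner_sub_self (x y : V) :
    ⟪x - y, x - y⟫_ℝ = ⟪x, x⟫_ℝ - 2 * ⟪x, y⟫_ℝ + ⟪y, y⟫_ℝ := real_inner_sub_sub_self x y

theorem inner_add_self (x y : V) :
    ⟪x + y, x + y⟫_ℝ = ⟪x, x⟫_ℝ + 2 * ⟪x, y⟫_ℝ + ⟪y, y⟫_ℝ := real_inner_add_add_self x y

theorem isGood_sup {M N : Submodule ℤ V} (hM : IsEE8 M) (hN : IsEE8 N)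
    (hi : IsIntegral (M ⊔ N)) (hr : IsRootless (M ⊔ N)) : IsGood (M ⊔ N) := by
  refine ⟨hi, fun x hx => ?_, hr⟩
  obtain ⟨b, hb⟩ := isEE8_iff_exists_isFrame.1 hM
  obtain ⟨c, hc⟩ := isEE8_iff_exists_isFrame.1 hN
  obtain ⟨m, hm, n, hn, rfl⟩ := Submodule.mem_sup.1 hx
  obtain ⟨k, hk⟩ := hi m (Submodule.mem_sup_left hm) n (Submodule.mem_sup_right hn)
  obtain ⟨i, hi⟩ := hb.exists_four_dvd hm
  obtain ⟨j, hj⟩ := hc.exists_four_dvd hn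
  exact ⟨2 * i + k + 2 * j, by rw [inner_add_self, hi, hj, hk]; push_cast; ring⟩

theorem linearIndependent_of_isFrame {b : Fin 8 → V} {M : Submodule ℤ V} (hb : IsFrame b M) :
    LinearIndependent ℝ b := by
  rw [Fintype.linearIndependent_iff]
  intro a ha
  have h1 : a ᵥ* CartanMatrix.E₈.map (Int.cast : ℤ → ℝ) = 0 := by
    ext j
    have h := congrArg (fun x => ⟪x, b j⟫_ℝ) ha
    simp only [sum_inner, real_inner_smul_left, hb.gram, inner_zero_left] at h
    have h2 : ∑ i, a i * (CartanMatrix.E₈ i j : ℝ) = 0 := by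
      have h3 : 2 * ∑ i, a i * (CartanMatrix.E₈ i j : ℝ) = 0 := by
        rw [Finset.mul_sum, ← h]
        exact Finset.sum_congr rfl fun i _ => by ring
      linarith
    simpa [vecMul, dotProduct] using h2
  have h2 : CartanMatrix.E₈.map (Int.cast : ℤ → ℝ) * cartanInv.map (Int.cast : ℤ → ℝ) = 1 := by
    have := congrArg (fun A => Matrix.map A (Int.castRingHom ℝ)) mul_cartanInv
    rw [Matrix.map_mul] at this
    simpa using this
  have h3 : a = 0 := by
    have := congrArg (fun v => v ᵥ* cartanInv.map (Int.cast : ℤ → ℝ)) h1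
    simpa [vecMul_vecMul, h2] using this
  exact fun i => congrFun h3 i

theorem IsFrame.span_real {b : Fin 8 → V} {M : Submodule ℤ V} (hb : IsFrame b M) :
    Submodule.span ℝ (M : Set V) = Submodule.span ℝ (Set.range b) := by
  rw [← hb.span_eq]
  apply le_antisymm
  · rw [Submodule.span_le]
    exact Submodule.span_le_restrictScalars ℤ ℝ (Set.range b)
  · exact Submodule.span_mono Submodule.subset_span

theorem finrank_span_real {M : Submodule ℤ V} (hM : IsEE8 M) :
    Module.finrank ℝ (Submodule.span ℝ (M : Set V)) = 8 := by
  obtain ⟨b, hb⟩ := isEE8_iff_exists_isFrame.1 hM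
  rw [hb.span_real, finrank_span_eq_card (linearIndependent_of_isFrame hb)]
  simp

theorem mem_image {f : V ≃ₗᵢ[ℝ] V} {L : Submodule ℤ V} {y : V} :
    y ∈ image f L ↔ ∃ x ∈ L, f x = y := Iff.rfl

theorem mem_image_of_mem (f : V ≃ₗᵢ[ℝ] V) {L : Submodule ℤ V} {x : V} (hx : x ∈ L) :
    f x ∈ image f L := ⟨x, hx, rfl⟩

theorem image_one (L : Submodule ℤ V) : image 1 L = L := by
  ext x; simp [mem_image]

theorem image_mul (f g : V ≃ₗᵢ[ℝ] V) (L : Submodule ℤ V) :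
    image (f * g) L = image f (image g L) := by
  ext x; simp [mem_image]

theorem IsFrame.image {b : Fin 8 → V} {M : Submodule ℤ V} (hb : IsFrame b M) (f : V ≃ₗᵢ[ℝ] V) :
    IsFrame (fun i => f (b i)) (image f M) := by
  refine ⟨fun i j => by rw [f.inner_map_map, hb.gram], ?_⟩
  rw [EE8Lattice.image, ← hb.span_eq, Submodule.map_span, ← Set.range_comp]
  rfl

theorem IsEE8.image {M : Submodule ℤ V} (hM : IsEE8 M) (f : V ≃ₗᵢ[ℝ] V) : IsEE8 (image f M) := by
  obtain ⟨b, hb⟩ := isEE8_iff_exists_isFrame.1 hM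
  exact (hb.image f).isEE8

variable [FiniteDimensional ℝ V]

theorem invol_invol (M : Submodule ℤ V) (x : V) : invol M (invol M x) = x :=
  Submodule.reflection_reflection _ x

theorem invol_mul_self (M : Submodule ℤ V) : invol M * invol M = 1 :=
  Submodule.reflection_mul_reflection _

theorem inner_invol (M : Submodule ℤ V) (x y : V) : ⟪invol M x, y⟫_ℝ = ⟪x, invol M y⟫_ℝ := by
  conv_lhs => rw [← invol_invol M y]
  rw [LinearIsometryEquiv.inner_map_map]

theorem invol_eq_neg_iff {M : Submodule ℤ V} {x : V} :
    invol M x = -x ↔ x ∈ Submodule.span ℝ (M : Set V) := by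
  rw [invol, Submodule.reflection_orthogonal_apply, neg_inj, Submodule.reflection_eq_self_iff]

theorem inner_eq_zero_of_invol {M : Submodule ℤ V} {x y : V} (hx : invol M x = -x)
    (hy : invol M y = y) : ⟪x, y⟫_ℝ = 0 := by
  have h := inner_invol M x y
  rw [hx, hy, inner_neg_left] at h
  linarith

theorem invol_image (f : V ≃ₗᵢ[ℝ] V) (M : Submodule ℤ V) (x : V) :
    invol (image f M) (f x) = f (invol M x) := by
  have h1 : invol (image f M) (f (x - invol M x)) = -f (x - invol M x) := by
    have h2 : x - invol M x ∈ Submodule.span ℝ (M : Set V) := by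
      rw [← invol_eq_neg_iff, map_sub, invol_invol, neg_sub]
    rw [invol_eq_neg_iff]
    have h3 := Submodule.mem_map_of_mem (f := f.toLinearEquiv.toLinearMap) h2
    rw [Submodule.map_span] at h3
    exact h3
  have h4 : invol (image f M) (f (x + invol M x)) = f (x + invol M x) := by
    refine invol_apply_of_orthogonal ?_
    rintro _ ⟨m, hm, rfl⟩
    change ⟪f m, f (x + invol M x)⟫_ℝ = 0
    rw [LinearIsometryEquiv.inner_map_map]
    refine inner_eq_zero_of_invol (invol_apply_of_mem hm) ?_
    rw [map_add, invol_invol, add_comm]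
  have h5 := congrArg₂ (· + ·) h1 h4
  simp only [← map_add, ← map_neg] at h5
  have h6 : x - invol M x + (x + invol M x) = (2 : ℝ) • x := by module
  have h7 : -(x - invol M x) + (x + invol M x) = (2 : ℝ) • invol M x := by module
  rw [h6, h7, map_smul, map_smul, map_smul] at h5
  exact smul_right_injective V (two_ne_zero' ℝ) h5

/-- `x - t_M x` is twice the projection of `x` to the span of `M`. That projection lies in the dual
of `M`, which is `M/2`. -/
theorem sub_invol_mem {M : Submodule ℤ V} (hM : IsEE8 M) {x : V}
    (hx : ∀ m ∈ M, ∃ n : ℤ, ⟪x, m⟫_ℝ = n) : x - invol M x ∈ M := by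
  obtain ⟨b, hb⟩ := isEE8_iff_exists_isFrame.1 hM
  choose l hl using fun i => hx (b i) (hb.mem i)
  set z := vec b (cartanInv *ᵥ l) with hz
  have hzb : ∀ i, ⟪z, b i⟫_ℝ = 2 * l i := fun i => by
    rw [hz, hb.inner_vec_basis, mulVec_mulVec, mul_cartanInv, one_mulVec]
  have hzM : z ∈ M := hb.vec_mem _
  have h1 : invol M (x - (1 / 2 : ℝ) • z) = x - (1 / 2 : ℝ) • z := by
    refine invol_apply_of_orthogonal fun y hy => ?_
    obtain ⟨c, rfl⟩ := (hb.mem_iff y).1 hy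
    rw [real_inner_comm, inner_vec_right]
    refine Finset.sum_eq_zero fun i _ => ?_
    rw [inner_sub_left, real_inner_smul_left, hzb, hl]
    ring
  rw [map_sub, map_smul, invol_apply_of_mem hzM] at h1
  have h2 : x - invol M x = z := by
    have h3 : invol M x = x - (1 / 2 : ℝ) • z + (1 / 2 : ℝ) • -z := by rw [← h1]; abel
    rw [h3]; module
  rw [h2]; exact hzM

theorem sub_invol_mem_of_mem {Q M : Submodule ℤ V} (hQ : IsIntegral Q) (hM : IsEE8 M)
    (hMQ : M ≤ Q) {x : V} (hx : x ∈ Q) : x - invol M x ∈ M :=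
  sub_invol_mem hM fun m hm => hQ x hx m (hMQ hm)

theorem invol_mem {Q M : Submodule ℤ V} (hQ : IsIntegral Q) (hM : IsEE8 M)
    (hMQ : M ≤ Q) {x : V} (hx : x ∈ Q) : invol M x ∈ Q := by
  have := Q.sub_mem hx (hMQ (sub_invol_mem_of_mem hQ hM hMQ hx))
  simpa using this

/-- An `EE₈`-sublattice of an even integral rootless lattice is primitive. -/
theorem mem_of_invol_eq_neg {Q M : Submodule ℤ V} (hQ : IsGood Q) (hM : IsEE8 M) (hMQ : M ≤ Q)
    {x : V} (hx : x ∈ Q) (h : invol M x = -x) : x ∈ M := by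
  classical
  obtain ⟨b, hb⟩ := isEE8_iff_exists_isFrame.1 hM
  have hev : ∀ z ∈ Q, ∃ n : ℕ, ⟪z, z⟫_ℝ = 2 * n := fun z hz => by
    obtain ⟨n, hn⟩ := hQ.even z hz
    have h0 : 0 ≤ ⟪z, z⟫_ℝ := real_inner_self_nonneg
    rw [hn] at h0
    have h1 : 0 ≤ n := by exact_mod_cast (by linarith : (0 : ℝ) ≤ n)
    lift n to ℕ using h1
    exact ⟨n, by exact_mod_cast hn⟩
  -- Choose a vector `z` of least norm in the coset `x + M`. Its double lies in `M`.
  have hex : ∃ n : ℕ, ∃ m ∈ M, ⟪x + m, x + m⟫_ℝ = 2 * n := by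
    obtain ⟨n, hn⟩ := hev x hx
    exact ⟨n, 0, M.zero_mem, by rwa [add_zero]⟩
  obtain ⟨m, hm, hn⟩ := Nat.find_spec hex
  have hmin := fun n => Nat.find_min' hex (m := n)
  set n := Nat.find hex
  set z := x + m with hz
  have hzQ : z ∈ Q := Q.add_mem hx (hMQ hm)
  have hzneg : invol M z = -z := by rw [hz, map_add, h, invol_apply_of_mem hm]; abel
  have h2z : z + z ∈ M := by
    have := sub_invol_mem_of_mem hQ.integral hM hMQ hzQ
    rwa [hzneg, sub_neg_eq_add] at this
  obtain ⟨b', hb', -, hdom⟩ := hb.exists_dominant Set.univ h2z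
  obtain ⟨l, hl⟩ := hb'.exists_weights h2z
  have h0 : ∀ i, 0 ≤ l i := fun i => by
    have := hdom i trivial
    rw [hl] at this
    exact_mod_cast (by linarith : (0 : ℝ) ≤ l i)
  -- Subtracting the highest root cannot shorten `z`.
  have hθ : ⟪z + z, vec b' highest⟫_ℝ ≤ 4 := by
    have hmem : z - vec b' highest ∈ Q := Q.sub_mem hzQ (hMQ (hb'.vec_mem _))
    obtain ⟨k, hk⟩ := hev _ hmem
    have h1 := hmin k ⟨m - vec b' highest, M.sub_mem hm (hb'.vec_mem _), by
      rw [← add_sub_assoc]; exact hk⟩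
    have h2 : (n : ℝ) ≤ k := by exact_mod_cast h1
    rw [inner_sub_self, hn, hb'.inner_highest_self] at hk
    rw [inner_add_left]
    linarith
  rw [inner_vec_weights hl] at hθ
  have hθ' : l ⬝ᵥ highest ≤ 2 := by
    have : 2 * (l ⬝ᵥ highest) ≤ 4 := by exact_mod_cast hθ
    omega
  have hsum : ∑ i, l i ≤ 1 := by
    have : ∑ i, l i * 2 ≤ l ⬝ᵥ highest := Finset.sum_le_sum fun i _ =>
      mul_le_mul_of_nonneg_left (by revert i; decide +kernel) (h0 i)
    rw [← Finset.sum_mul] at this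
    omega
  have hzz : ⟪z + z, z + z⟫_ℝ = 4 * ⟪z, z⟫_ℝ := by rw [inner_add_self]; ring
  have hnorm := hb'.inner_self_eq h2z hl
  rcases eq_zero_or_single_of_sum_le_one h0 hsum with rfl | ⟨i, rfl⟩
  · have : ⟪z, z⟫_ℝ = 0 := by
      rw [hzz] at hnorm
      simp at hnorm
      simp [hnorm]
    rw [inner_self_eq_zero] at this
    have : x = -m := by rw [eq_neg_iff_add_eq_zero, ← hz, this]
    rw [this]; exact M.neg_mem hm
  · exfalso
    -- Only nodes 0 and 7 have coefficient 2 in the highest root. They would give `z` norm 2, which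
    -- is excluded, or norm 1, which is odd.
    have hi : i = 0 ∨ i = 7 := by
      clear hnorm hθ hl h0 hsum
      revert i; decide +kernel
    rcases hi with rfl | rfl
    · have h1 : (Pi.single 0 1 : Fin 8 → ℤ) ⬝ᵥ cartanInv *ᵥ Pi.single 0 1 = 4 := by decide +kernel
      rw [hzz, h1] at hnorm
      refine hQ.rootless z hzQ ?_
      push_cast at hnorm; linarith
    · have h1 : (Pi.single 7 1 : Fin 8 → ℤ) ⬝ᵥ cartanInv *ᵥ Pi.single 7 1 = 2 := by decide +kernel
      rw [hzz, h1, hn] at hnorm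
      have : (4 * (2 * n) : ℤ) = 2 * 2 := by exact_mod_cast hnorm
      omega

/-- Primitivity gives `Y ≤ M`. Both spans have dimension 8, so they agree, and primitivity of `Y`
gives equality. -/
theorem eq_of_forall_invol_eq_neg {Q M Y : Submodule ℤ V} (hQ : IsGood Q) (hM : IsEE8 M)
    (hMQ : M ≤ Q) (hY : IsEE8 Y) (hYQ : Y ≤ Q) (h : ∀ y ∈ Y, invol M y = -y) : Y = M := by
  have hle : Y ≤ M := fun y hy => mem_of_invol_eq_neg hQ hM hMQ (hYQ hy) (h y hy)
  have hspan : Submodule.span ℝ (Y : Set V) = Submodule.span ℝ (M : Set V) :=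
    Submodule.eq_of_le_of_finrank_eq (Submodule.span_mono hle)
      (by rw [finrank_span_real hY, finrank_span_real hM])
  refine le_antisymm hle fun m hm => mem_of_invol_eq_neg hQ hY hYQ (hMQ hm) ?_
  rw [invol_eq_neg_iff, hspan]
  exact Submodule.subset_span hm

theorem eq_of_invol_eq {Q M Y : Submodule ℤ V} (hQ : IsGood Q) (hM : IsEE8 M)
    (hMQ : M ≤ Q) (hY : IsEE8 Y) (hYQ : Y ≤ Q) (h : invol Y = invol M) : Y = M :=
  eq_of_forall_invol_eq_neg hQ hM hMQ hY hYQ fun y hy => by rw [← h, invol_apply_of_mem hy]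

/-- A frame of `M` all of whose members lie in the real span of `Y` forces `Y = M`. -/
theorem IsFrame.eq_of_mem_span {Q M Y : Submodule ℤ V} {b : Fin 8 → V} (hb : IsFrame b M)
    (hQ : IsGood Q) (hMQ : M ≤ Q) (hY : IsEE8 Y) (hYQ : Y ≤ Q)
    (h : ∀ i, b i ∈ Submodule.span ℝ (Y : Set V)) : Y = M := by
  refine (eq_of_forall_invol_eq_neg hQ hY hYQ hb.isEE8 hMQ fun m hm => ?_).symm
  rw [invol_eq_neg_iff]
  obtain ⟨c, rfl⟩ := (hb.mem_iff m).1 hm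
  refine Submodule.sum_mem _ fun i _ => ?_
  rw [← Int.cast_smul_eq_zsmul ℝ]
  exact Submodule.smul_mem _ _ (h i)

/-- `x - t_Y x` lies in `Y` and has norm 0, 4, 8, 12 or 16. Norm 16 means that `x` is in `Y`. In the
case of norm 12 some root `r` of `Y` has `⟨x, r⟩ = 3`, and then `x - r` has norm 2. -/
theorem mem_or_inner_invol {Q Y : Submodule ℤ V} (hQ : IsGood Q) (hY : IsEE8 Y) (hYQ : Y ≤ Q)
    {x : V} (hx : x ∈ Q) (h4 : ⟪x, x⟫_ℝ = 4) :
    x ∈ Y ∨ ⟪x, invol Y x⟫_ℝ = 4 ∨ ⟪x, invol Y x⟫_ℝ = 2 ∨ ⟪x, invol Y x⟫_ℝ = 0 := by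
  obtain ⟨b, hb⟩ := isEE8_iff_exists_isFrame.1 hY
  have hy := sub_invol_mem_of_mem hQ.integral hY hYQ hx
  obtain ⟨n, hn⟩ := hb.exists_four_dvd hy
  have ht : ⟪invol Y x, invol Y x⟫_ℝ = 4 := by rw [LinearIsometryEquiv.inner_map_map, h4]
  have hn' := hn
  rw [inner_sub_self, h4, ht] at hn
  have hsum : ⟪x + invol Y x, x + invol Y x⟫_ℝ = 8 + 2 * ⟪x, invol Y x⟫_ℝ := by
    rw [inner_add_self, h4, ht]; ring
  have h1 : 0 ≤ ⟪x + invol Y x, x + invol Y x⟫_ℝ := real_inner_self_nonneg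
  have h2 : 0 ≤ ⟪x - invol Y x, x - invol Y x⟫_ℝ := real_inner_self_nonneg
  have hn0 : 0 ≤ n := by exact_mod_cast (by linarith : (0 : ℝ) ≤ n)
  have hn4 : n ≤ 4 := by exact_mod_cast (by linarith : (n : ℝ) ≤ 4)
  interval_cases n
  · right; left; push_cast at hn; linarith
  · right; right; left; push_cast at hn; linarith
  · right; right; right; push_cast at hn; linarith
  · exfalso
    obtain ⟨r, hr, hr4, hr6⟩ := hb.exists_root_inner_eq_six hy (by rw [hn']; norm_num)
    rw [inner_sub_left, inner_invol, invol_apply_of_mem hr, inner_neg_right] at hr6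
    refine hQ.rootless (x - r) (Q.sub_mem hx (hYQ hr)) ?_
    rw [inner_sub_self, h4, hr4]
    linarith
  · left
    refine mem_of_invol_eq_neg hQ hY hYQ hx ?_
    have : ⟪x + invol Y x, x + invol Y x⟫_ℝ = 0 := by push_cast at hn; linarith
    rw [inner_self_eq_zero] at this
    exact (neg_eq_of_add_eq_zero_right this).symm

/-- A root outside `Y` has a projection to the span of `Y` of norm at most 2; the rest is
Cauchy–Schwarz. -/
theorem mem_of_lt_inner_sq {Q Y : Submodule ℤ V} (hQ : IsGood Q) (hY : IsEE8 Y) (hYQ : Y ≤ Q)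
    {x a : V} (hx : x ∈ Q) (h4 : ⟪x, x⟫_ℝ = 4) (ha : a ∈ Submodule.span ℝ (Y : Set V))
    (h : 2 * ⟪a, a⟫_ℝ < ⟪x, a⟫_ℝ ^ 2) : x ∈ Y := by
  rcases mem_or_inner_invol hQ hY hYQ hx h4 with hxY | hxt
  · exact hxY
  exfalso
  have ht : ⟪invol Y x, invol Y x⟫_ℝ = 4 := by rw [LinearIsometryEquiv.inner_map_map, h4]
  have h1 : ⟪x - invol Y x, a⟫_ℝ = 2 * ⟪x, a⟫_ℝ := by
    rw [inner_sub_left, inner_invol, invol_eq_neg_iff.2 ha, inner_neg_right]; ring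
  have h2 : ⟪x - invol Y x, x - invol Y x⟫_ℝ ≤ 8 := by
    rw [inner_sub_self, h4, ht]
    rcases hxt with h | h | h <;> rw [h] <;> norm_num
  have h3 := real_inner_mul_inner_self_le (x - invol Y x) a
  rw [h1] at h3
  have h5 : 0 ≤ ⟪a, a⟫_ℝ := real_inner_self_nonneg
  nlinarith

/-- Here `f/2` pairs integrally with `Y`, so `(f - t_Y f)/2` lies in `Y`. Its norm is at most 4 and
divisible by 4. -/
theorem invol_eq_or_eq_neg {Q Y : Submodule ℤ V} (hY : IsEE8 Y) (hYQ : Y ≤ Q) {f : V}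
    (h4 : ⟪f, f⟫_ℝ = 4) (hf : ∀ q ∈ Q, ∃ n : ℤ, ⟪f, q⟫_ℝ = 2 * n) :
    invol Y f = f ∨ invol Y f = -f := by
  obtain ⟨b, hb⟩ := isEE8_iff_exists_isFrame.1 hY
  have hy : (1 / 2 : ℝ) • f - invol Y ((1 / 2 : ℝ) • f) ∈ Y := sub_invol_mem hY fun m hm => by
    obtain ⟨n, hn⟩ := hf m (hYQ hm)
    exact ⟨n, by rw [real_inner_smul_left, hn]; ring⟩
  obtain ⟨n, hn⟩ := hb.exists_four_dvd hy
  have ht : ⟪invol Y f, invol Y f⟫_ℝ = 4 := by rw [LinearIsometryEquiv.inner_map_map, h4]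
  have h1 : 0 ≤ ⟪f + invol Y f, f + invol Y f⟫_ℝ := real_inner_self_nonneg
  have h2 : 0 ≤ ⟪f - invol Y f, f - invol Y f⟫_ℝ := real_inner_self_nonneg
  have h3 : 0 = ⟪f + invol Y f, f + invol Y f⟫_ℝ → invol Y f = -f := fun h => by
    rw [eq_comm, inner_self_eq_zero] at h
    exact (neg_eq_of_add_eq_zero_right h).symm
  have h5 : 0 = ⟪f - invol Y f, f - invol Y f⟫_ℝ → invol Y f = f := fun h => by
    rw [eq_comm, inner_self_eq_zero, sub_eq_zero] at h
    exact h.symm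
  rw [map_smul, ← smul_sub, real_inner_smul_left, real_inner_smul_right] at hn
  rw [inner_sub_self, h4, ht] at hn h2 h5
  rw [inner_add_self, h4, ht] at h1 h3
  have hn0 : -1 < n := by exact_mod_cast (by push_cast; linarith : ((-1 : ℤ) : ℝ) < n)
  have hn1 : n < 2 := by exact_mod_cast (by push_cast; linarith : (n : ℝ) < (2 : ℤ))
  have : n = 0 ∨ n = 1 := by omega
  rcases this with rfl | rfl
  · left; apply h5; push_cast at hn; linarith
  · right; apply h3; push_cast at hn; linarith

/-- Put `w = t_Y v₀`. The norm of `v₀ - w` is at most 16/3 and divisible by 4, so it is 0 or 4. If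
it is 4, the norms of `w - v₁` and `w - v₂` are even with sum 4, and neither can be 2, so one of
them is 0. -/
theorem invol_mem_triple {Q Y : Submodule ℤ V} (hQ : IsGood Q) (hY : IsEE8 Y) (hYQ : Y ≤ Q)
    {v₀ v₁ v₂ : V} (hv : v₀ + v₁ + v₂ = 0) (h₀ : ⟪v₀, v₀⟫_ℝ = 4 / 3) (h₁ : ⟪v₁, v₁⟫_ℝ = 4 / 3)
    (h₂ : ⟪v₂, v₂⟫_ℝ = 4 / 3) (hint : ∀ q ∈ Q, ∃ n : ℤ, ⟪v₀, q⟫_ℝ = n)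
    (h₀₁ : v₀ - v₁ ∈ Q) (h₀₂ : v₀ - v₂ ∈ Q) :
    invol Y v₀ = v₀ ∨ invol Y v₀ = v₁ ∨ invol Y v₀ = v₂ := by
  obtain ⟨b, hb⟩ := isEE8_iff_exists_isFrame.1 hY
  have hy : v₀ - invol Y v₀ ∈ Y := sub_invol_mem hY fun m hm => hint m (hYQ hm)
  obtain ⟨n, hn⟩ := hb.exists_four_dvd hy
  have ht : ⟪invol Y v₀, invol Y v₀⟫_ℝ = 4 / 3 := by rw [LinearIsometryEquiv.inner_map_map, h₀]
  set w := invol Y v₀ with hw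
  have h1 : 0 ≤ ⟪v₀ + w, v₀ + w⟫_ℝ := real_inner_self_nonneg
  have h2 : 0 ≤ ⟪v₀ - w, v₀ - w⟫_ℝ := real_inner_self_nonneg
  have hwv : ∀ v, ⟪w - v, w - v⟫_ℝ = 0 → w = v := fun v h => by
    rwa [inner_self_eq_zero, sub_eq_zero] at h
  have hQ1 : w - v₁ ∈ Q := by
    have := Q.sub_mem h₀₁ (hYQ hy)
    rwa [sub_sub_sub_cancel_left] at this
  have hQ2 : w - v₂ ∈ Q := by
    have := Q.sub_mem h₀₂ (hYQ hy)
    rwa [sub_sub_sub_cancel_left] at this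
  have hnn := hn
  rw [inner_sub_self, h₀, ht] at hn h2
  rw [inner_add_self, h₀, ht] at h1
  have hn0 : -1 < n := by exact_mod_cast (by push_cast; linarith : ((-1 : ℤ) : ℝ) < n)
  have hn1 : n < 2 := by exact_mod_cast (by push_cast; linarith : (n : ℝ) < (2 : ℤ))
  have : n = 0 ∨ n = 1 := by omega
  rcases this with rfl | rfl
  · left
    rw [Int.cast_zero, mul_zero, inner_self_eq_zero, sub_eq_zero] at hnn
    exact hnn.symm
  · right
    have hs : ⟪w, v₀⟫_ℝ + ⟪w, v₁⟫_ℝ + ⟪w, v₂⟫_ℝ = 0 := by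
      rw [← inner_add_right, ← inner_add_right, hv, inner_zero_right]
    rw [real_inner_comm] at hn
    obtain ⟨i, hi⟩ := hQ.even _ hQ1
    obtain ⟨j, hj⟩ := hQ.even _ hQ2
    have hi0 : 0 ≤ ⟪w - v₁, w - v₁⟫_ℝ := real_inner_self_nonneg
    have hj0 : 0 ≤ ⟪w - v₂, w - v₂⟫_ℝ := real_inner_self_nonneg
    have hi1 := hQ.rootless _ hQ1
    rw [hi] at hi0 hi1
    rw [hj] at hj0
    have hi' := hi
    have hj' := hj
    rw [inner_sub_self, h₁, ht] at hi
    rw [inner_sub_self, h₂, ht] at hj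
    have hij : i + j = 2 := by
      push_cast at hn
      exact_mod_cast (by linarith : (i + j : ℝ) = 2)
    have hi0' : 0 ≤ i := by exact_mod_cast (by linarith : (0 : ℝ) ≤ i)
    have hj0' : 0 ≤ j := by exact_mod_cast (by linarith : (0 : ℝ) ≤ j)
    have hi1' : i ≠ 1 := by rintro rfl; norm_num at hi1
    have : i = 0 ∨ j = 0 := by omega
    rcases this with rfl | rfl
    · left; exact hwv _ (by rw [hi']; simp)
    · right; exact hwv _ (by rw [hj']; simp)

/-- An involution permuting three vectors fixes all of them or fixes one and swaps the others. The
second alternative covers `v₀` being fixed. -/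
theorem invol_triple_dichotomy {Q Y : Submodule ℤ V} (hQ : IsGood Q) (hY : IsEE8 Y) (hYQ : Y ≤ Q)
    {v₀ v₁ v₂ : V} (hv : v₀ + v₁ + v₂ = 0) (h₀ : ⟪v₀, v₀⟫_ℝ = 4 / 3) (h₁ : ⟪v₁, v₁⟫_ℝ = 4 / 3)
    (h₂ : ⟪v₂, v₂⟫_ℝ = 4 / 3) (hint₀ : ∀ q ∈ Q, ∃ n : ℤ, ⟪v₀, q⟫_ℝ = n)
    (hint₁ : ∀ q ∈ Q, ∃ n : ℤ, ⟪v₁, q⟫_ℝ = n) (h₀₁ : v₀ - v₁ ∈ Q) (h₀₂ : v₀ - v₂ ∈ Q) :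
    (invol Y v₀ = v₀ ∧ invol Y v₁ = v₁ ∧ invol Y v₂ = v₂) ∨
      (invol Y v₀ = v₀ ∧ invol Y v₁ = v₂ ∧ invol Y v₂ = v₁) ∨
      (invol Y v₁ = v₁ ∧ invol Y v₀ = v₂ ∧ invol Y v₂ = v₀) ∨
      (invol Y v₂ = v₂ ∧ invol Y v₀ = v₁ ∧ invol Y v₁ = v₀) := by
  have e2 : v₂ = -(v₀ + v₁) := (neg_eq_of_add_eq_zero_right hv).symm
  have t2 : invol Y v₂ = -(invol Y v₀ + invol Y v₁) := by rw [e2, map_neg, map_add]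
  have hinv := fun x => invol_invol Y x
  have h₁₀ : v₁ - v₀ ∈ Q := by have := Q.neg_mem h₀₁; rwa [neg_sub] at this
  have h₁₂ : v₁ - v₂ ∈ Q := by
    have := Q.add_mem h₁₀ h₀₂; rwa [sub_add_sub_cancel] at this
  rcases invol_mem_triple hQ hY hYQ hv h₀ h₁ h₂ hint₀ h₀₁ h₀₂ with h | h | h
  · rcases invol_mem_triple hQ hY hYQ (by rw [add_comm v₁, hv]) h₁ h₀ h₂ hint₁ h₁₀ h₁₂
      with k | k | k
    · left; exact ⟨h, k, by rw [t2, h, k, ← e2]⟩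
    · left
      have e : v₁ = v₀ := by rw [← hinv v₁, k, h]
      exact ⟨h, by rw [k, e], by rw [t2, h, k, e2, e]⟩
    · right; left
      exact ⟨h, k, by rw [← k, hinv]⟩
  · right; right; right
    have k : invol Y v₁ = v₀ := by rw [← h, hinv]
    exact ⟨by rw [t2, h, k, e2, add_comm], h, k⟩
  · right; right; left
    have k : invol Y v₂ = v₀ := by rw [← h, hinv]
    refine ⟨?_, h, k⟩
    have : v₁ = -(v₀ + v₂) := by rw [e2]; abel
    rw [this, map_neg, map_add, h, k, add_comm]

end EE8Lattice

/-! ### Isometries of order three inverted by an EE₈-involution. -/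

open scoped InnerProductSpace

namespace EE8Lattice

open Matrix

theorem connected_E₈ {p : Fin 8 → Prop}
    (h : ∀ i j, CartanMatrix.E₈ i j = -1 → p i → p j) : (∀ i, p i) ∨ ∀ i, ¬p i := by
  have e : ∀ i j, CartanMatrix.E₈ i j = -1 → (p i ↔ p j) := fun i j hij =>
    ⟨h i j hij, h j i (by rw [E₈_symm, hij])⟩
  have h02 := e 0 2 rfl
  have h23 := e 2 3 rfl
  have h13 := e 1 3 rfl
  have h34 := e 3 4 rfl
  have h45 := e 4 5 rfl
  have h56 := e 5 6 rfl
  have h67 := e 6 7 rfl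
  simp only [Fin.forall_fin_succ]
  by_cases h3 : p 3
  · left
    refine ⟨?_, ?_, ?_, ?_, ?_, ?_, ?_, ?_, fun i => i.elim0⟩ <;> grind
  · right
    refine ⟨?_, ?_, ?_, ?_, ?_, ?_, ?_, ?_, fun i => i.elim0⟩ <;> grind

theorem connected_E₆ {p : Fin 8 → Prop} (h : ∀ i < 6, ∀ j < 6, CartanMatrix.E₈ i j = -1 → p i → p j) :
    (∀ i < 6, p i) ∨ ∀ i < 6, ¬p i := by
  have e : ∀ i < 6, ∀ j < 6, CartanMatrix.E₈ i j = -1 → (p i ↔ p j) := fun i hi j hj hij =>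
    ⟨h i hi j hj hij, h j hj i hi (by rw [E₈_symm, hij])⟩
  have h02 := e 0 (by decide) 2 (by decide) rfl
  have h23 := e 2 (by decide) 3 (by decide) rfl
  have h13 := e 1 (by decide) 3 (by decide) rfl
  have h34 := e 3 (by decide) 4 (by decide) rfl
  have h45 := e 4 (by decide) 5 (by decide) rfl
  by_cases h3 : p 3
  · left; intro i hi; fin_cases i <;> first | (exact absurd hi (by decide)) | grind
  · right; intro i hi; fin_cases i <;> first | (exact absurd hi (by decide)) | grind

theorem connected_D₄ {p : Fin 8 → Prop} (h : ∀ i ∈ ({1, 2, 3, 4} : Set (Fin 8)),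
    ∀ j ∈ ({1, 2, 3, 4} : Set (Fin 8)), CartanMatrix.E₈ i j = -1 → p i → p j) :
    (∀ i ∈ ({1, 2, 3, 4} : Set (Fin 8)), p i) ∨ ∀ i ∈ ({1, 2, 3, 4} : Set (Fin 8)), ¬p i := by
  have e : ∀ i ∈ ({1, 2, 3, 4} : Set (Fin 8)), ∀ j ∈ ({1, 2, 3, 4} : Set (Fin 8)),
      CartanMatrix.E₈ i j = -1 → (p i ↔ p j) := fun i hi j hj hij =>
    ⟨h i hi j hj hij, h j hj i hi (by rw [E₈_symm, hij])⟩
  have h23 := e 2 (by simp) 3 (by simp) rfl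
  have h13 := e 1 (by simp) 3 (by simp) rfl
  have h34 := e 3 (by simp) 4 (by simp) rfl
  by_cases h3 : p 3
  · left; rintro i (rfl | rfl | rfl | rfl) <;> grind
  · right; rintro i (rfl | rfl | rfl | rfl) <;> grind

variable {V : Type*} [NormedAddCommGroup V] [InnerProductSpace ℝ V]

/-- Every coefficient of the highest root is nonzero, so it can replace any one frame member in a
real basis. -/
theorem IsFrame.linearMap_eq_zero {W : Type*} [AddCommGroup W] [Module ℝ W] {b : Fin 8 → V}
    {M : Submodule ℤ V} (hb : IsFrame b M) (j : Fin 8) (φ : V →ₗ[ℝ] W)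
    (h : ∀ i ≠ j, φ (b i) = 0) (hθ : φ (vec b highest) = 0) {m : V} (hm : m ∈ M) : φ m = 0 := by
  have hj : φ (b j) = 0 := by
    rw [map_vec, Finset.sum_eq_single j (fun i _ hi => by rw [h i hi, smul_zero]) (by simp),
      ← Int.cast_smul_eq_zsmul ℝ] at hθ
    refine (smul_eq_zero.1 hθ).resolve_left (Int.cast_ne_zero.2 ?_)
    clear * -
    revert j; decide +kernel
  obtain ⟨c, rfl⟩ := (hb.mem_iff m).1 hm
  rw [map_vec]
  refine Finset.sum_eq_zero fun i _ => ?_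
  by_cases hi : i = j
  · rw [hi, hj, smul_zero]
  · rw [h i hi, smul_zero]

variable [FiniteDimensional ℝ V]

/-- An isometry `g` of order dividing `3` preserving the even rootless lattice `Q` and inverted by
the involution of the `EE₈`-sublattice `M`. -/
structure IsInvertedBy (Q M : Submodule ℤ V) (g : V ≃ₗᵢ[ℝ] V) : Prop where
  good : IsGood Q
  isEE8 : IsEE8 M
  le : M ≤ Q
  map_mem : ∀ x ∈ Q, g x ∈ Q
  cube : ∀ x, g (g (g x)) = x
  conj : ∀ x, invol M (g x) = g (g (invol M x))

namespace IsInvertedBy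

variable {Q M : Submodule ℤ V} {g : V ≃ₗᵢ[ℝ] V} (H : IsInvertedBy Q M g)
include H

theorem inner_map_right (x y : V) : ⟪x, g y⟫_ℝ = ⟪g (g x), y⟫_ℝ := by
  rw [← g.inner_map_map, ← g.inner_map_map (g x), H.cube]

theorem image_le : image g M ≤ Q := by
  rintro _ ⟨m, hm, rfl⟩
  exact H.map_mem m (H.le hm)

theorem inner_sq_right (x : V) : ⟪x, g (g x)⟫_ℝ = ⟪x, g x⟫_ℝ := by
  rw [H.inner_map_right, H.inner_map_right, H.cube, real_inner_comm]

theorem inner_trace_self (x : V) :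
    ⟪x + g x + g (g x), x + g x + g (g x)⟫_ℝ = 3 * (⟪x, x⟫_ℝ + 2 * ⟪x, g x⟫_ℝ) := by
  have h1 : ⟪g x, g (g x)⟫_ℝ = ⟪x, g x⟫_ℝ := g.inner_map_map _ _
  have h2 := H.inner_sq_right x
  have h3 := real_inner_comm x (g x)
  have h4 := real_inner_comm x (g (g x))
  have h5 := real_inner_comm (g x) (g (g x))
  simp only [inner_add_left, inner_add_right, LinearIsometryEquiv.inner_map_map] at *
  linarith

theorem inner_trace_comm (x y : V) :
    ⟪x + g x + g (g x), y⟫_ℝ = ⟪x, y + g y + g (g y)⟫_ℝ := by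
  simp only [inner_add_left, inner_add_right, H.inner_map_right, H.cube]
  ring

theorem trace_fixed (x : V) : g (x + g x + g (g x)) = x + g x + g (g x) := by
  simp only [map_add, H.cube]; abel

theorem trace_mem {x : V} (hx : x ∈ M) : x + g x + g (g x) ∈ M := by
  have hxQ := H.le hx
  refine mem_of_invol_eq_neg H.good H.isEE8 H.le
    (Q.add_mem (Q.add_mem hxQ (H.map_mem _ hxQ)) (H.map_mem _ (H.map_mem _ hxQ))) ?_
  simp only [map_add, H.conj, H.cube, invol_apply_of_mem hx, map_neg]
  abel

theorem inner_fixed {x y : V} (hx : g x = x) : 3 * ⟪x, y⟫_ℝ = ⟪x, y + g y + g (g y)⟫_ℝ := by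
  rw [← H.inner_trace_comm, hx, hx, inner_add_left, inner_add_left]; ring

/-- The involution of `gM` sends `x` to `-g²x`, so the possible inner products of a root with its
image under `t_{gM}` restrict `⟨x, gx⟩`. The value -4 would give `gx = -x`, impossible in order 3.
-/
theorem root_cases {x : V} (hx : x ∈ M) (h4 : ⟪x, x⟫_ℝ = 4) :
    g x = x ∨ (x + g x + g (g x) = 0 ∧ ⟪x, g x⟫_ℝ = -2) ∨ ⟪x, g x⟫_ℝ = 0 := by
  have hinv : invol (image g M) x = -g (g x) := by
    have := invol_image g M (g (g x))
    rw [H.cube, H.conj, H.conj, invol_apply_of_mem hx, H.cube, map_neg, map_neg] at this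
    exact this
  rcases mem_or_inner_invol H.good (H.isEE8.image g) H.image_le (H.le hx) h4 with h | h | h | h
  · left
    have h1 := invol_apply_of_mem h
    rw [hinv, neg_inj] at h1
    rw [← h1, H.cube, h1]
  all_goals rw [hinv, inner_neg_right, H.inner_sq_right] at h
  · exfalso
    have h1 : ⟪x + g x, x + g x⟫_ℝ = 0 := by
      rw [inner_add_self, LinearIsometryEquiv.inner_map_map, h4]; linarith
    rw [inner_self_eq_zero, add_comm, add_eq_zero_iff_eq_neg] at h1
    have h2 := H.cube x
    rw [h1, map_neg, h1, neg_neg, h1] at h2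
    have h3 := congrArg (fun z => ⟪z, x⟫_ℝ) h2
    simp only [inner_neg_left, h4] at h3
    norm_num at h3
  · right; left
    have h1 : ⟪x, g x⟫_ℝ = -2 := by linarith
    refine ⟨?_, h1⟩
    rw [← inner_self_eq_zero (𝕜 := ℝ), H.inner_trace_self, h4, h1]; norm_num
  · right; right; linarith

/-- A root `x` of `M` orthogonal to `g x` provides a frame adapted to an `A₂`-sublattice fixed
pointwise by `g`. -/
theorem exists_frame {x : V} (hx : x ∈ M) (h4 : ⟪x, x⟫_ℝ = 4) (h0 : ⟪x, g x⟫_ℝ = 0) :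
    ∃ b, IsFrame b M ∧ g (vec b highest) = vec b highest ∧ g (b 7) = b 7 := by
  obtain ⟨b₀, hb₀⟩ := isEE8_iff_exists_isFrame.1 H.isEE8
  set v := x + g x + g (g x) with hv
  have hvM := H.trace_mem hx
  have hvf : g v = v := H.trace_fixed x
  have hv12 : ⟪v, v⟫_ℝ = 12 := by rw [hv, H.inner_trace_self, h4, h0]; norm_num
  obtain ⟨b, hb, hw⟩ := hb₀.exists_eq_weight_six hvM hv12
  have hvr : ⟪v, vec b highest⟫_ℝ = 6 := by
    rw [inner_vec_weights hw]
    have : (Pi.single 6 1 : Fin 8 → ℤ) ⬝ᵥ highest = 3 := by decide +kernel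
    rw [this]; norm_num
  have hfix : g (vec b highest) = vec b highest := by
    have h3 := H.inner_fixed (y := vec b highest) hvf
    rcases H.root_cases (hb.vec_mem highest) hb.inner_highest_self with h | ⟨h, -⟩ | h
    · exact h
    · rw [h, hvr, inner_zero_right] at h3; norm_num at h3
    · have h5 := H.inner_trace_self (vec b highest)
      rw [h, hb.inner_highest_self] at h5
      -- If the highest root is orthogonal to its image, its trace has norm 12 and inner product 18
      -- with `v`, which also has norm 12. This violates Cauchy–Schwarz.
      have h6 := real_inner_mul_inner_self_le v
        (vec b highest + g (vec b highest) + g (g (vec b highest)))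
      rw [← h3, h5, hv12, hvr] at h6
      norm_num at h6
  refine ⟨b, hb, hfix, ?_⟩
  -- `v` is the fundamental weight at node 6, and in E₈ this weight is twice the highest root minus
  -- the last simple root.
  have hb7 : b 7 = (2 : ℤ) • vec b highest - v := by
    rw [hv, hb.eq_vec hvM hw, ← vec_smul, ← vec_sub, ← vec_single b 7]
    congr 1
    decide +kernel
  rw [hb7, map_sub, map_zsmul, hfix, hvf]

/-- If no root is orthogonal to its image, each simple root is fixed or has trace zero. A fixed
vector is orthogonal to a trace-zero one, so connectedness of E₈ leaves only one kind. -/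
theorem trichotomy : (∀ m ∈ M, g m = m) ∨ (∀ m ∈ M, m + g m + g (g m) = 0) ∨
    ∃ b, IsFrame b M ∧ g (vec b highest) = vec b highest ∧ g (b 7) = b 7 := by
  obtain ⟨b, hb⟩ := isEE8_iff_exists_isFrame.1 H.isEE8
  by_cases hex : ∃ x ∈ M, ⟪x, x⟫_ℝ = 4 ∧ ⟪x, g x⟫_ℝ = 0
  · obtain ⟨x, hx, h4, h0⟩ := hex
    exact Or.inr (Or.inr (H.exists_frame hx h4 h0))
  push Not at hex
  have hcase : ∀ i, g (b i) ≠ b i → b i + g (b i) + g (g (b i)) = 0 := fun i hi => by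
    rcases H.root_cases (hb.mem i) (hb.inner_basis_self i) with h | ⟨h, -⟩ | h
    · exact absurd h hi
    · exact h
    · exact absurd h (hex _ (hb.mem i) (hb.inner_basis_self i))
  rcases connected_E₈ (p := fun i => g (b i) = b i) (fun i j hij hi => by
    by_contra hj
    have h3 := H.inner_fixed (y := b j) hi
    rw [hcase j hj, hb.gram, hij, inner_zero_right] at h3
    norm_num at h3) with h | h
  · left
    intro m hm
    obtain ⟨c, rfl⟩ := (hb.mem_iff m).1 hm
    rw [map_vec]
    simp only [h, vec]
  · right; left
    intro m hm
    obtain ⟨c, rfl⟩ := (hb.mem_iff m).1 hm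
    have : ∀ x, x + g x + g (g x) = ((LinearMap.id : V →ₗ[ℝ] V) + g.toLinearEquiv.toLinearMap +
      g.toLinearEquiv.toLinearMap ∘ₗ g.toLinearEquiv.toLinearMap) x := fun x => rfl
    rw [this, map_vec]
    refine Finset.sum_eq_zero fun i _ => ?_
    rw [← this, hcase i (h i), smul_zero]

/-- `t_M` interchanges `gu` and `g²u` up to sign, so they pair equally with `M`, and the three
conjugates sum to zero. -/
theorem inner_map_left {u m : V} (hu : u ∈ M) (hT : u + g u + g (g u) = 0) (hm : m ∈ M) :
    ⟪g u, m⟫_ℝ = -⟪u, m⟫_ℝ / 2 ∧ ⟪g (g u), m⟫_ℝ = -⟪u, m⟫_ℝ / 2 := by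
  have h1 : ⟪g (g u), m⟫_ℝ = ⟪g u, m⟫_ℝ := by
    rw [← (invol M).inner_map_map, H.conj, H.conj, invol_apply_of_mem hu, invol_apply_of_mem hm,
      H.cube, map_neg, inner_neg_neg]
  have h2 := congrArg (fun z => ⟪z, m⟫_ℝ) hT
  simp only [inner_add_left, inner_zero_left] at h2
  constructor <;> linarith

theorem pow_three : g ^ 3 = 1 := by
  ext x; exact H.cube x

theorem map_pow_mem (i : ℕ) {x : V} (hx : x ∈ Q) : (g ^ i) x ∈ Q := by
  induction i with
  | zero => simpa using hx
  | succ n ih => rw [pow_succ']; exact H.map_mem _ ih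

/-- `Y` contains `gⁱ u` and is orthogonal to `gⁱ (g² u - g u)`. -/
def _root_.EE8Lattice.TypeAt (Y : Submodule ℤ V) (g : V ≃ₗᵢ[ℝ] V) (u : V) (i : ℕ) : Prop :=
  invol Y ((g ^ i) u) = -(g ^ i) u ∧
    invol Y ((g ^ i) (g (g u) - g u)) = (g ^ i) (g (g u) - g u)

/-- The triple is `v, gv, g²v` with `v = (g²u - gu)/3`. Its differences are the conjugates of `u` up
to sign, so fixing the triple makes `Y` orthogonal to all of them, while a swap puts one conjugate
in `Y`. -/
theorem typeAt_dichotomy {Y : Submodule ℤ V} (hY : IsEE8 Y) (hYQ : Y ≤ Q) {u : V} (hu : u ∈ M)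
    (h4 : ⟪u, u⟫_ℝ = 4) (hT : u + g u + g (g u) = 0)
    (hint : ∀ q ∈ Q, ∃ n : ℤ, ⟪g (g u) - g u, q⟫_ℝ = 3 * n) :
    (∀ i : Fin 3, invol Y ((g ^ (i : ℕ)) u) = (g ^ (i : ℕ)) u) ∨
      ∃ i : Fin 3, TypeAt Y g u i := by
  have huQ := H.le hu
  have hgu : ⟪g u, u⟫_ℝ = -2 := by rw [(H.inner_map_left hu hT hu).1, h4]; norm_num
  have hggu : ⟪g (g u), u⟫_ℝ = -2 := by rw [(H.inner_map_left hu hT hu).2, h4]; norm_num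
  have hggg : ⟪g (g u), g u⟫_ℝ = -2 := by rw [LinearIsometryEquiv.inner_map_map, hgu]
  have hnorm : ⟪g (g u) - g u, g (g u) - g u⟫_ℝ = 12 := by
    rw [inner_sub_self, LinearIsometryEquiv.inner_map_map, LinearIsometryEquiv.inner_map_map, h4,
      hggg]
    norm_num
  set v := (1 / 3 : ℝ) • (g (g u) - g u) with hv
  have h0 : ⟪v, v⟫_ℝ = 4 / 3 := by
    rw [hv, real_inner_smul_left, real_inner_smul_right, hnorm]; norm_num
  have h1 : ⟪g v, g v⟫_ℝ = 4 / 3 := by rw [LinearIsometryEquiv.inner_map_map, h0]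
  have h2 : ⟪g (g v), g (g v)⟫_ℝ = 4 / 3 := by rw [LinearIsometryEquiv.inner_map_map, h1]
  have hgv : g v = (1 / 3 : ℝ) • (u - g (g u)) := by rw [hv, map_smul, map_sub, H.cube]
  have hggv : g (g v) = (1 / 3 : ℝ) • (g u - u) := by rw [hgv, map_smul, map_sub, H.cube]
  have hsum : v + g v + g (g v) = 0 := by rw [hggv, hgv, hv]; module
  have d0 : g v - g (g v) = u := by
    rw [hggv, hgv]
    have : u = -(g u + g (g u)) := eq_neg_of_add_eq_zero_left (by rw [← add_assoc]; exact hT)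
    have h3 : (1 / 3 : ℝ) • (u - g (g u)) - (1 / 3 : ℝ) • (g u - u) =
      u - (1 / 3 : ℝ) • (u + g u + g (g u)) := by module
    rw [h3, hT, smul_zero, sub_zero]
  have d1 : g (g v) - v = g u := by
    have := congrArg g d0; rwa [map_sub, H.cube] at this
  have d2 : v - g v = g (g u) := by
    have := congrArg g d1; rwa [map_sub, H.cube] at this
  have hint0 : ∀ q ∈ Q, ∃ n : ℤ, ⟪v, q⟫_ℝ = n := fun q hq => by
    obtain ⟨n, hn⟩ := hint q hq
    exact ⟨n, by rw [hv, real_inner_smul_left, hn]; ring⟩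
  have hint1 : ∀ q ∈ Q, ∃ n : ℤ, ⟪g v, q⟫_ℝ = n := fun q hq => by
    obtain ⟨n, hn⟩ := hint0 _ (H.map_mem _ (H.map_mem _ hq))
    refine ⟨n, ?_⟩
    rw [← hn, real_inner_comm, H.inner_map_right, real_inner_comm]
  have h01 : v - g v ∈ Q := by rw [d2]; exact H.map_mem _ (H.map_mem _ huQ)
  have h02 : v - g (g v) ∈ Q := by
    rw [← neg_sub, d1]; exact Q.neg_mem (H.map_mem _ huQ)
  have e : g (g u) - g u = (3 : ℝ) • v := by rw [hv]; module
  have eg : ∀ x, (g ^ 2) x = g (g x) := fun x => rfl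
  rcases invol_triple_dichotomy H.good hY hYQ hsum h0 h1 h2 hint0 hint1 h01 h02 with
    ⟨a0, a1, a2⟩ | ⟨a0, a1, a2⟩ | ⟨a1, a0, a2⟩ | ⟨a2, a0, a1⟩
  · left
    intro i
    fin_cases i
    · simp only [pow_zero, LinearIsometryEquiv.coe_one, id]
      rw [← d0, map_sub, a1, a2]
    · simp only [pow_one]
      rw [← d1, map_sub, a2, a0]
    · simp only [eg]
      rw [← d2, map_sub, a0, a1]
  · right
    refine ⟨0, ?_, ?_⟩
    · simp only [Fin.val_zero, pow_zero, LinearIsometryEquiv.coe_one, id]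
      rw [← d0, map_sub, a1, a2, neg_sub]
    · simp only [Fin.val_zero, pow_zero, LinearIsometryEquiv.coe_one, id]
      rw [e, map_smul, a0]
  · right
    refine ⟨1, ?_, ?_⟩
    · simp only [Fin.val_one, pow_one]
      rw [← d1, map_sub, a0, a2, neg_sub]
    · simp only [Fin.val_one, pow_one]
      rw [e, map_smul, map_smul, a1]
  · right
    refine ⟨2, ?_, ?_⟩
    · simp only [Fin.val_two, eg]
      rw [← d2, map_sub, a0, a1, neg_sub]
    · simp only [Fin.val_two, eg]
      rw [e, map_smul, map_smul, map_smul, a2]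

/-- The orthogonal type for `u'` contradicts `⟨u, u'⟩ = -2`. Types at different powers would give
two vectors of `Y` with inner product 1, but inner products in `Y` are even. -/
theorem typeAt_of_inner {Y : Submodule ℤ V} (hY : IsEE8 Y) (hYQ : Y ≤ Q) {u u' : V} (hu : u ∈ M)
    (hT : u + g u + g (g u) = 0) (hu' : u' ∈ M) (huu : ⟪u, u'⟫_ℝ = -2)
    (h' : (∀ i : Fin 3, invol Y ((g ^ (i : ℕ)) u') = (g ^ (i : ℕ)) u') ∨
      ∃ i : Fin 3, TypeAt Y g u' i) {i : Fin 3} (hi : TypeAt Y g u i) : TypeAt Y g u' i := by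
  have hgu : ⟪g u, u'⟫_ℝ = 1 := by rw [(H.inner_map_left hu hT hu').1, huu]; norm_num
  have hggu : ⟪g (g u), u'⟫_ℝ = 1 := by rw [(H.inner_map_left hu hT hu').2, huu]; norm_num
  rcases h' with h' | ⟨j, hj⟩
  · exfalso
    have := inner_eq_zero_of_invol hi.1 (h' i)
    rw [LinearIsometryEquiv.inner_map_map, huu] at this
    norm_num at this
  · by_cases hij : i = j
    · rw [hij]; exact hj
    exfalso
    obtain ⟨b, hb⟩ := isEE8_iff_exists_isFrame.1 hY
    obtain ⟨n, hn⟩ := hb.exists_even_inner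
      (mem_of_invol_eq_neg H.good hY hYQ (H.map_pow_mem i (H.le hu)) hi.1)
      (mem_of_invol_eq_neg H.good hY hYQ (H.map_pow_mem j (H.le hu')) hj.1)
    have h1 : ⟪(g ^ (i : ℕ)) u, (g ^ (j : ℕ)) u'⟫_ℝ = 1 := by
      have eg : ∀ x, (g ^ 2) x = g (g x) := fun x => rfl
      clear hn hi hj
      fin_cases i <;> fin_cases j <;> first | exact absurd rfl hij | skip
      all_goals simp only [pow_zero, pow_one, eg, LinearIsometryEquiv.coe_one, id,
        H.inner_map_right, H.cube, hgu, hggu]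
    rw [h1] at hn
    have : (1 : ℤ) = 2 * n := by exact_mod_cast hn
    omega

end IsInvertedBy

end EE8Lattice

/-! ### Type DIH₆(14). -/

open scoped InnerProductSpace

namespace EE8Lattice

open Matrix

variable {V : Type*} [NormedAddCommGroup V] [InnerProductSpace ℝ V]

theorem eq_image_of_image_inv_eq {Y M : Submodule ℤ V} {f : V ≃ₗᵢ[ℝ] V} (h : image f⁻¹ Y = M) :
    Y = image f M := by
  rw [← h, ← image_mul, mul_inv_cancel, image_one]

theorem finite_of_le_isEE8 {M L : Submodule ℤ V} (hM : IsEE8 M) (h : L ≤ M) :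
    Module.Finite ℤ L := by
  obtain ⟨b, -⟩ := hM
  have : Module.Finite ℤ M := Module.Finite.of_basis b
  exact Module.Finite.of_injective (Submodule.inclusion h) (Submodule.inclusion_injective _)

theorem finrank_inf_add_finrank_sup {M N : Submodule ℤ V} (hM : IsEE8 M) (hN : IsEE8 N) :
    Module.finrank ℤ ↥(M ⊔ N) + Module.finrank ℤ ↥(M ⊓ N) = 16 := by
  have hM' := hM
  obtain ⟨b, -⟩ := hM
  obtain ⟨c, -⟩ := hN
  have : Module.Finite ℤ M := Module.Finite.of_basis b
  have : Module.Finite ℤ N := Module.Finite.of_basis c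
  have : Module.Finite ℤ ↥(M ⊔ N) := Module.Finite.iff_fg.2
    ((Module.Finite.iff_fg.1 ‹Module.Finite ℤ M›).sup (Module.Finite.iff_fg.1 ‹Module.Finite ℤ N›))
  have := finite_of_le_isEE8 hM' (inf_le_left : M ⊓ N ≤ M)
  have hf : ∀ L : Submodule ℤ V, Module.Finite ℤ L → Module.rank ℤ L = Module.finrank ℤ L :=
    fun L _ => (Module.finrank_eq_rank ℤ L).symm
  have h := Submodule.rank_sup_add_rank_inf_eq M N
  rw [hf, hf, hf, hf] at h <;> try assumption
  rw [Module.finrank_eq_card_basis b, Module.finrank_eq_card_basis c] at h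
  simp only [Fintype.card_fin] at h
  exact_mod_cast h

theorem sup_decomposition {M N : Submodule ℤ V} {g : V ≃ₗᵢ[ℝ] V} (h : N = image g M) {q : V}
    (hq : q ∈ M ⊔ N) : ∃ m ∈ M, ∃ m' ∈ M, q = m + g m' := by
  obtain ⟨m, hm, n, hn, rfl⟩ := Submodule.mem_sup.1 hq
  rw [h] at hn
  obtain ⟨m', hm', rfl⟩ := hn
  exact ⟨m, hm, m', hm', rfl⟩

variable [FiniteDimensional ℝ V]

theorem TypeAt.image_inv {Y : Submodule ℤ V} {g : V ≃ₗᵢ[ℝ] V} {u : V} {i : ℕ}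
    (h : TypeAt Y g u i) : TypeAt (image (g ^ i)⁻¹ Y) g u 0 := by
  have key : ∀ x, invol (image (g ^ i)⁻¹ Y) x = (g ^ i)⁻¹ (invol Y ((g ^ i) x)) := fun x => by
    rw [← invol_image]
    congr 1
    exact ((g ^ i).symm_apply_apply x).symm
  have hs : ∀ x, (g ^ i)⁻¹ ((g ^ i) x) = x := fun x => (g ^ i).symm_apply_apply x
  constructor
  · rw [pow_zero, LinearIsometryEquiv.coe_one, id, key, h.1, map_neg, hs]
  · rw [pow_zero, LinearIsometryEquiv.coe_one, id, key, h.2, hs]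

namespace IsInvertedBy

variable {Q M : Submodule ℤ V} {g : V ≃ₗᵢ[ℝ] V} (H : IsInvertedBy Q M g)
include H

theorem image_pow_inv_le (i : ℕ) {Y : Submodule ℤ V} (hYQ : Y ≤ Q) : image (g ^ i)⁻¹ Y ≤ Q := by
  have h1 : g⁻¹ = g ^ 2 := by
    rw [inv_eq_iff_mul_eq_one, ← pow_succ', H.pow_three]
  rintro _ ⟨y, hy, rfl⟩
  change (g ^ i)⁻¹ y ∈ Q
  rw [← inv_pow, h1, ← pow_mul]
  exact H.map_pow_mem _ (hYQ hy)

theorem typeAt_family {Y : Submodule ℤ V} (hY : IsEE8 Y) (hYQ : Y ≤ Q) {b : Fin 8 → V}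
    (hb : IsFrame b M) (K : Set (Fin 8))
    (hK : ∀ p : Fin 8 → Prop, (∀ i ∈ K, ∀ j ∈ K, CartanMatrix.E₈ i j = -1 → p i → p j) →
      (∀ i ∈ K, p i) ∨ ∀ i ∈ K, ¬p i)
    (hT : ∀ k ∈ K, b k + g (b k) + g (g (b k)) = 0)
    (hint : ∀ k ∈ K, ∀ q ∈ Q, ∃ n : ℤ, ⟪g (g (b k)) - g (b k), q⟫_ℝ = 3 * n) :
    (∀ k ∈ K, ∀ i : Fin 3, invol Y ((g ^ (i : ℕ)) (b k)) = (g ^ (i : ℕ)) (b k)) ∨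
      ∃ i : Fin 3, ∀ k ∈ K, TypeAt Y g (b k) i := by
  have hd := fun k hk => H.typeAt_dichotomy hY hYQ (hb.mem k) (hb.inner_basis_self k) (hT k hk)
    (hint k hk)
  have hall : ∀ i : Fin 3, (∀ k ∈ K, TypeAt Y g (b k) i) ∨ ∀ k ∈ K, ¬TypeAt Y g (b k) i :=
    fun i => hK _ fun k hk l hl hkl h => H.typeAt_of_inner hY hYQ (hb.mem k) (hT k hk) (hb.mem l)
      (by rw [hb.gram, hkl]; norm_num) (hd l hl) h
  by_cases hex : ∃ i : Fin 3, ∀ k ∈ K, TypeAt Y g (b k) i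
  · exact Or.inr hex
  · left
    intro k hk
    rcases hd k hk with h | ⟨i, hi⟩
    · exact h
    · rcases hall i with h | h
      · exact absurd ⟨i, h⟩ hex
      · exact absurd hi (h k hk)

/-- For `y = m + gm'` in `Y`, the vector `y + t_M y` equals `gm' - g²m'`. It is orthogonal to `y`:
this is linear in `m'` and holds on the first six frame members by hypothesis and on the fixed
vectors trivially. Hence `y + t_M y = 0`. -/
theorem eq_of_orthogonal (hsup : ∀ q ∈ Q, ∃ m ∈ M, ∃ m' ∈ M, q = m + g m') {b : Fin 8 → V}
    (hb : IsFrame b M) (hθ : g (vec b highest) = vec b highest) (h7 : g (b 7) = b 7)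
    {Y : Submodule ℤ V} (hY : IsEE8 Y) (hYQ : Y ≤ Q)
    (h : ∀ k < 6, invol Y (g (g (b k)) - g (b k)) = g (g (b k)) - g (b k)) : Y = M := by
  refine eq_of_forall_invol_eq_neg H.good H.isEE8 H.le hY hYQ fun y hy => ?_
  have hyt := invol_apply_of_mem hy
  obtain ⟨m, hm, m', hm', rfl⟩ := hsup y (hYQ hy)
  set y := m + g m' with hyd
  let G : V →ₗ[ℝ] V := g.toLinearEquiv.toLinearMap
  let φ : V →ₗ[ℝ] ℝ := (innerₛₗ ℝ y) ∘ₗ (G ∘ₗ G - G)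
  have hφ : ∀ x, φ x = ⟪y, g (g x) - g x⟫_ℝ := fun x => rfl
  have h0 : φ m' = 0 := by
    refine hb.linearMap_eq_zero 6 φ (fun i hi => ?_) ?_ hm'
    · rw [hφ]
      by_cases hi6 : i < 6
      · exact inner_eq_zero_of_invol hyt (h i hi6)
      · have : i = 7 := by omega
        rw [this, h7, h7, sub_self, inner_zero_right]
    · rw [hφ, hθ, hθ, sub_self, inner_zero_right]
  have hz : y + invol M y = -(g (g m') - g m') := by
    rw [hyd, map_add, H.conj, invol_apply_of_mem hm, invol_apply_of_mem hm', map_neg, map_neg]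
    abel
  have h1 : ⟪y, y + invol M y⟫_ℝ = 0 := by rw [hz, inner_neg_right, ← hφ, h0, neg_zero]
  have h2 : ⟪y + invol M y, y + invol M y⟫_ℝ = 0 := by
    rw [inner_add_self, LinearIsometryEquiv.inner_map_map]
    rw [inner_add_right] at h1
    linarith
  rw [inner_self_eq_zero] at h2
  exact (neg_eq_of_add_eq_zero_right h2).symm

/-- The E₆-roots have a common type. The orthogonal type would force `Y = M`, although `M` contains
these roots; in the other case a power of `g` reduces to `eq_of_orthogonal`. -/
theorem exists_eq_image (hsup : ∀ q ∈ Q, ∃ m ∈ M, ∃ m' ∈ M, q = m + g m') {b : Fin 8 → V}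
    (hb : IsFrame b M) (hθ : g (vec b highest) = vec b highest) (h7 : g (b 7) = b 7)
    (hT : ∀ k < 6, b k + g (b k) + g (g (b k)) = 0) {Y : Submodule ℤ V} (hY : IsEE8 Y)
    (hYQ : Y ≤ Q) : ∃ i : Fin 3, Y = image (g ^ (i : ℕ)) M := by
  have hint : ∀ k < 6, ∀ q ∈ Q, ∃ n : ℤ, ⟪g (g (b k)) - g (b k), q⟫_ℝ = 3 * n := by
    intro k hk q hq
    obtain ⟨m, hm, m', hm', rfl⟩ := hsup q hq
    obtain ⟨n, hn⟩ := hb.exists_even_inner (hb.mem k) hm'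
    have e1 := H.inner_map_left (hb.mem k) (hT k hk) hm
    have e2 := H.inner_map_left (hb.mem k) (hT k hk) hm'
    refine ⟨-n, ?_⟩
    rw [inner_add_right, inner_sub_left, inner_sub_left, LinearIsometryEquiv.inner_map_map,
      LinearIsometryEquiv.inner_map_map, e1.1, e1.2, e2.1, hn]
    push_cast; ring
  rcases H.typeAt_family hY hYQ hb {i | i < 6} (fun p hp => connected_E₆ hp) hT hint with
    hZ | ⟨i, hi⟩
  · exfalso
    have hYM : Y = M := H.eq_of_orthogonal hsup hb hθ h7 hY hYQ fun k hk => by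
      have h1 := hZ k hk 1
      have h2 := hZ k hk 2
      have eg : ∀ x, (g ^ 2) x = g (g x) := fun x => rfl
      simp only [Fin.val_one, pow_one, Fin.val_two, eg] at h1 h2
      rw [map_sub, h1, h2]
    have h0 := hZ 0 (by decide) 0
    simp only [Fin.val_zero, pow_zero, LinearIsometryEquiv.coe_one, id] at h0
    rw [hYM] at h0
    have := inner_eq_zero_of_invol (invol_apply_of_mem (hb.mem 0)) h0
    rw [hb.inner_basis_self] at this
    norm_num at this
  · refine ⟨i, eq_image_of_image_inv_eq ?_⟩
    refine H.eq_of_orthogonal hsup hb hθ h7 (hY.image _) (H.image_pow_inv_le i hYQ) fun k hk => ?_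
    have := (hi k hk).image_inv.2
    simpa only [pow_zero, LinearIsometryEquiv.coe_one, id] using this

end IsInvertedBy

theorem closure_eq_top_of_mulEquiv {G D : Type*} [Group G] [Group D] {s t : G}
    (hs : s * s = 1) (ht : t * t = 1) (e : Subgroup.closure {s, t} ≃* D) :
    ∃ A B : D, A * A = 1 ∧ B * B = 1 ∧ Subgroup.closure {A, B} = ⊤ ∧
      ∀ n, (s * t) ^ n = 1 ↔ (A * B) ^ n = 1 := by
  set S : Subgroup.closure {s, t} := ⟨s, Subgroup.subset_closure (by simp)⟩ with hS
  set T : Subgroup.closure {s, t} := ⟨t, Subgroup.subset_closure (by simp)⟩ with hT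
  refine ⟨e S, e T, ?_, ?_, ?_, fun n => ?_⟩
  · rw [← map_mul, map_eq_one_iff e e.injective]; exact Subtype.ext hs
  · rw [← map_mul, map_eq_one_iff e e.injective]; exact Subtype.ext ht
  · have h1 : Subgroup.closure {S, T} = ⊤ := by
      have h2 := Subgroup.closure_closure_coe_preimage (k := {s, t})
      convert h2 using 2
      ext x
      simp [Subtype.ext_iff, hS, hT]
    have h3 := congrArg (Subgroup.map e.toMonoidHom) h1
    rw [MonoidHom.map_closure, Subgroup.map_top_of_surjective _ e.surjective,
      Set.image_pair] at h3
    exact h3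
  · rw [← map_mul, ← map_pow, map_eq_one_iff e e.injective, Subtype.ext_iff]
    rfl

theorem mul_comm_of_closure_eq_top {D : Type*} [Group D] {A B : D} (hA : A * A = 1)
    (hB : B * B = 1) (htop : Subgroup.closure {A, B} = ⊤) (h2 : (A * B) ^ 2 = 1) (x y : D) :
    x * y = y * x := by
  have hAB : A * B = B * A := by
    rw [pow_two, mul_eq_one_iff_eq_inv, _root_.mul_inv_rev, inv_eq_of_mul_eq_one_left hA,
      inv_eq_of_mul_eq_one_left hB] at h2
    exact h2
  have h1 : Subgroup.closure {A, B} ≤ Subgroup.centralizer {A, B} := by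
    rw [Subgroup.closure_le]
    rintro z (rfl | rfl)
    · rw [SetLike.mem_coe, Subgroup.mem_centralizer_iff]
      rintro w (rfl | rfl)
      · rfl
      · exact hAB.symm
    · rw [SetLike.mem_coe, Subgroup.mem_centralizer_iff]
      rintro w (rfl | rfl)
      · exact hAB
      · rfl
  have h3 : Subgroup.closure {A, B} ≤ Subgroup.center D := by
    rw [Subgroup.closure_le]
    intro w hw
    rw [SetLike.mem_coe, Subgroup.mem_center_iff]
    intro z
    have hz : z ∈ Subgroup.centralizer {A, B} := h1 (htop ▸ Subgroup.mem_top z)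
    exact (Subgroup.mem_centralizer_iff.1 hz w hw).symm
  have hx : x ∈ Subgroup.center D := h3 (htop ▸ Subgroup.mem_top x)
  exact (Subgroup.mem_center_iff.1 hx y).symm

/-- The braid relation `BAB = ABA` reduces every word to one of six. -/
theorem card_le_six_of_closure_eq_top {D : Type*} [Group D] [Fintype D] [DecidableEq D] {A B : D}
    (hA : A * A = 1) (hB : B * B = 1) (htop : Subgroup.closure {A, B} = ⊤)
    (h3 : (A * B) ^ 3 = 1) : Fintype.card D ≤ 6 := by
  have hAi : A⁻¹ = A := inv_eq_of_mul_eq_one_left hA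
  have hBi : B⁻¹ = B := inv_eq_of_mul_eq_one_left hB
  have hAl : ∀ z, A * (A * z) = z := fun z => by rw [← mul_assoc, hA, one_mul]
  have hBl : ∀ z, B * (B * z) = z := fun z => by rw [← mul_assoc, hB, one_mul]
  have hBAB : B * (A * B) = A * (B * A) := by
    have h4 : A * (B * (A * B)) * (A * B) = 1 := by rw [← h3]; simp only [pow_succ, pow_zero,
      one_mul, mul_assoc]
    rw [mul_eq_one_iff_eq_inv, _root_.mul_inv_rev, hAi, hBi] at h4
    rw [← hAl (B * (A * B)), h4]
  have hBABA : B * (A * (B * A)) = A * B := by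
    rw [← hBAB, hBl]
  have hmem : ∀ x : D, x ∈ ({1, A, B, A * B, B * A, A * (B * A)} : Finset D) := fun x => by
    have hx : x ∈ Subgroup.closure {A, B} := htop ▸ Subgroup.mem_top x
    induction hx using Subgroup.closure_induction_left with
    | one => simp
    | mul_left y hy z _ ih =>
      simp only [Finset.mem_insert, Finset.mem_singleton] at ih ⊢
      rcases hy with rfl | rfl <;> rcases ih with rfl | rfl | rfl | rfl | rfl | rfl <;>
        simp [hA, hB, hAl, hBl, hBAB, hBABA]
    | inv_mul_cancel y hy z _ ih =>
      simp only [Finset.mem_insert, Finset.mem_singleton] at ih ⊢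
      rcases hy with rfl | rfl <;> rcases ih with rfl | rfl | rfl | rfl | rfl | rfl <;>
        simp [hA, hB, hAl, hBl, hBAB, hBABA, hAi, hBi]
  have h6 : (Finset.univ : Finset D).card ≤ 6 :=
    (Finset.card_le_card fun x _ => hmem x).trans Finset.card_le_six
  rwa [Finset.card_univ] at h6

theorem pow_of_mulEquiv_dihedralGroup_three {G : Type*} [Group G] {s t : G} (hs : s * s = 1)
    (ht : t * t = 1) (e : Subgroup.closure {s, t} ≃* DihedralGroup 3) :
    (s * t) ^ 3 = 1 ∧ (s * t) ^ 2 ≠ 1 := by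
  obtain ⟨A, B, hA, hB, htop, hn⟩ := closure_eq_top_of_mulEquiv hs ht e
  have h2 : (A * B) ^ 2 ≠ 1 := fun h => by
    have := mul_comm_of_closure_eq_top hA hB htop h (DihedralGroup.r 1) (DihedralGroup.sr 0)
    revert this; decide
  refine ⟨(hn 3).2 ?_, fun h => h2 ((hn 2).1 h)⟩
  have : ∀ x : DihedralGroup 3, x ^ 2 ≠ 1 → x ^ 3 = 1 := by decide
  exact this _ h2

theorem pow_of_mulEquiv_dihedralGroup_six {G : Type*} [Group G] {s t : G} (hs : s * s = 1)
    (ht : t * t = 1) (e : Subgroup.closure {s, t} ≃* DihedralGroup 6) :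
    (s * t) ^ 6 = 1 ∧ (s * t) ^ 2 ≠ 1 ∧ (s * t) ^ 3 ≠ 1 := by
  obtain ⟨A, B, hA, hB, htop, hn⟩ := closure_eq_top_of_mulEquiv hs ht e
  refine ⟨(hn 6).2 ?_, fun h => ?_, fun h => ?_⟩
  · have : ∀ x : DihedralGroup 6, x ^ 6 = 1 := by decide
    exact this _
  · have := mul_comm_of_closure_eq_top hA hB htop ((hn 2).1 h) (DihedralGroup.r 1)
      (DihedralGroup.sr 0)
    revert this; decide
  · have := card_le_six_of_closure_eq_top hA hB htop ((hn 3).1 h)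
    rw [DihedralGroup.card] at this
    omega

/-- The `EE₈`-sublattices of a lattice of type `DIH₆(14)`. -/
theorem ncard_ee8Sublattices {Q : Submodule ℤ V} (hQ : IsDIH 6 14 Q) :
    (ee8Sublattices Q).ncard = 3 := by
  obtain ⟨hi, hr, hrank, M, N, hM, hN, rfl, k, hk, ⟨e⟩⟩ := hQ
  obtain rfl : k = 3 := by omega
  obtain ⟨h3, h2⟩ := pow_of_mulEquiv_dihedralGroup_three (invol_mul_self M) (invol_mul_self N) e
  have hgood := isGood_sup hM hN hi hr
  set g := invol M * invol N with hg
  have hMQ : M ≤ M ⊔ N := le_sup_left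
  have hNQ : N ≤ M ⊔ N := le_sup_right
  have happ : ∀ x, g x = invol M (invol N x) := fun x => rfl
  have hcube : ∀ x, g (g (g x)) = x := fun x => by
    have : (g ^ 3) x = x := by rw [h3]; rfl
    exact this
  have htN : ∀ x, invol N x = invol M (g x) := fun x => by rw [happ, invol_invol]
  have H : IsInvertedBy (M ⊔ N) M g :=
    { good := hgood
      isEE8 := hM
      le := hMQ
      map_mem := fun x hx => invol_mem hi hM hMQ (invol_mem hi hN hNQ hx)
      cube := hcube
      conj := fun x => by
        rw [← htN]
        have := hcube (invol N x)
        rw [happ (invol N x), invol_invol] at this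
        exact this.symm }
  have hNM : N = image g M := by
    refine eq_of_invol_eq hgood (hM.image g) H.image_le hN hNQ ?_
    ext x
    have := invol_image g M (g (g x))
    rw [hcube, H.conj, H.conj, hcube] at this
    rw [this, htN, H.conj]
  have hfixN : ∀ m ∈ M, g m = m → m ∈ N := fun m hm hgm =>
    mem_of_invol_eq_neg hgood hN hNQ (hMQ hm) (by rw [htN, hgm, invol_apply_of_mem hm])
  -- Rank 14 for the sum leaves rank 16 - 14 = 2 for the intersection, which contains every fixed
  -- vector of `M`.
  have hfinf : Module.finrank ℤ ↥(M ⊓ N) = 2 := by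
    have := finrank_inf_add_finrank_sup hM hN
    omega
  have hne1 : g ≠ 1 := fun h => h2 (by rw [h, one_pow])
  have hMN : M ≠ N := fun h => hne1 (by rw [hg, ← h, invol_mul_self])
  have hsup : ∀ q ∈ M ⊔ N, ∃ m ∈ M, ∃ m' ∈ M, q = m + g m' := fun q => sup_decomposition hNM
  obtain ⟨b, hb, hθ, h7⟩ : ∃ b, IsFrame b M ∧ g (vec b highest) = vec b highest ∧
      g (b 7) = b 7 := by
    rcases H.trichotomy with h | h | h
    · exact absurd (eq_of_forall_invol_eq_neg hgood hN hNQ hM hMQ fun m hm =>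
        invol_apply_of_mem (hfixN m hm (h m hm))) hMN
    · have hbot : M ⊓ N = ⊥ := by
        rw [eq_bot_iff]
        intro x hx
        have hgx : g x = x := by
          rw [happ, invol_apply_of_mem hx.2, map_neg, invol_apply_of_mem hx.1, neg_neg]
        have := h x hx.1
        rw [hgx, hgx, ← two_smul ℝ x] at this
        have this : (3 : ℝ) • x = 0 := by rw [← this]; module
        exact (smul_eq_zero.1 this).resolve_left (by norm_num)
      rw [hbot, finrank_bot] at hfinf
      norm_num at hfinf
    · exact h
  -- A nonzero trace would be a third independent fixed vector, being orthogonal to the highest root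
  -- and the last frame member.
  have hT : ∀ k < 6, b k + g (b k) + g (g (b k)) = 0 := fun k hk => by
    by_contra hne
    set w := b k + g (b k) + g (g (b k)) with hw
    have hwM := H.trace_mem (hb.mem k)
    have hwf : g w = w := H.trace_fixed (b k)
    have hk7 : k ≠ 7 := by rintro rfl; exact absurd hk (by decide)
    have hkθ : ⟪vec b highest, b k⟫_ℝ = 0 := by
      rw [hb.inner_highest_basis, Pi.single_eq_of_ne hk7]; norm_num
    have hwθ : ⟪vec b highest, w⟫_ℝ = 0 := by rw [hw, ← H.inner_fixed hθ, hkθ, mul_zero]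
    have hw7 : ⟪b 7, w⟫_ℝ = 0 := by
      rw [hw, ← H.inner_fixed h7, hb.gram]
      have : CartanMatrix.E₈ 7 k = 0 := by
        clear * - hk
        revert k; decide +kernel
      rw [this]; norm_num
    let f : Fin 3 → ↥(M ⊓ N) := ![⟨vec b highest, hb.vec_mem _, hfixN _ (hb.vec_mem _) hθ⟩,
      ⟨b 7, hb.mem 7, hfixN _ (hb.mem 7) h7⟩, ⟨w, hwM, hfixN _ hwM hwf⟩]
    have hli : LinearIndependent ℤ f := by
      rw [Fintype.linearIndependent_iff]
      intro c hc
      have hc' := congrArg Subtype.val hc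
      simp only [Fin.sum_univ_three, f, Matrix.cons_val_zero, Matrix.cons_val_one,
        Matrix.cons_val, Submodule.coe_add, Submodule.coe_smul, ZeroMemClass.coe_zero] at hc'
      have e0 := congrArg (fun z => ⟪z, vec b highest⟫_ℝ) hc'
      have e1 := congrArg (fun z => ⟪z, b 7⟫_ℝ) hc'
      have e2 := congrArg (fun z => ⟪z, w⟫_ℝ) hc'
      have hθ7 : ⟪vec b highest, b 7⟫_ℝ = 2 := by
        rw [hb.inner_highest_basis]; norm_num
      have hww : ⟪w, w⟫_ℝ ≠ 0 := fun h => hne (inner_self_eq_zero.1 h)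
      simp only [inner_add_left, inner_zsmul_left, inner_zero_left, hwθ, hw7, hθ7,
        hb.inner_highest_self, hb.inner_basis_self, real_inner_comm (vec b highest) w,
        real_inner_comm (b 7) w, real_inner_comm (vec b highest) (b 7)] at e0 e1 e2
      have c0 : (c 0 : ℝ) = 0 := by linarith
      have c1 : (c 1 : ℝ) = 0 := by linarith
      have c2 : (c 2 : ℝ) = 0 := by
        have : (c 2 : ℝ) * ⟪w, w⟫_ℝ = 0 := by linarith
        exact (mul_eq_zero.1 this).resolve_right hww
      intro i
      fin_cases i
      · exact_mod_cast c0
      · exact_mod_cast c1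
      · exact_mod_cast c2
    have := finite_of_le_isEE8 hM (inf_le_left : M ⊓ N ≤ M)
    have := hli.fintype_card_le_finrank
    rw [hfinf, Fintype.card_fin] at this
    omega
  have hsub : ee8Sublattices (M ⊔ N) = {M, image g M, image g (image g M)} := by
    ext Y
    simp only [ee8Sublattices, Set.mem_ofPred_eq, Set.mem_insert_iff, Set.mem_singleton_iff]
    constructor
    · rintro ⟨hYQ, hY⟩
      obtain ⟨i, hi⟩ := H.exists_eq_image hsup hb hθ h7 hT hY hYQ
      fin_cases i
      · left; simpa [image_one] using hi
      · right; left; simpa using hi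
      · right; right
        rw [← image_mul]
        simpa [pow_two] using hi
    · rintro (rfl | rfl | rfl)
      · exact ⟨hMQ, hM⟩
      · exact ⟨H.image_le, hM.image g⟩
      · refine ⟨?_, (hM.image g).image g⟩
        rintro _ ⟨y, hy, rfl⟩
        exact H.map_mem _ (H.image_le hy)
  have hthree : image g (image g (image g M)) = M := by
    have h : g * (g * g) = 1 := by rw [← mul_assoc, ← h3, pow_succ, pow_two]
    rw [← image_mul, ← image_mul, mul_assoc, h, image_one]
  rw [hsub, Set.ncard_eq_three]
  refine ⟨_, _, _, ?_, ?_, ?_, rfl⟩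
  · rw [← hNM]; exact hMN
  · intro h
    have := congrArg (image g) h
    rw [hthree, ← hNM] at this
    exact hMN this.symm
  · intro h
    have := congrArg (fun L => image g (image g L)) h
    simp only [hthree] at this
    rw [← hNM] at this
    exact hMN this

end EE8Lattice

/-! ### Short dominant vectors in the E₆ orthogonal to √2A₂. -/

open scoped InnerProductSpace

namespace EE8Lattice

open Matrix

section Frame

variable {V : Type*} [NormedAddCommGroup V] [InnerProductSpace ℝ V]

namespace IsFrame

variable {b : Fin 8 → V} {M : Submodule ℤ V} (hb : IsFrame b M)
include hb

/-- Frames sharing the highest root and the last member can be made dominant for an element of the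
orthogonal complement of type `E₆`. -/
theorem exists_dominant_E₆ {v : V} (hv : v ∈ M) (hθ : ⟪vec b highest, v⟫_ℝ = 0)
    (h7 : ⟪b 7, v⟫_ℝ = 0) :
    ∃ b', IsFrame b' M ∧ vec b' highest = vec b highest ∧ b' 7 = b 7 ∧
      ∃ l : Fin 8 → ℤ, (∀ i, ⟪v, b' i⟫_ℝ = 2 * (l i : ℝ)) ∧ (∀ i < 6, 0 ≤ l i) ∧ l 7 = 0 ∧
        2 * l 0 + 3 * l 1 + 4 * l 2 + 6 * l 3 + 5 * l 4 + 4 * l 5 + 3 * l 6 = 0 := by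
  obtain ⟨b', hb', htr, hdom⟩ := hb.exists_dominant {i | i < 6} hv
  have eθ : vec b' highest = vec b highest := by
    rw [hb'.eq_vec (hb.vec_mem highest) (l := Pi.single 7 1) fun j => ?_]
    · congr 1; decide +kernel
    · rw [htr, hb.inner_highest_basis]
      intro i hi
      rw [hb.inner_highest_basis, Pi.single_eq_of_ne (by rintro rfl; exact absurd hi (by decide))]
      norm_num
  have e7 : b' 7 = b 7 := by
    rw [hb'.eq_vec (hb.mem 7) (l := fun j => CartanMatrix.E₈ 7 j) fun j => ?_, ← vec_single b' 7]
    · congr 1; decide +kernel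
    · rw [htr, hb.gram]
      intro i hi
      rw [hb.gram]
      have : CartanMatrix.E₈ 7 i = 0 := by
        clear * - hi
        have hi : i < 6 := hi
        revert i; decide +kernel
      rw [this]; norm_num
  obtain ⟨l, hl⟩ := hb'.exists_weights hv
  have l7 : l 7 = 0 := by
    have := hl 7
    rw [e7, real_inner_comm, h7] at this
    exact_mod_cast (by linarith : (l 7 : ℝ) = 0)
  refine ⟨b', hb', eθ, e7, l, hl, fun i hi => ?_, l7, ?_⟩
  · have := hdom i hi
    rw [hl] at this
    exact_mod_cast (by linarith : (0 : ℝ) ≤ l i)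
  · rw [← eθ, real_inner_comm, inner_vec_weights hl] at hθ
    have h0 : 2 * (l ⬝ᵥ highest) = 0 := by exact_mod_cast hθ
    have h1 : l ⬝ᵥ highest = 2 * l 0 + 3 * l 1 + 4 * l 2 + 6 * l 3 + 5 * l 4 + 4 * l 5 +
        3 * l 6 + 2 * l 7 := by
      simp [dotProduct, highest, Fin.sum_univ_eight]; ring
    omega

/-- Orthogonality to the highest root eliminates the label at node 6 and leaves three times the
inverse Cartan form of E₆. -/
theorem norm_E₆ {v : V} (hv : v ∈ M) {l : Fin 8 → ℤ} (hl : ∀ i, ⟪v, b i⟫_ℝ = 2 * (l i : ℝ))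
    (l7 : l 7 = 0)
    (hθ : 2 * l 0 + 3 * l 1 + 4 * l 2 + 6 * l 3 + 5 * l 4 + 4 * l 5 + 3 * l 6 = 0) :
    3 * ⟪v, v⟫_ℝ = ((2 * (4 * l 0 ^ 2 + 6 * l 1 ^ 2 + 10 * l 2 ^ 2 + 18 * l 3 ^ 2 + 10 * l 4 ^ 2 +
      4 * l 5 ^ 2 + 2 * (3 * (l 0 * l 1) + 5 * (l 0 * l 2) + 6 * (l 0 * l 3) + 4 * (l 0 * l 4) +
      2 * (l 0 * l 5) + 6 * (l 1 * l 2) + 9 * (l 1 * l 3) + 6 * (l 1 * l 4) + 3 * (l 1 * l 5) +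
      12 * (l 2 * l 3) + 8 * (l 2 * l 4) + 4 * (l 2 * l 5) + 12 * (l 3 * l 4) + 6 * (l 3 * l 5) +
      5 * (l 4 * l 5))) : ℤ) : ℝ) := by
  rw [hb.inner_self_eq hv hl, ← Int.cast_ofNat (R := ℝ), ← Int.cast_mul]
  congr 1
  simp only [dotProduct, mulVec, cartanInv, Fin.sum_univ_eight, Matrix.of_apply, Matrix.cons_val,
    l7]
  linear_combination (2 * (3 * l 6 + (2 * l 0 + 3 * l 1 + 4 * l 2 + 6 * l 3 + 5 * l 4 + 4 * l 5)) *
    2 + 0) * hθ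

-- Three times the inverse Cartan matrix of E₆ has all entries at least 2. A label sum of 3 would
-- therefore force the form to be at least 18.
omit hb in
theorem weights_bound_E₆ {l : Fin 8 → ℤ} (h0 : ∀ i < 6, 0 ≤ l i) {n : ℤ}
    (hn : 4 * l 0 ^ 2 + 6 * l 1 ^ 2 + 10 * l 2 ^ 2 + 18 * l 3 ^ 2 + 10 * l 4 ^ 2 +
      4 * l 5 ^ 2 + 2 * (3 * (l 0 * l 1) + 5 * (l 0 * l 2) + 6 * (l 0 * l 3) + 4 * (l 0 * l 4) +
      2 * (l 0 * l 5) + 6 * (l 1 * l 2) + 9 * (l 1 * l 3) + 6 * (l 1 * l 4) + 3 * (l 1 * l 5) +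
      12 * (l 2 * l 3) + 8 * (l 2 * l 4) + 4 * (l 2 * l 5) + 12 * (l 3 * l 4) + 6 * (l 3 * l 5) +
      5 * (l 4 * l 5)) = n) (h12 : n ≤ 12) : ∀ i < 6, l i < 3 := by
  have p0 := h0 0 (by decide)
  have p1 := h0 1 (by decide)
  have p2 := h0 2 (by decide)
  have p3 := h0 3 (by decide)
  have p4 := h0 4 (by decide)
  have p5 := h0 5 (by decide)
  have hS : l 0 + l 1 + l 2 + l 3 + l 4 + l 5 < 3 := by
    by_contra! h3
    have : 0 ≤ 2 * l 0 ^ 2 + 4 * l 1 ^ 2 + 8 * l 2 ^ 2 + 16 * l 3 ^ 2 + 8 * l 4 ^ 2 +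
      2 * l 5 ^ 2 + 2 * (1 * (l 0 * l 1) + 3 * (l 0 * l 2) + 4 * (l 0 * l 3) + 2 * (l 0 * l 4) +
      0 * (l 0 * l 5) + 4 * (l 1 * l 2) + 7 * (l 1 * l 3) + 4 * (l 1 * l 4) + 1 * (l 1 * l 5) +
      10 * (l 2 * l 3) + 6 * (l 2 * l 4) + 2 * (l 2 * l 5) + 10 * (l 3 * l 4) + 4 * (l 3 * l 5) +
      3 * (l 4 * l 5)) := by positivity
    have h9 : 9 ≤ (l 0 + l 1 + l 2 + l 3 + l 4 + l 5) ^ 2 := by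
      have := pow_le_pow_left₀ (by norm_num) h3 2
      linarith
    have e : n = (2 * l 0 ^ 2 + 4 * l 1 ^ 2 + 8 * l 2 ^ 2 + 16 * l 3 ^ 2 + 8 * l 4 ^ 2 +
      2 * l 5 ^ 2 + 2 * (1 * (l 0 * l 1) + 3 * (l 0 * l 2) + 4 * (l 0 * l 3) + 2 * (l 0 * l 4) +
      0 * (l 0 * l 5) + 4 * (l 1 * l 2) + 7 * (l 1 * l 3) + 4 * (l 1 * l 4) + 1 * (l 1 * l 5) +
      10 * (l 2 * l 3) + 6 * (l 2 * l 4) + 2 * (l 2 * l 5) + 10 * (l 3 * l 4) + 4 * (l 3 * l 5) +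
      3 * (l 4 * l 5))) + 2 * (l 0 + l 1 + l 2 + l 3 + l 4 + l 5) ^ 2 := by rw [← hn]; ring
    linarith
  intro i hi
  fin_cases i <;> first | (exact absurd hi (by decide)) | (simp; omega)

-- The value 6 is attained only at the highest root of E₆, and 12 only at the sum of the two
-- fundamental weights at the end nodes 0 and 5. The labels -1 and -2 at node 6 come from
-- orthogonality to the highest root of E₈.
omit hb in
theorem weights_eq_E₆ {l : Fin 8 → ℤ} (h0 : ∀ i < 6, 0 ≤ l i) (h3 : ∀ i < 6, l i < 3)
    (hθ : 2 * l 0 + 3 * l 1 + 4 * l 2 + 6 * l 3 + 5 * l 4 + 4 * l 5 + 3 * l 6 = 0)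
    {n : ℤ} (hn : 4 * l 0 ^ 2 + 6 * l 1 ^ 2 + 10 * l 2 ^ 2 + 18 * l 3 ^ 2 + 10 * l 4 ^ 2 +
      4 * l 5 ^ 2 + 2 * (3 * (l 0 * l 1) + 5 * (l 0 * l 2) + 6 * (l 0 * l 3) + 4 * (l 0 * l 4) +
      2 * (l 0 * l 5) + 6 * (l 1 * l 2) + 9 * (l 1 * l 3) + 6 * (l 1 * l 4) + 3 * (l 1 * l 5) +
      12 * (l 2 * l 3) + 8 * (l 2 * l 4) + 4 * (l 2 * l 5) + 12 * (l 3 * l 4) + 6 * (l 3 * l 5) +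
      5 * (l 4 * l 5)) = n) (l7 : l 7 = 0) :
    (n = 6 → l = ![0, 1, 0, 0, 0, 0, -1, 0]) ∧ (n = 12 → l = ![1, 0, 0, 0, 0, 1, -2, 0]) := by
  have key : ∀ p : Fin 3 × Fin 3 × Fin 3 × Fin 3 × Fin 3 × Fin 3,
      let a : ℤ := (p.1 : ℕ); let b : ℤ := (p.2.1 : ℕ); let c : ℤ := (p.2.2.1 : ℕ)
      let d : ℤ := (p.2.2.2.1 : ℕ); let e : ℤ := (p.2.2.2.2.1 : ℕ); let f : ℤ := (p.2.2.2.2.2 : ℕ)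
      let n := 4 * a ^ 2 + 6 * b ^ 2 + 10 * c ^ 2 + 18 * d ^ 2 + 10 * e ^ 2 +
        4 * f ^ 2 + 2 * (3 * (a * b) + 5 * (a * c) + 6 * (a * d) + 4 * (a * e) +
        2 * (a * f) + 6 * (b * c) + 9 * (b * d) + 6 * (b * e) + 3 * (b * f) +
        12 * (c * d) + 8 * (c * e) + 4 * (c * f) + 12 * (d * e) + 6 * (d * f) +
        5 * (e * f))
      (n = 6 → a = 0 ∧ b = 1 ∧ c = 0 ∧ d = 0 ∧ e = 0 ∧ f = 0) ∧
      (n = 12 → a = 1 ∧ b = 0 ∧ c = 0 ∧ d = 0 ∧ e = 0 ∧ f = 1) := by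
    decide +kernel
  have lift : ∀ i < 6, ∃ k : Fin 3, l i = ((k : ℕ) : ℤ) := fun i hi =>
    ⟨⟨(l i).toNat, by have := h0 i hi; have := h3 i hi; omega⟩, by
      have := h0 i hi; simp; omega⟩
  obtain ⟨a, ha⟩ := lift 0 (by decide)
  obtain ⟨b, hb⟩ := lift 1 (by decide)
  obtain ⟨c, hc⟩ := lift 2 (by decide)
  obtain ⟨d, hd⟩ := lift 3 (by decide)
  obtain ⟨e, he⟩ := lift 4 (by decide)
  obtain ⟨f, hf⟩ := lift 5 (by decide)
  have := key (a, b, c, d, e, f)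
  simp only [← ha, ← hb, ← hc, ← hd, ← he, ← hf] at this
  rw [hn] at this
  refine ⟨fun h => ?_, fun h => ?_⟩
  · obtain ⟨q0, q1, q2, q3, q4, q5⟩ := this.1 h
    funext i
    fin_cases i <;> simp <;> omega
  · obtain ⟨q0, q1, q2, q3, q4, q5⟩ := this.2 h
    funext i
    fin_cases i <;> simp <;> omega

theorem exists_frame_norm_E₆ {v : V} (hv : v ∈ M) (hθ : ⟪vec b highest, v⟫_ℝ = 0)
    (h7 : ⟪b 7, v⟫_ℝ = 0) :
    ∃ b', IsFrame b' M ∧ vec b' highest = vec b highest ∧ b' 7 = b 7 ∧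
      ∃ l : Fin 8 → ℤ, (∀ i, ⟪v, b' i⟫_ℝ = 2 * (l i : ℝ)) ∧
        (⟪v, v⟫_ℝ = 4 → l = ![0, 1, 0, 0, 0, 0, -1, 0]) ∧
        (⟪v, v⟫_ℝ = 8 → l = ![1, 0, 0, 0, 0, 1, -2, 0]) := by
  obtain ⟨b', hb', eθ, e7, l, hl, h0, l7, hs⟩ := hb.exists_dominant_E₆ hv hθ h7
  have hn := hb'.norm_E₆ hv hl l7 hs
  refine ⟨b', hb', eθ, e7, l, hl, fun h => ?_, fun h => ?_⟩
  · rw [h] at hn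
    have hn' := Int.cast_injective (α := ℝ)
      ((by norm_num : ((2 * 6 : ℤ) : ℝ) = 3 * 4).trans hn)
    have hn2 := (mul_left_cancel₀ two_ne_zero hn').symm
    exact (weights_eq_E₆ h0 (weights_bound_E₆ h0 hn2 (by norm_num)) hs hn2 l7).1 rfl
  · rw [h] at hn
    have hn' := Int.cast_injective (α := ℝ)
      ((by norm_num : ((2 * 12 : ℤ) : ℝ) = 3 * 8).trans hn)
    have hn2 := (mul_left_cancel₀ two_ne_zero hn').symm
    exact (weights_eq_E₆ h0 (weights_bound_E₆ h0 hn2 (by norm_num)) hs hn2 l7).2 rfl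

end IsFrame
end Frame
end EE8Lattice

/-! ### Pairs whose involutions generate, with `g`, a dihedral group of order twelve. -/

open scoped InnerProductSpace

namespace EE8Lattice

open Matrix

variable {V : Type*} [NormedAddCommGroup V] [InnerProductSpace ℝ V] [FiniteDimensional ℝ V]

/-- The data attached to a pair of `EE₈`-lattices whose involutions have a product of order six:
`g` is an isometry of order three inverted by the involutions of `M` and `N`, and `u` is the
product of these two commuting involutions. -/
structure IsSixPair (Q M N : Submodule ℤ V) (g u : V ≃ₗᵢ[ℝ] V) : Prop where
  invM : IsInvertedBy Q M g
  invN : IsInvertedBy Q N g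
  u_sq : ∀ x, u (u x) = x
  u_g : ∀ x, u (g x) = g (u x)
  u_M : ∀ x, invol M (u x) = u (invol M x)
  prod : ∀ x, invol N x = invol M (u x)
  sup : M ⊔ image (g ^ 2) N = Q
  kill : ∀ x ∈ Q, u (x + g x + g (g x)) = -(x + g x + g (g x))
  g_ne : g ≠ 1
  u_ne : u ≠ 1

omit [FiniteDimensional ℝ V] in
theorem sq_apply (f : V ≃ₗᵢ[ℝ] V) (x : V) : (f ^ 2) x = f (f x) := by
  rw [pow_two]; rfl

omit [FiniteDimensional ℝ V] in
theorem isometry_eq_one {f : V ≃ₗᵢ[ℝ] V} (h : ∀ x, f x = x) : f = 1 :=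
  LinearIsometryEquiv.ext h

theorem IsInvertedBy.sq {Q M : Submodule ℤ V} {g : V ≃ₗᵢ[ℝ] V} (H : IsInvertedBy Q M g) :
    IsInvertedBy Q M (g ^ 2) where
  good := H.good
  isEE8 := H.isEE8
  le := H.le
  map_mem x hx := H.map_pow_mem 2 hx
  cube x := by simp only [sq_apply, H.cube]
  conj x := by
    simp only [sq_apply]
    rw [H.conj, H.conj]

namespace IsSixPair

variable {Q M N : Submodule ℤ V} {g u : V ≃ₗᵢ[ℝ] V} (H : IsSixPair Q M N g u)
include H

theorem image_sq_sup : N ⊔ image g M = Q := by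
  have e : image g (M ⊔ image (g ^ 2) N) = image g M ⊔ N := by
    rw [EE8Lattice.image, Submodule.map_sup]
    congr 1
    change image g (image (g ^ 2) N) = N
    rw [← image_mul, ← pow_succ', H.invM.pow_three, image_one]
  rw [sup_comm, ← e, H.sup]
  refine le_antisymm ?_ fun x hx => ?_
  · intro y hy
    obtain ⟨x, hx, rfl⟩ := mem_image.1 hy
    exact H.invM.map_mem x hx
  · rw [← H.invM.cube x]
    exact mem_image_of_mem _ (H.invM.map_mem _ (H.invM.map_mem x hx))

theorem symm : IsSixPair Q N M (g ^ 2) u where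
  invM := H.invN.sq
  invN := H.invM.sq
  u_sq := H.u_sq
  u_g x := by simp only [sq_apply, H.u_g]
  u_M x := by rw [H.prod, H.prod, H.u_M]
  prod x := by rw [H.prod, H.u_sq]
  sup := by
    have e : (g ^ 2) ^ 2 = g := by
      rw [← pow_mul, show 2 * 2 = 3 + 1 by norm_num, pow_succ, H.invM.pow_three, one_mul]
    rw [e, H.image_sq_sup]
  kill x hx := by
    simp only [sq_apply, H.invM.cube]
    rw [add_right_comm, H.kill x hx]
  g_ne h := H.g_ne (by
    refine isometry_eq_one fun x => ?_
    have : (g ^ 2) (g x) = g x := by rw [h]; rfl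
    simp only [sq_apply, H.invM.cube] at this
    exact this.symm)
  u_ne := H.u_ne

theorem inner_u (x y : V) : ⟪u x, y⟫_ℝ = ⟪x, u y⟫_ℝ := by
  rw [← u.inner_map_map, H.u_sq]

theorem u_eq (x : V) : u x = invol M (invol N x) := by
  rw [H.prod, invol_invol]

theorem u_mem_Q {x : V} (hx : x ∈ Q) : u x ∈ Q := by
  rw [H.u_eq]
  exact invol_mem H.invM.good.integral H.invM.isEE8 H.invM.le
    (invol_mem H.invM.good.integral H.invN.isEE8 H.invN.le hx)

theorem u_mem {x : V} (hx : x ∈ M) : u x ∈ M :=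
  mem_of_invol_eq_neg H.invM.good H.invM.isEE8 H.invM.le (H.u_mem_Q (H.invM.le hx))
    (by rw [H.u_M, invol_apply_of_mem hx, map_neg])

theorem mem_N {x : V} (hx : x ∈ M) (hu : u x = x) : x ∈ N :=
  mem_of_invol_eq_neg H.invM.good H.invN.isEE8 H.invN.le (H.invM.le hx)
    (by rw [H.prod, hu, invol_apply_of_mem hx])

theorem exists_g_ne : ∃ m ∈ M, g m ≠ m := by
  by_contra! h
  refine H.g_ne (isometry_eq_one ?_)
  have e : image g M = M := by
    ext x
    rw [mem_image]
    exact ⟨fun ⟨y, hy, e⟩ => by rwa [← e, h y hy], fun hx => ⟨x, hx, h x hx⟩⟩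
  have h1 : ∀ x, g (invol M x) = invol M x := fun x => by
    have := invol_image g M x
    rw [e, H.invM.conj] at this
    exact g.injective this
  intro x
  rw [← invol_invol M x, h1]

theorem exists_u_ne : ∃ m ∈ M, u m ≠ m := by
  by_contra! h
  refine H.u_ne (isometry_eq_one fun x => ?_)
  have e : M = N := eq_of_forall_invol_eq_neg H.invM.good H.invN.isEE8 H.invN.le H.invM.isEE8
    H.invM.le fun y hy => by rw [H.prod, h y hy, invol_apply_of_mem hy]
  rw [H.u_eq, ← e, invol_invol]

theorem invol_image_sq (x : V) : invol (image (g ^ 2) N) x = invol M (g (g (u x))) := by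
  have := invol_image (g ^ 2) N (g x)
  simp only [sq_apply] at this
  rw [H.invM.cube] at this
  rw [this, H.invN.conj, H.invN.cube, H.prod, H.invM.conj, H.invM.conj, H.invM.cube]

theorem root_cases {x : V} (hx : x ∈ M) (h4 : ⟪x, x⟫_ℝ = 4) :
    (g x = x ∧ u x = -x) ∨ (x + g x + g (g x) = 0 ∧ (u x = x ∨ ⟪x, u x⟫_ℝ = 0)) ∨
      (⟪x, g x⟫_ℝ = 0 ∧ (u x = -x ∨ ⟪x, u x⟫_ℝ = 0)) := by
  have hQ := H.invM.le hx
  have ht : invol M x = -x := invol_apply_of_mem hx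
  have hk := H.kill x hQ
  have hβ : ⟪x, invol N x⟫_ℝ = -⟪x, u x⟫_ℝ := by
    rw [H.prod, ← inner_invol, ht, inner_neg_left]
  have hN' : IsEE8 (image (g ^ 2) N) := H.invN.isEE8.image _
  have hNQ : image (g ^ 2) N ≤ Q := by rw [← H.sup]; exact le_sup_right
  have eN := H.invol_image_sq x
  have hγ : ⟪x, invol (image (g ^ 2) N) x⟫_ℝ = -⟪x, g (g (u x))⟫_ℝ := by
    rw [eN, ← inner_invol, ht, inner_neg_left]
  have hγ' : ⟪x, g (u x)⟫_ℝ = ⟪x, g (g (u x))⟫_ℝ := by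
    rw [H.invM.inner_map_right, ← H.inner_u, real_inner_comm, H.u_g, H.u_g]
  -- The identity `kill` ties `⟨x, ux⟩` and `⟨x, g²ux⟩` to `⟨x, gx⟩`. Each of the first two belongs
  -- to {4, -4, -2, 0}, by the root condition for `N` and for `g²N`, so few combinations survive.
  have hs : ⟪x, u x⟫_ℝ + 2 * ⟪x, g (g (u x))⟫_ℝ = -(4 + 2 * ⟪x, g x⟫_ℝ) := by
    have := congrArg (fun y => ⟪x, y⟫_ℝ) hk
    simp only [map_add, inner_add_right, inner_neg_right, H.u_g, hγ', H.invM.inner_sq_right,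
      h4] at this
    linarith
  have eu : ∀ {y : V}, ⟪y, y⟫_ℝ = 4 → ⟪x, y⟫_ℝ = -4 → y = -x := fun {y} hy h => by
    rw [eq_neg_iff_add_eq_zero, ← inner_self_eq_zero (𝕜 := ℝ), inner_add_self, hy, h4,
      real_inner_comm, h]
    norm_num
  have nu : ⟪u x, u x⟫_ℝ = 4 := by rw [u.inner_map_map, h4]
  have ng : ⟪g (g (u x)), g (g (u x))⟫_ℝ = 4 := by rw [g.inner_map_map, g.inner_map_map, nu]
  have cβ := mem_or_inner_invol H.invM.good H.invN.isEE8 H.invN.le hQ h4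
  rw [hβ] at cβ
  have cγ := mem_or_inner_invol H.invM.good hN' hNQ hQ h4
  rw [hγ] at cγ
  have cβ' : ⟪x, u x⟫_ℝ = 4 ∨ ⟪x, u x⟫_ℝ = -4 ∨ ⟪x, u x⟫_ℝ = -2 ∨ ⟪x, u x⟫_ℝ = 0 := by
    rcases cβ with h | h | h | h
    · left
      rw [invol_apply_of_mem h, inner_neg_right, h4] at hβ
      linarith
    · right; left; linarith
    · right; right; left; linarith
    · right; right; right; linarith
  have cγ' : ⟪x, g (g (u x))⟫_ℝ = 4 ∨ ⟪x, g (g (u x))⟫_ℝ = -4 ∨ ⟪x, g (g (u x))⟫_ℝ = -2 ∨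
      ⟪x, g (g (u x))⟫_ℝ = 0 := by
    rcases cγ with h | h | h | h
    · left
      rw [invol_apply_of_mem h, inner_neg_right, h4] at hγ
      linarith
    · right; left; linarith
    · right; right; left; linarith
    · right; right; right; linarith
  have fix : ⟪x, u x⟫_ℝ = 4 → u x = x := fun h => by
    rw [← sub_eq_zero, ← inner_self_eq_zero (𝕜 := ℝ), inner_sub_self, nu, h4,
      real_inner_comm, h]
    norm_num
  rcases H.invM.root_cases hx h4 with hg | ⟨hT, hα⟩ | hα
  · left
    refine ⟨hg, ?_⟩
    rw [hg, hg, map_add, map_add] at hk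
    have h3 : (3 : ℝ) • (u x + x) = 0 := by
      rw [show (3 : ℝ) = 1 + 1 + 1 by norm_num, add_smul, add_smul, one_smul]
      rw [eq_neg_iff_add_eq_zero] at hk
      rw [← hk]; abel
    rw [smul_eq_zero, or_iff_right (by norm_num)] at h3
    exact eq_neg_of_add_eq_zero_left h3
  · right; left
    refine ⟨hT, ?_⟩
    rw [hα] at hs
    rcases cβ' with h | h | h | h
    · exact Or.inl (fix h)
    · rw [h] at hs; rcases cγ' with k | k | k | k <;> (rw [k] at hs; norm_num at hs)
    · rw [h] at hs; rcases cγ' with k | k | k | k <;> (rw [k] at hs; norm_num at hs)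
    · exact Or.inr h
  · right; right
    refine ⟨hα, ?_⟩
    rw [hα] at hs
    rcases cβ' with h | h | h | h
    -- If `ux = x`, then `g²x = -x`, against `⟨x, gx⟩ = 0`.
    · have k : ⟪x, g (g (u x))⟫_ℝ = -4 := by linarith
      have := eu ng k
      rw [fix h] at this
      have h2 := H.invM.inner_sq_right x
      rw [this, inner_neg_right, h4, hα] at h2
      norm_num at h2
    · exact Or.inl (eu nu h)
    · rw [h] at hs; rcases cγ' with k | k | k | k <;> (rw [k] at hs; norm_num at hs)
    · exact Or.inr h

end IsSixPair
end EE8Lattice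

/-! ### Frames adapted to the commuting actions of `g` and `u`. -/

open scoped InnerProductSpace

namespace EE8Lattice

open Matrix

variable {V : Type*} [NormedAddCommGroup V] [InnerProductSpace ℝ V]

theorem inner_sq_le (x y : V) : ⟪x, y⟫_ℝ ^ 2 ≤ ⟪x, x⟫_ℝ * ⟪y, y⟫_ℝ := by
  have := real_inner_mul_inner_self_le x y
  nlinarith [this]

theorem eq_of_inner {x y : V} (h : ⟪x, y⟫_ℝ = ⟪x, x⟫_ℝ) (h' : ⟪y, y⟫_ℝ = ⟪x, x⟫_ℝ) : x = y := by
  rw [← sub_eq_zero, ← inner_self_eq_zero (𝕜 := ℝ), inner_sub_self, h, h']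
  ring

theorem IsFrame.inner_vec_eq {b : Fin 8 → V} {M : Submodule ℤ V} (hb : IsFrame b M)
    {c d : Fin 8 → ℤ} {n : ℤ} (h : 2 * ((CartanMatrix.E₈ *ᵥ c) ⬝ᵥ d) = n) :
    ⟪vec b c, vec b d⟫_ℝ = n := by
  rw [hb.inner_vec, h]

theorem IsFrame.inner_vec_basis_eq {b : Fin 8 → V} {M : Submodule ℤ V} (hb : IsFrame b M)
    {c : Fin 8 → ℤ} {j : Fin 8} {n : ℤ} (h : 2 * ((CartanMatrix.E₈ *ᵥ c) j) = n) :
    ⟪vec b c, b j⟫_ℝ = n := by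
  rw [hb.inner_vec_basis, ← h]; push_cast; rfl

variable [FiniteDimensional ℝ V]

/-- A frame of `M` which exhibits the action of `g` and `u`: the fixed lattice of `g` is spanned by
the highest root and the last member, and the first six members form an `E₆`-system on which `u`
fixes the central `D₄`. -/
structure IsAdapted (b : Fin 8 → V) (M : Submodule ℤ V) (g u : V ≃ₗᵢ[ℝ] V) : Prop where
  frame : IsFrame b M
  gθ : g (vec b highest) = vec b highest
  g7 : g (b 7) = b 7
  uθ : u (vec b highest) = -vec b highest
  u7 : u (b 7) = -b 7
  u_fix : ∀ i ∈ ({1, 2, 3, 4} : Set (Fin 8)), u (b i) = b i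
  u0 : u (b 0) = -b 0 - vec b ![0, 1, 2, 2, 1, 0, 0, 0]
  u5 : u (b 5) = -b 5 - vec b ![0, 1, 1, 2, 2, 0, 0, 0]
  trace : ∀ k < 6, b k + g (b k) + g (g (b k)) = 0

namespace IsSixPair

variable {Q M N : Submodule ℤ V} {g u : V ≃ₗᵢ[ℝ] V} (H : IsSixPair Q M N g u)
include H

theorem inner_sub_u {x y : V} (hy : u y = -y) : ⟪x - u x, y⟫_ℝ = 2 * ⟪x, y⟫_ℝ := by
  rw [inner_sub_left, H.inner_u, hy, inner_neg_right]; ring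

theorem inner_add_u {x y : V} (hy : u y = y) : ⟪x + u x, y⟫_ℝ = 2 * ⟪x, y⟫_ℝ := by
  rw [inner_add_left, H.inner_u, hy]; ring

theorem inner_eq_zero {x y : V} (hx : u x = x) (hy : u y = -y) : ⟪x, y⟫_ℝ = 0 := by
  have := H.inner_u x y
  rw [hx, hy, inner_neg_right] at this
  linarith

theorem u_sub (x : V) : u (x - u x) = -(x - u x) := by
  rw [map_sub, H.u_sq, neg_sub]

omit [FiniteDimensional ℝ V] H in
theorem _root_.EE8Lattice.inner_sub_map_self {x : V} (h4 : ⟪x, x⟫_ℝ = 4) (h0 : ⟪x, u x⟫_ℝ = 0) :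
    ⟪x - u x, x - u x⟫_ℝ = 8 := by
  rw [inner_sub_self, u.inner_map_map, h4, h0]; norm_num

theorem u_eq_neg_of_fixed {x : V} (hx : x ∈ M) (h4 : ⟪x, x⟫_ℝ = 4) (hg : g x = x) : u x = -x := by
  rcases H.root_cases hx h4 with h | ⟨h, -⟩ | ⟨h, -⟩
  · exact h.2
  · have := congrArg (fun y => ⟪x, y⟫_ℝ) h
    simp only [hg, inner_add_right, h4, inner_zero_right] at this
    norm_num at this
  · rw [hg, h4] at h; norm_num at h

/-- `r - ur` and `v` both have norm 8 and their inner product is 8, so they coincide. -/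
theorem sub_u_eq {v r : V} (hv : u v = -v) (h8 : ⟪v, v⟫_ℝ = 8) (h4 : ⟪r, r⟫_ℝ = 4)
    (hr : u r = r ∨ ⟪r, u r⟫_ℝ = 0) (h : ⟪v, r⟫_ℝ = 4) : r - u r = v := by
  have hr0 : ⟪r, u r⟫_ℝ = 0 := by
    rcases hr with hr | hr
    · have := H.inner_eq_zero hr hv
      rw [real_inner_comm, h] at this
      norm_num at this
    · exact hr
  have h8' := inner_sub_map_self (u := u) h4 hr0
  have hi := H.inner_sub_u (x := r) hv
  rw [real_inner_comm v r, h] at hi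
  exact eq_of_inner (by rw [hi, h8']; norm_num) (by rw [h8, h8'])

/-- Otherwise every root is fixed by `u` or orthogonal to its image. Make `v = r - ur` of norm 8 the
weight at node 0. All roots with coefficient 2 there yield the same `v`, so their differences, which
include the simple roots other than the one at node 0, are fixed by `u`. -/
theorem not_trace_eq_zero : ¬ ∀ m ∈ M, m + g m + g (g m) = 0 := by
  intro h0
  have hc : ∀ x ∈ M, ⟪x, x⟫_ℝ = 4 → u x = x ∨ ⟪x, u x⟫_ℝ = 0 := fun x hx h4 => by
    have hα : ⟪x, g x⟫_ℝ = -2 := by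
      have := congrArg (fun y => ⟪x, y⟫_ℝ) (h0 x hx)
      simp only [inner_add_right, H.invM.inner_sq_right, h4, inner_zero_right] at this
      linarith
    rcases H.root_cases hx h4 with h | h | h
    · rw [h.1, h4] at hα; norm_num at hα
    · exact h.2
    · rw [h.1] at hα; norm_num at hα
  obtain ⟨b, hb⟩ := isEE8_iff_exists_isFrame.1 H.invM.isEE8
  have hk : ∃ k, u (b k) ≠ b k := by
    by_contra! hk
    obtain ⟨m, hm, hne⟩ := H.exists_u_ne
    obtain ⟨c, rfl⟩ := (hb.mem_iff m).1 hm
    exact hne (by rw [map_vec]; simp only [hk]; rfl)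
  obtain ⟨k, hk⟩ := hk
  have hk0 := (hc _ (hb.mem k) (hb.inner_basis_self k)).resolve_left hk
  have h8 := inner_sub_map_self (u := u) (hb.inner_basis_self k) hk0
  have huv := H.u_sub (b k)
  obtain ⟨b', hb', hl⟩ :=
    hb.exists_eq_weight_zero (M.sub_mem (hb.mem k) (H.u_mem (hb.mem k))) h8
  have key : ∀ c : Fin 8 → ℤ, 2 * ((CartanMatrix.E₈ *ᵥ c) ⬝ᵥ c) = 4 → c 0 = 2 →
      vec b' c - u (vec b' c) = b k - u (b k) := fun c h2 hc0 => by
    have h4 : ⟪vec b' c, vec b' c⟫_ℝ = 4 := hb'.inner_vec_eq h2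
    refine H.sub_u_eq huv h8 h4 (hc _ (hb'.vec_mem c) h4) ?_
    rw [inner_vec_weights hl, single_one_dotProduct, hc0]
    norm_num
  have step : ∀ c d : Fin 8 → ℤ, ∀ i, 2 * ((CartanMatrix.E₈ *ᵥ c) ⬝ᵥ c) = 4 → c 0 = 2 →
      2 * ((CartanMatrix.E₈ *ᵥ d) ⬝ᵥ d) = 4 → d 0 = 2 → c - d = Pi.single i 1 →
      u (b' i) = b' i := fun c d i h1 h2 h3 h4 h5 => by
    have := (key c h1 h2).trans (key d h3 h4).symm
    rw [← vec_single b' i, ← h5, vec_sub, map_sub]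
    rw [sub_eq_sub_iff_add_eq_add] at this
    rw [sub_eq_sub_iff_add_eq_add, add_comm, ← this, add_comm]
  have f7 := step highest ![2, 3, 4, 6, 5, 4, 3, 1] 7 (by decide) rfl (by decide) rfl (by decide)
  have f6 := step ![2, 3, 4, 6, 5, 4, 3, 1] ![2, 3, 4, 6, 5, 4, 2, 1] 6
    (by decide) rfl (by decide) rfl (by decide)
  have f5 := step ![2, 3, 4, 6, 5, 4, 2, 1] ![2, 3, 4, 6, 5, 3, 2, 1] 5
    (by decide) rfl (by decide) rfl (by decide)
  have f4 := step ![2, 3, 4, 6, 5, 3, 2, 1] ![2, 3, 4, 6, 4, 3, 2, 1] 4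
    (by decide) rfl (by decide) rfl (by decide)
  have f3 := step ![2, 3, 4, 6, 4, 3, 2, 1] ![2, 3, 4, 5, 4, 3, 2, 1] 3
    (by decide) rfl (by decide) rfl (by decide)
  have f1 := step ![2, 3, 4, 5, 4, 3, 2, 1] ![2, 2, 4, 5, 4, 3, 2, 1] 1
    (by decide) rfl (by decide) rfl (by decide)
  have f2 := step ![2, 2, 4, 5, 4, 3, 2, 1] ![2, 2, 3, 5, 4, 3, 2, 1] 2
    (by decide) rfl (by decide) rfl (by decide)
  have hθ := key highest (by decide) rfl
  -- The highest root has coefficient 2 at node 0 and all other frame members are fixed. The norm 8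
  -- would then be four times 0 or four times 8.
  have e : b k - u (b k) = (2 : ℝ) • (b' 0 - u (b' 0)) := by
    rw [← hθ, map_vec]
    simp only [vec, Fin.sum_univ_eight, f1, f2, f3, f4, f5, f6, f7]
    rw [two_smul]
    simp [highest]
    abel
  have h2 := hc _ (hb'.mem 0) (hb'.inner_basis_self 0)
  rw [e, inner_smul_left, inner_smul_right, inner_sub_self, u.inner_map_map,
    hb'.inner_basis_self] at h8
  rcases h2 with h2 | h2
  · rw [h2, hb'.inner_basis_self] at h8
    norm_num at h8
  · rw [h2] at h8
    norm_num at h8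

theorem exists_fixed_frame : ∃ b, IsFrame b M ∧ g (vec b highest) = vec b highest ∧
    g (b 7) = b 7 := by
  rcases H.invM.trichotomy with h | h | h
  · obtain ⟨m, hm, hne⟩ := H.exists_g_ne
    exact absurd (h m hm) hne
  · exact absurd h H.not_trace_eq_zero
  · exact h

/-- The trace of a root that is not fixed has norm 0 or 12, and its inner product with `e` is `3⟨x,
e⟩`. Cauchy–Schwarz gives the threshold 4/3. -/
theorem fixed_of_inner_sq {x e : V} (hx : x ∈ M) (h4 : ⟪x, x⟫_ℝ = 4) (he : g e = e)
    (h : 4 / 3 * ⟪e, e⟫_ℝ < ⟪x, e⟫_ℝ ^ 2) : g x = x := by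
  have h3 := H.invM.inner_fixed (y := x) he
  have hs := inner_sq_le e (x + g x + g (g x))
  rw [← h3, H.invM.inner_trace_self, h4, real_inner_comm x e] at hs
  have he0 : 0 ≤ ⟪e, e⟫_ℝ := real_inner_self_nonneg
  rcases H.invM.root_cases hx h4 with h' | h' | h'
  · exact h'
  · rw [h'.2] at hs; nlinarith
  · rw [h'] at hs; nlinarith

/-- Make such a fixed root the highest root of E₆. Roots pairing to -2 with both it and `b 7` are
then fixed, and their differences fix every frame member except the one at node 1. With the highest
root this makes `g` trivial on `M`. -/
theorem not_fixed_of_orthogonal {b : Fin 8 → V} (hb : IsFrame b M)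
    (hθ : g (vec b highest) = vec b highest) (h7 : g (b 7) = b 7) {a : V} (ha : a ∈ M)
    (h4 : ⟪a, a⟫_ℝ = 4) (aθ : ⟪vec b highest, a⟫_ℝ = 0) (a7 : ⟪b 7, a⟫_ℝ = 0) : g a ≠ a := by
  intro hg
  obtain ⟨b', hb', eθ, e7, l, hl, hl4, -⟩ := hb.exists_frame_norm_E₆ ha aθ a7
  rw [hl4 h4] at hl
  rw [← eθ] at hθ
  rw [← e7] at h7 a7
  have key : ∀ c : Fin 8 → ℤ, 2 * ((CartanMatrix.E₈ *ᵥ c) ⬝ᵥ c) = 4 →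
      2 * ((CartanMatrix.E₈ *ᵥ c) 7) = -2 → 2 * (![0, 1, 0, 0, 0, 0, -1, 0] ⬝ᵥ c) = -2 →
      g (vec b' c) = vec b' c := fun c c4 c7 ca => by
    have x4 : ⟪vec b' c, vec b' c⟫_ℝ = 4 := hb'.inner_vec_eq c4
    have x7 : ⟪vec b' c, b' 7⟫_ℝ = -2 := by exact_mod_cast hb'.inner_vec_basis_eq c7
    have xa : ⟪vec b' c, a⟫_ℝ = -2 := by
      rw [real_inner_comm, inner_vec_weights hl, ca]; norm_num
    -- The vector `b' 7 + a` has norm 8 and inner product -4 with the root; 16 exceeds 32/3.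
    refine H.fixed_of_inner_sq (hb'.vec_mem c) x4 (e := b' 7 + a) (by rw [map_add, h7, hg]) ?_
    rw [inner_add_self, inner_add_right, x7, xa, a7, h4, hb'.inner_basis_self]
    norm_num
  have step : ∀ c d : Fin 8 → ℤ, ∀ i, g (vec b' c) = vec b' c → g (vec b' d) = vec b' d →
      c - d = Pi.single i 1 → g (b' i) = b' i := fun c d i h1 h2 h3 => by
    rw [← vec_single b' i, ← h3, vec_sub, map_sub, h1, h2]
  have k6 := key ![0, 0, 0, 0, 0, 0, 1, 0] (by decide) (by decide) (by decide)
  have k5 := key ![0, 0, 0, 0, 0, 1, 1, 0] (by decide) (by decide) (by decide)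
  have k4 := key ![0, 0, 0, 0, 1, 1, 1, 0] (by decide) (by decide) (by decide)
  have k3 := key ![0, 0, 0, 1, 1, 1, 1, 0] (by decide) (by decide) (by decide)
  have k2 := key ![0, 0, 1, 1, 1, 1, 1, 0] (by decide) (by decide) (by decide)
  have k0 := key ![1, 0, 1, 1, 1, 1, 1, 0] (by decide) (by decide) (by decide)
  have f6 := step _ 0 6 k6 (by simp [vec]) (by decide)
  have f5 := step _ _ 5 k5 k6 (by decide)
  have f4 := step _ _ 4 k4 k5 (by decide)
  have f3 := step _ _ 3 k3 k4 (by decide)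
  have f2 := step _ _ 2 k2 k3 (by decide)
  have f0 := step _ _ 0 k0 k2 (by decide)
  obtain ⟨m, hm, hne⟩ := H.exists_g_ne
  have := hb'.linearMap_eq_zero 1 (g.toLinearEquiv.toLinearMap - LinearMap.id) (fun i hi => by
    change g (b' i) - b' i = 0
    rw [sub_eq_zero]
    fin_cases i
    · exact f0
    · exact absurd rfl hi
    · exact f2
    · exact f3
    · exact f4
    · exact f5
    · exact f6
    · exact h7) (by
    change g (vec b' highest) - vec b' highest = 0
    rw [hθ, sub_self]) hm
  exact hne (sub_eq_zero.1 this)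

/-- Otherwise the trace `v` has norm 12 and some root `r` with `⟨v, r⟩ = 6` is fixed. This root
turns out to be orthogonal to √2A₂ as well, contrary to `not_fixed_of_orthogonal`. -/
theorem trace_eq_zero_of_orthogonal {b : Fin 8 → V} (hb : IsFrame b M)
    (hθ : g (vec b highest) = vec b highest) (h7 : g (b 7) = b 7) {x : V} (hx : x ∈ M)
    (h4 : ⟪x, x⟫_ℝ = 4) (xθ : ⟪vec b highest, x⟫_ℝ = 0) (x7 : ⟪b 7, x⟫_ℝ = 0) :
    x + g x + g (g x) = 0 ∧ (u x = x ∨ ⟪x, u x⟫_ℝ = 0) := by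
  rcases H.root_cases hx h4 with h | h | ⟨h, -⟩
  · exact absurd h.1 (H.not_fixed_of_orthogonal hb hθ h7 hx h4 xθ x7)
  · exact h
  exfalso
  have vM := H.invM.trace_mem hx
  have v12 : ⟪x + g x + g (g x), x + g x + g (g x)⟫_ℝ = 12 := by
    rw [H.invM.inner_trace_self, h4, h]; norm_num
  have vg := H.invM.trace_fixed x
  have vθ : ⟪vec b highest, x + g x + g (g x)⟫_ℝ = 0 := by
    rw [← H.invM.inner_fixed hθ, xθ, mul_zero]
  have v7 : ⟪b 7, x + g x + g (g x)⟫_ℝ = 0 := by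
    rw [← H.invM.inner_fixed h7, x7, mul_zero]
  generalize x + g x + g (g x) = v at vM v12 vg vθ v7
  obtain ⟨r, rM, r4, rv⟩ := hb.exists_root_inner_eq_six vM v12
  have rg : g r = r := H.fixed_of_inner_sq rM r4 vg (by
    rw [real_inner_comm v r, rv, v12]; norm_num)
  obtain ⟨p, hp⟩ := hb.exists_even_inner rM (hb.vec_mem highest)
  obtain ⟨q, hq⟩ := hb.exists_even_inner rM (hb.mem 7)
  have θ7 : ⟪vec b highest, b 7⟫_ℝ = 2 := by
    rw [hb.inner_highest_basis]; simp
  -- The second vector is six times the component of `r` orthogonal to √2A₂. Cauchy–Schwarz gives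
  -- this component norm at least 3, leaving at most 1 for `(4/3)(p² - pq + q²)`, so `p = q = 0`.
  have hs := inner_sq_le v ((6 : ℝ) • r - ((2 * (2 * p) - (2 * q) : ℝ) • vec b highest +
    (2 * (2 * q) - (2 * p) : ℝ) • b 7))
  simp only [inner_sub_left, inner_sub_right, inner_add_left, inner_add_right, inner_smul_left,
    inner_smul_right, real_inner_comm (vec b highest) v, real_inner_comm (b 7) v,
    real_inner_comm r (vec b highest), real_inner_comm r (b 7), vθ, v7, rv, v12, hp, hq, θ7, r4,
    hb.inner_highest_self, hb.inner_basis_self, real_inner_comm (vec b highest) (b 7)] at hs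
  simp only [conj_trivial] at hs
  have hpq : ((p ^ 2 - p * q + q ^ 2 : ℤ) : ℝ) < 1 := by push_cast; nlinarith
  have hpq' : p ^ 2 - p * q + q ^ 2 < 1 := by exact_mod_cast hpq
  have p0 : p = 0 := by nlinarith [sq_nonneg (2 * q - p), sq_nonneg p]
  have q0 : q = 0 := by nlinarith [sq_nonneg (2 * p - q), sq_nonneg q]
  rw [p0] at hp
  rw [q0] at hq
  exact H.not_fixed_of_orthogonal hb hθ h7 rM r4 (by rw [real_inner_comm, hp]; simp)
    (by rw [real_inner_comm, hq]; simp) rg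

/-- The `E₆`-system orthogonal to the fixed roots is not centralized by `u`. -/
theorem exists_inner_u_eq_zero {b : Fin 8 → V} (hb : IsFrame b M)
    (hθ : g (vec b highest) = vec b highest) (h7 : g (b 7) = b 7) : ∃ k < 6, u (b k) ≠ b k := by
  by_contra! hk
  have uθ := H.u_eq_neg_of_fixed (hb.vec_mem highest) hb.inner_highest_self hθ
  have u7 := H.u_eq_neg_of_fixed (hb.mem 7) (hb.inner_basis_self 7) h7
  have hZ : u (vec b ![2, 3, 4, 6, 5, 4, 0, 0]) = vec b ![2, 3, 4, 6, 5, 4, 0, 0] := by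
    rw [map_vec]
    simp only [vec, Fin.sum_univ_eight, hk 0 (by decide), hk 1 (by decide), hk 2 (by decide),
      hk 3 (by decide), hk 4 (by decide), hk 5 (by decide)]
    simp
  -- This splits `3 b₆` into its √2A₂-part, negated by `u`, and its E₆-part of norm 24, supposedly
  -- fixed. Then `⟨b₆, ub₆⟩ = 4/3`, which is not a possible value.
  have e : (3 : ℝ) • b 6 = vec b highest - (2 : ℝ) • b 7 - vec b ![2, 3, 4, 6, 5, 4, 0, 0] := by
    have : vec b ![0, 0, 0, 0, 0, 0, 3, 0] =
        vec b (highest - ![0, 0, 0, 0, 0, 0, 0, 2] - ![2, 3, 4, 6, 5, 4, 0, 0]) := by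
      congr 1; decide +kernel
    rw [vec_sub, vec_sub] at this
    rw [show vec b ![0, 0, 0, 0, 0, 0, 0, 2] = (2 : ℝ) • b 7 by
      simp [vec, Fin.sum_univ_eight, two_smul]] at this
    rw [← this]
    simp [vec, Fin.sum_univ_eight]
    rw [← Int.cast_smul_eq_zsmul ℝ]
    norm_num
  have e2 : (3 : ℝ) • (b 6 + u (b 6)) = (-2 : ℝ) • vec b ![2, 3, 4, 6, 5, 4, 0, 0] := by
    have e' := congrArg u e
    rw [map_smul, map_sub, map_sub, map_smul, uθ, u7, hZ] at e'
    rw [smul_add, e', e]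
    module
  have h24 : ⟪vec b ![2, 3, 4, 6, 5, 4, 0, 0], vec b ![2, 3, 4, 6, 5, 4, 0, 0]⟫_ℝ = (24 : ℤ) :=
    hb.inner_vec_eq (by decide)
  have hn := congrArg (fun y => ⟪y, y⟫_ℝ) e2
  simp only [inner_smul_left, inner_smul_right, h24, inner_add_self, u.inner_map_map,
    hb.inner_basis_self, conj_trivial] at hn
  have c : u (b 6) = -b 6 ∨ u (b 6) = b 6 ∨ ⟪b 6, u (b 6)⟫_ℝ = 0 := by
    rcases H.root_cases (hb.mem 6) (hb.inner_basis_self 6) with h | h | h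
    · exact Or.inl h.2
    · exact Or.inr h.2
    · exact h.2.imp id Or.inr
  rcases c with c | c | c
  · rw [c, inner_neg_right, hb.inner_basis_self] at hn; norm_num at hn
  · rw [c, hb.inner_basis_self] at hn; norm_num at hn
  · rw [c] at hn; norm_num at hn

/-- Once D₄ is fixed, a moved end node `b 0` or `b 5` has a determined sum with its image, namely
twice its projection to D₄. Neither end can be moved alone, since the two are orthogonal. -/
theorem isAdapted_of_u_fix {b : Fin 8 → V} (hb : IsFrame b M)
    (hθ : g (vec b highest) = vec b highest) (h7 : g (b 7) = b 7)
    (hf : ∀ i ∈ ({1, 2, 3, 4} : Set (Fin 8)), u (b i) = b i) : IsAdapted b M g u := by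
  have uθ := H.u_eq_neg_of_fixed (hb.vec_mem highest) hb.inner_highest_self hθ
  have u7 := H.u_eq_neg_of_fixed (hb.mem 7) (hb.inner_basis_self 7) h7
  have f1 := hf 1 (by simp)
  have f2 := hf 2 (by simp)
  have f3 := hf 3 (by simp)
  have f4 := hf 4 (by simp)
  have low : ∀ j < 6, b j + g (b j) + g (g (b j)) = 0 ∧
      (u (b j) = b j ∨ ⟪b j, u (b j)⟫_ℝ = 0) := fun j hj => by
    have c7 : (CartanMatrix.E₈ *ᵥ (Pi.single j 1)) 7 = 0 := by
      clear * - hj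
      revert j; decide +kernel
    have cθ : (CartanMatrix.E₈ *ᵥ (Pi.single j 1)) ⬝ᵥ highest = 0 := by
      clear * - hj
      revert j; decide +kernel
    refine H.trace_eq_zero_of_orthogonal hb hθ h7 (hb.mem j) (hb.inner_basis_self j) ?_ ?_
    · rw [← vec_single b j, real_inner_comm, hb.inner_vec, cθ]; norm_num
    · rw [← vec_single b j, real_inner_comm, hb.inner_vec_basis, c7]; norm_num
  have form : ∀ j < 6, u (b j) ≠ b j → ∀ c : Fin 8 → ℤ,
      c 0 = 0 → c 5 = 0 → c 6 = 0 → c 7 = 0 → 2 * ((CartanMatrix.E₈ *ᵥ c) ⬝ᵥ c) = 8 →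
      2 * ((CartanMatrix.E₈ *ᵥ c) j) = -4 → b j + u (b j) = - vec b c :=
    fun j hj hj1 c c0 c5 c6 c7 cc cj => by
      have hu : u (vec b c) = vec b c := by
        rw [map_vec]
        simp only [vec, Fin.sum_univ_eight, f1, f2, f3, f4, c0, c5, c6, c7, zero_smul]
      have h1 : ⟪vec b c, vec b c⟫_ℝ = (8 : ℤ) := hb.inner_vec_eq cc
      have h2 : ⟪vec b c, b j⟫_ℝ = (-4 : ℤ) := hb.inner_vec_basis_eq cj
      have h0 := ((low j hj).2).resolve_left hj1
      -- Both sides have norm 8, and their inner product is 8 because `vec b c` is fixed by `u`.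
      refine eq_of_inner ?_ ?_
      · rw [inner_neg_right, H.inner_add_u hu, real_inner_comm, h2, inner_add_self,
          u.inner_map_map, hb.inner_basis_self, h0]
        norm_num
      · rw [inner_neg_neg, h1, inner_add_self, u.inner_map_map, hb.inner_basis_self, h0]
        norm_num
  have form0 := fun h => form 0 (by decide) h ![0, 1, 2, 2, 1, 0, 0, 0] rfl rfl rfl rfl (by decide)
    (by decide)
  have form5 := fun h => form 5 (by decide) h ![0, 1, 1, 2, 2, 0, 0, 0] rfl rfl rfl rfl (by decide)
    (by decide)
  have h05 : ⟪b 0, b 5⟫_ℝ = 0 := by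
    rw [hb.gram, show CartanMatrix.E₈ 0 5 = 0 by decide]; simp
  have m0 : u (b 0) ≠ b 0 := fun h => by
    have m5 : u (b 5) ≠ b 5 := fun h5 => by
      obtain ⟨k, hk6, hk⟩ := H.exists_inner_u_eq_zero hb hθ h7
      refine hk ?_
      clear hk
      have : k = 0 ∨ k = 1 ∨ k = 2 ∨ k = 3 ∨ k = 4 ∨ k = 5 := by
        revert k; decide
      rcases this with rfl | rfl | rfl | rfl | rfl | rfl <;> assumption
    have h1 := H.inner_add_u (x := b 5) h
    rw [form5 m5, inner_neg_left, real_inner_comm, real_inner_comm (b 0), h05, real_inner_comm,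
      hb.inner_vec_basis_eq (n := -2) (by decide)] at h1
    norm_num at h1
  have m5 : u (b 5) ≠ b 5 := fun h => by
    have h1 := H.inner_add_u (x := b 0) h
    rw [form0 m0, inner_neg_left, h05, hb.inner_vec_basis_eq (n := -2) (by decide)] at h1
    norm_num at h1
  refine ⟨hb, hθ, h7, uθ, u7, hf, ?_, ?_, fun j hj => (low j hj).1⟩
  · rw [← add_sub_cancel_left (b 0) (u (b 0)), form0 m0]; abel
  · rw [← add_sub_cancel_left (b 5) (u (b 5)), form5 m5]; abel

/-- Take a moved simple root of E₆ and make its difference with its image dominant of norm 8, the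
weight at nodes 0 and 5. Roots of E₆ with coefficient 1 at both ends share this difference, so the
members of D₄, being differences of such roots, are fixed by `u`. -/
theorem exists_isAdapted : ∃ b, IsAdapted b M g u := by
  obtain ⟨b₀, hb₀, hθ, h7⟩ := H.exists_fixed_frame
  obtain ⟨k, hk6, hk⟩ := H.exists_inner_u_eq_zero hb₀ hθ h7
  have uθ := H.u_eq_neg_of_fixed (hb₀.vec_mem highest) hb₀.inner_highest_self hθ
  have u7 := H.u_eq_neg_of_fixed (hb₀.mem 7) (hb₀.inner_basis_self 7) h7
  have kθ : ⟪vec b₀ highest, b₀ k⟫_ℝ = 0 := by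
    rw [hb₀.inner_highest_basis, Pi.single_eq_of_ne (by rintro rfl; exact absurd hk6 (by decide))]
    simp
  have k7 : ⟪b₀ 7, b₀ k⟫_ℝ = 0 := by
    have : CartanMatrix.E₈ 7 k = 0 := by
      clear * - hk6
      revert k; decide +kernel
    rw [hb₀.gram, this]; simp
  have hk0 := ((H.trace_eq_zero_of_orthogonal hb₀ hθ h7 (hb₀.mem k) (hb₀.inner_basis_self k) kθ
    k7).2).resolve_left hk
  have h8 := inner_sub_map_self (u := u) (hb₀.inner_basis_self k) hk0
  have huv := H.u_sub (b₀ k)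
  have hvM := M.sub_mem (hb₀.mem k) (H.u_mem (hb₀.mem k))
  have hvθ : ⟪vec b₀ highest, b₀ k - u (b₀ k)⟫_ℝ = 0 := by
    rw [real_inner_comm, H.inner_sub_u uθ, real_inner_comm, kθ, mul_zero]
  have hv7 : ⟪b₀ 7, b₀ k - u (b₀ k)⟫_ℝ = 0 := by
    rw [real_inner_comm, H.inner_sub_u u7, real_inner_comm, k7, mul_zero]
  obtain ⟨b, hb, eθ, e7, l, hl, -, hl8⟩ := hb₀.exists_frame_norm_E₆ hvM hvθ hv7
  rw [hl8 h8] at hl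
  clear hl8 kθ k7 hk hvθ hv7
  rw [← eθ] at hθ uθ
  rw [← e7] at h7 u7
  generalize b₀ k - u (b₀ k) = v at h8 huv hvM hl
  have orth : ∀ c : Fin 8 → ℤ, 2 * ((CartanMatrix.E₈ *ᵥ c) ⬝ᵥ c) = 4 →
      2 * ((CartanMatrix.E₈ *ᵥ c) ⬝ᵥ highest) = 0 → 2 * ((CartanMatrix.E₈ *ᵥ c) 7) = 0 →
      vec b c + g (vec b c) + g (g (vec b c)) = 0 ∧
        (u (vec b c) = vec b c ∨ ⟪vec b c, u (vec b c)⟫_ℝ = 0) := fun c c4 cθ c7 =>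
    H.trace_eq_zero_of_orthogonal hb hθ h7 (hb.vec_mem c) (hb.inner_vec_eq c4)
      (by rw [real_inner_comm]; exact_mod_cast hb.inner_vec_eq cθ)
      (by rw [real_inner_comm]; exact_mod_cast hb.inner_vec_basis_eq c7)
  have key : ∀ c : Fin 8 → ℤ, 2 * ((CartanMatrix.E₈ *ᵥ c) ⬝ᵥ c) = 4 →
      2 * ((CartanMatrix.E₈ *ᵥ c) ⬝ᵥ highest) = 0 → 2 * ((CartanMatrix.E₈ *ᵥ c) 7) = 0 →
      2 * (![1, 0, 0, 0, 0, 1, -2, 0] ⬝ᵥ c) = 4 → vec b c - u (vec b c) = v :=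
    fun c c4 cθ c7 cv => by
      refine H.sub_u_eq huv h8 (hb.inner_vec_eq c4) (orth c c4 cθ c7).2 ?_
      rw [inner_vec_weights hl, cv]; norm_num
  have step : ∀ c d : Fin 8 → ℤ, ∀ i, vec b c - u (vec b c) = v → vec b d - u (vec b d) = v →
      c - d = Pi.single i 1 → u (b i) = b i := fun c d i h1 h2 h5 => by
    have := h1.trans h2.symm
    rw [← vec_single b i, ← h5, vec_sub, map_sub]
    rw [sub_eq_sub_iff_add_eq_add] at this
    rw [sub_eq_sub_iff_add_eq_add, add_comm, ← this, add_comm]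
  have k0 := key ![1, 0, 1, 1, 1, 1, 0, 0] (by decide) (by decide) (by decide) (by decide)
  have k1 := key ![1, 1, 1, 1, 1, 1, 0, 0] (by decide) (by decide) (by decide) (by decide)
  have k2 := key ![1, 1, 1, 2, 1, 1, 0, 0] (by decide) (by decide) (by decide) (by decide)
  have k3 := key ![1, 1, 2, 2, 1, 1, 0, 0] (by decide) (by decide) (by decide) (by decide)
  have k4 := key ![1, 1, 1, 2, 2, 1, 0, 0] (by decide) (by decide) (by decide) (by decide)
  have f1 := step _ _ 1 k1 k0 (by decide)
  have f3 := step _ _ 3 k2 k1 (by decide)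
  have f2 := step _ _ 2 k3 k2 (by decide)
  have f4 := step _ _ 4 k4 k2 (by decide)
  refine ⟨b, H.isAdapted_of_u_fix hb hθ h7 ?_⟩
  rintro i (rfl | rfl | rfl | rfl)
  exacts [f1, f2, f3, f4]

end IsSixPair
end EE8Lattice

/-! ### Matching two simple systems of the same D₄. -/

open scoped InnerProductSpace

namespace EE8Lattice

open Matrix

/-- The action of `u` on an adapted frame. -/
def uAct : Fin 8 → Fin 8 → ℤ :=
  ![![-1, -1, -2, -2, -1, 0, 0, 0], ![0, 1, 0, 0, 0, 0, 0, 0], ![0, 0, 1, 0, 0, 0, 0, 0],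
    ![0, 0, 0, 1, 0, 0, 0, 0], ![0, 0, 0, 0, 1, 0, 0, 0], ![0, -1, -1, -2, -2, -1, 0, 0],
    ![0, 0, 0, 0, 0, 0, -1, 0], ![0, 0, 0, 0, 0, 0, 0, -1]]

/-- The isometries of `E₈` commuting with `uAct` and permuting the leaves of the central
`D₄`-diagram. -/
def leafAct (p : Fin 8 × Fin 8 × Fin 8) : Fin 8 → Fin 8 → ℤ :=
  let m : Fin 8 → Fin 8 → ℤ := ![0, ![1, 1, 2, 3, 3, 3, 2, 1], ![-1, -1, -2, -2, -1, 0, 0, 0], 0,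
    ![0, 0, 0, 0, 0, 1, 0, 0], 0, 0, 0]
  let o : Fin 8 → Fin 8 → ℤ := ![0, -highest, ![2, 2, 3, 4, 3, 2, 1, 0], 0,
    ![0, 0, 0, 0, 0, 0, 1, 0], 0, 0, 0]
  ![vec uAct (m p.2.1), Pi.single p.1 1, Pi.single p.2.1 1, Pi.single 3 1, Pi.single p.2.2 1,
    m p.2.2, o p.2.2, Pi.single 7 1]

/-- The permutations of the leaves of the central `D₄`-diagram. -/
def leafPerms : List (Fin 8 × Fin 8 × Fin 8) :=
  [(1, 2, 4), (1, 4, 2), (2, 1, 4), (2, 4, 1), (4, 1, 2), (4, 2, 1)]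

theorem leaf_pair : ∀ p : Fin 8 × Fin 8, p.1 ∈ [1, 2, 3, 4] → p.2 ∈ [1, 2, 3, 4] →
    (CartanMatrix.E₈ p.1 p.2 = 0 →
      p.1 ≠ p.2 ∧ (p.1 = 1 ∨ p.1 = 2 ∨ p.1 = 4) ∧ (p.2 = 1 ∨ p.2 = 2 ∨ p.2 = 4)) ∧
    (CartanMatrix.E₈ p.1 p.2 = -1 → p.1 ≠ 3 → p.2 = 3) := by
  decide +kernel

theorem leafPerms_complete {i j k l : Fin 8} (hi : i ∈ [1, 2, 3, 4]) (hj : j ∈ [1, 2, 3, 4])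
    (hk : k ∈ [1, 2, 3, 4]) (hl : l ∈ [1, 2, 3, 4]) (hij : CartanMatrix.E₈ i j = 0)
    (hil : CartanMatrix.E₈ i l = 0) (hjl : CartanMatrix.E₈ j l = 0)
    (hik : CartanMatrix.E₈ i k = -1) : (i, j, l) ∈ leafPerms ∧ k = 3 := by
  obtain ⟨n1, h1, h2⟩ := (leaf_pair (i, j) hi hj).1 hij
  obtain ⟨n2, -, h3⟩ := (leaf_pair (i, l) hi hl).1 hil
  obtain ⟨n3, -, -⟩ := (leaf_pair (j, l) hj hl).1 hjl
  refine ⟨?_, (leaf_pair (i, k) hi hk).2 hik ?_⟩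
  · dsimp only at *
    clear hi hj hk hl hij hil hjl hik
    rcases h1 with rfl | rfl | rfl <;> rcases h2 with rfl | rfl | rfl <;>
      rcases h3 with rfl | rfl | rfl <;>
      first | exact absurd rfl n1 | exact absurd rfl n2 | exact absurd rfl n3 | decide
  · rcases h1 with h | h | h <;> rw [h] <;> decide

theorem leafAct_gram : ∀ p ∈ leafPerms, ∀ q : Fin 8 × Fin 8,
    (CartanMatrix.E₈ *ᵥ leafAct p q.1) ⬝ᵥ leafAct p q.2 = CartanMatrix.E₈ q.1 q.2 := by
  decide +kernel

theorem leafAct_inv : ∀ p ∈ leafPerms, ∀ j : Fin 8,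
    vec (leafAct p) (cartanInv *ᵥ fun i => (CartanMatrix.E₈ *ᵥ leafAct p i) j) =
      Pi.single j 1 := by
  decide +kernel

theorem leafAct_uAct : ∀ p ∈ leafPerms, ∀ i : Fin 8,
    vec uAct (leafAct p i) = vec (leafAct p) (uAct i) := by
  decide +kernel

theorem vec_uAct_apply (c : Fin 8 → ℤ) : vec uAct c 0 = -c 0 ∧ vec uAct c 5 = -c 5 ∧
    vec uAct c 6 = -c 6 ∧ vec uAct c 7 = -c 7 := by
  simp [vec, uAct, Fin.sum_univ_eight]

theorem vec_vec {G : Type*} [AddCommGroup G] (b : Fin 8 → G) (A : Fin 8 → Fin 8 → ℤ)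
    (c : Fin 8 → ℤ) : vec (fun i => vec b (A i)) c = vec b (vec A c) := by
  simp only [vec, Finset.smul_sum, Finset.sum_apply, Pi.smul_apply, Finset.sum_smul, smul_smul,
    smul_eq_mul]
  exact Finset.sum_comm

/-- This characterizes the Weyl vector of D₄ among dominant vectors by its norm. The quadratic form
is diagonal in `2a - c`, `2b - c`, `2d - c` and `c`. -/
theorem D₄_norm_28 {a b c d : ℤ} (ha : 0 ≤ 2 * a - c) (hb : 0 ≤ 2 * b - c) (hd : 0 ≤ 2 * d - c)
    (hc : 0 ≤ 2 * c - a - b - d)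
    (h : (2 * a - c) ^ 2 + (2 * b - c) ^ 2 + (2 * d - c) ^ 2 + c ^ 2 = 28) :
    a = 3 ∧ b = 3 ∧ c = 5 ∧ d = 3 := by
  have hs : (2 * a - c) + (2 * b - c) + (2 * d - c) ≤ c := by linarith
  generalize ea : 2 * a - c = α at *
  generalize eb : 2 * b - c = β at *
  generalize ed : 2 * d - c = δ at *
  have c0 : 0 ≤ c := by linarith
  have key : ∀ p : Fin 6 × Fin 6 × Fin 6 × Fin 6, (p.1 : ℕ) + p.2.1 + p.2.2.1 ≤ p.2.2.2 →
      (p.1 : ℕ) ^ 2 + (p.2.1 : ℕ) ^ 2 + (p.2.2.1 : ℕ) ^ 2 + (p.2.2.2 : ℕ) ^ 2 = 28 →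
      (p.1 : ℕ) = 1 ∧ (p.2.1 : ℕ) = 1 ∧ (p.2.2.1 : ℕ) = 1 ∧ (p.2.2.2 : ℕ) = 5 := by
    decide +kernel
  have c5 : c < 6 := by nlinarith [sq_nonneg α, sq_nonneg β, sq_nonneg δ]
  lift α to ℕ using ha
  lift β to ℕ using hb
  lift δ to ℕ using hd
  lift c to ℕ using c0
  have := key (⟨α, by omega⟩, ⟨β, by omega⟩, ⟨δ, by omega⟩, ⟨c, by omega⟩)
    (by simp only; exact_mod_cast hs) (by simp only; exact_mod_cast h)
  simp only at this
  omega

/-- A root of height one is simple. The finite search shifts each variable, which lies between -2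
and 2, by 2; hence the total 18. -/
theorem D₄_height_one {a b c d : ℤ} (hs : a + b + c + d = 1)
    (h : (2 * a - c) ^ 2 + (2 * b - c) ^ 2 + (2 * d - c) ^ 2 + c ^ 2 = 4) :
    (a = 1 ∧ b = 0 ∧ c = 0 ∧ d = 0) ∨ (a = 0 ∧ b = 1 ∧ c = 0 ∧ d = 0) ∨
      (a = 0 ∧ b = 0 ∧ c = 1 ∧ d = 0) ∨ (a = 0 ∧ b = 0 ∧ c = 0 ∧ d = 1) := by
  have hs' : (2 * a - c) + (2 * b - c) + (2 * d - c) + 5 * c = 2 := by linarith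
  generalize ea : 2 * a - c = α at *
  generalize eb : 2 * b - c = β at *
  generalize ed : 2 * d - c = δ at *
  have key : ∀ p : Fin 5 × Fin 5 × Fin 5 × Fin 5,
      (p.1 : ℕ) + p.2.1 + p.2.2.1 + 5 * p.2.2.2 = 18 →
      ((p.1 : ℕ) - 2 : ℤ) ^ 2 + ((p.2.1 : ℕ) - 2 : ℤ) ^ 2 + ((p.2.2.1 : ℕ) - 2 : ℤ) ^ 2 +
        ((p.2.2.2 : ℕ) - 2 : ℤ) ^ 2 = 4 →
      (p.1 = 4 ∧ p.2.1 = 2 ∧ p.2.2.1 = 2 ∧ p.2.2.2 = 2) ∨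
      (p.1 = 2 ∧ p.2.1 = 4 ∧ p.2.2.1 = 2 ∧ p.2.2.2 = 2) ∨
      (p.1 = 2 ∧ p.2.1 = 2 ∧ p.2.2.1 = 4 ∧ p.2.2.2 = 2) ∨
      (p.1 = 1 ∧ p.2.1 = 1 ∧ p.2.2.1 = 1 ∧ p.2.2.2 = 3) := by
    decide +kernel
  have bound : ∀ x : ℤ, x ^ 2 ≤ 4 → ∃ k : Fin 5, x = (k : ℕ) - 2 := fun x hx => by
    have h1 : x ≤ 2 := by nlinarith
    have h2 : -2 ≤ x := by nlinarith
    exact ⟨⟨(x + 2).toNat, by omega⟩, by simp; omega⟩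
  have p1 := sq_nonneg α
  have p2 := sq_nonneg β
  have p3 := sq_nonneg δ
  have p4 := sq_nonneg c
  obtain ⟨α', hα⟩ := bound α (by linarith)
  obtain ⟨β', hβ⟩ := bound β (by linarith)
  obtain ⟨δ', hδ⟩ := bound δ (by linarith)
  obtain ⟨c', hc⟩ := bound c (by linarith)
  rw [hα, hβ, hδ, hc] at h
  rcases key (α', β', δ', c') (by dsimp only; omega) h with
    ⟨h1, h2, h3, h4⟩ | ⟨h1, h2, h3, h4⟩ | ⟨h1, h2, h3, h4⟩ | ⟨h1, h2, h3, h4⟩ <;>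
  · dsimp only at h1 h2 h3 h4
    subst h1 h2 h3 h4
    simp at hα hβ hδ hc
    omega

section

variable {V : Type*} [NormedAddCommGroup V] [InnerProductSpace ℝ V]

theorem IsFrame.of_gram {b : Fin 8 → V} {M : Submodule ℤ V} (hb : IsFrame b M)
    (A : Fin 8 → Fin 8 → ℤ)
    (hA : ∀ q : Fin 8 × Fin 8, (CartanMatrix.E₈ *ᵥ A q.1) ⬝ᵥ A q.2 = CartanMatrix.E₈ q.1 q.2)
    (hA' : ∀ j, ∃ c, vec A c = Pi.single j 1) : IsFrame (fun i => vec b (A i)) M := by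
  refine ⟨fun i j => ?_, le_antisymm ?_ ?_⟩
  · rw [hb.inner_vec, hA (i, j)]; push_cast; rfl
  · rw [Submodule.span_le]
    rintro _ ⟨i, rfl⟩
    exact hb.vec_mem _
  · rw [← hb.span_eq, Submodule.span_le]
    rintro _ ⟨j, rfl⟩
    obtain ⟨c, hc⟩ := hA' j
    rw [← vec_single b j, ← hc, ← vec_vec]
    exact Submodule.sum_mem _ fun i _ =>
      Submodule.smul_mem _ _ (Submodule.subset_span (Set.mem_range_self i))

/-- A frame on which `u` acts through `uAct`. -/
structure IsUFrame (b : Fin 8 → V) (M : Submodule ℤ V) (u : V ≃ₗᵢ[ℝ] V) : Prop where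
  frame : IsFrame b M
  u_basis : ∀ i, u (b i) = vec b (uAct i)

namespace IsUFrame

variable {b : Fin 8 → V} {M : Submodule ℤ V} {u : V ≃ₗᵢ[ℝ] V} (hb : IsUFrame b M u)
include hb

theorem u_vec (c : Fin 8 → ℤ) : u (vec b c) = vec b (vec uAct c) := by
  rw [map_vec, ← vec_vec]
  simp only [hb.u_basis]
  rfl

theorem relabel {p : Fin 8 × Fin 8 × Fin 8} (hp : p ∈ leafPerms) :
    ∃ b', IsUFrame b' M u ∧ b' 1 = b p.1 ∧ b' 2 = b p.2.1 ∧ b' 3 = b 3 ∧ b' 4 = b p.2.2 :=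
  ⟨fun i => vec b (leafAct p i),
    ⟨hb.frame.of_gram _ (leafAct_gram p hp) fun j => ⟨_, leafAct_inv p hp j⟩, fun i => by
      rw [hb.u_vec, leafAct_uAct p hp, ← vec_vec]⟩,
    vec_single b _, vec_single b _, vec_single b _, vec_single b _⟩

theorem exists_fixed_coords {x : V} (hx : x ∈ M) (hu : u x = x) :
    ∃ a₁ a₂ a₃ a₄ : ℤ, x = vec b ![0, a₁, a₂, a₃, a₄, 0, 0, 0] := by
  obtain ⟨c, rfl⟩ := (hb.frame.mem_iff x).1 hx
  rw [hb.u_vec] at hu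
  obtain ⟨h0, h5, h6, h7⟩ := vec_uAct_apply c
  rw [hb.frame.vec_injective hu] at h0 h5 h6 h7
  refine ⟨c 1, c 2, c 3, c 4, congrArg (vec b) (funext fun i => ?_)⟩
  fin_cases i <;> simp <;> omega

omit hb in
theorem E₈_mulVec_D₄ (a₁ a₂ a₃ a₄ e₁ e₂ e₃ e₄ : ℤ) :
    (CartanMatrix.E₈ *ᵥ ![0, a₁, a₂, a₃, a₄, 0, 0, 0]) ⬝ᵥ ![0, e₁, e₂, e₃, e₄, 0, 0, 0] =
      (2 * a₁ - a₃) * e₁ + (2 * a₂ - a₃) * e₂ + (2 * a₃ - a₁ - a₂ - a₄) * e₃ +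
        (2 * a₄ - a₃) * e₄ := by
  simp [mulVec, dotProduct, Fin.sum_univ_eight, CartanMatrix.E₈]
  ring

-- The vector with coefficients 3, 3, 5, 3 is the Weyl vector of the D₄ seen by `b`. Being dominant
-- for `b'` and of norm 28, it is also the Weyl vector seen by `b'`, so the two simple systems agree
-- up to a permutation of the leaves, which `relabel` undoes.
omit hb in
theorem eq_of_leaves {b' : Fin 8 → V} {N : Submodule ℤ V} (hb : IsUFrame b M u)
    (hb' : IsUFrame b' N u) (hN : ∀ i ∈ ({1, 2, 3, 4} : Set (Fin 8)), b i ∈ N)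
    (hdom : ∀ i ∈ ({1, 2, 3, 4} : Set (Fin 8)), 0 ≤ ⟪vec b ![0, 3, 3, 5, 3, 0, 0, 0], b' i⟫_ℝ) :
    ∃ b'', IsUFrame b'' N u ∧ ∀ i ∈ ({1, 2, 3, 4} : Set (Fin 8)), b'' i = b i := by
  have hu : ∀ i ∈ ({1, 2, 3, 4} : Set (Fin 8)), u (b i) = b i := by
    rintro i (rfl | rfl | rfl | rfl) <;>
      exact (hb.u_basis _).trans ((congrArg (vec b) (by decide +kernel)).trans (vec_single b _))
  have hx : vec b ![0, 3, 3, 5, 3, 0, 0, 0] ∈ N := by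
    simp only [vec, Fin.sum_univ_eight, Matrix.cons_val, zero_smul, zero_add, add_zero]
    exact N.add_mem (N.add_mem (N.add_mem (N.smul_mem _ (hN 1 (by simp)))
      (N.smul_mem _ (hN 2 (by simp)))) (N.smul_mem _ (hN 3 (by simp))))
      (N.smul_mem _ (hN 4 (by simp)))
  have hxu : u (vec b ![0, 3, 3, 5, 3, 0, 0, 0]) = vec b ![0, 3, 3, 5, 3, 0, 0, 0] := by
    rw [hb.u_vec]; congr 1; decide +kernel
  obtain ⟨a₁, a₂, a₃, a₄, ha⟩ := hb'.exists_fixed_coords hx hxu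
  have hn : ⟪vec b ![0, 3, 3, 5, 3, 0, 0, 0], vec b ![0, 3, 3, 5, 3, 0, 0, 0]⟫_ℝ = (28 : ℤ) :=
    hb.frame.inner_vec_eq (by decide)
  rw [ha, hb'.frame.inner_vec, Int.cast_inj, E₈_mulVec_D₄] at hn
  have pos : ∀ c : Fin 8 → ℤ, ∀ i ∈ ({1, 2, 3, 4} : Set (Fin 8)), c = Pi.single i 1 →
      0 ≤ (CartanMatrix.E₈ *ᵥ ![0, a₁, a₂, a₃, a₄, 0, 0, 0]) ⬝ᵥ c := fun c i hi hc => by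
    have := hdom i hi
    rw [ha, ← vec_single b' i, ← hc, hb'.frame.inner_vec] at this
    have h2 : 0 ≤ 2 * ((CartanMatrix.E₈ *ᵥ ![0, a₁, a₂, a₃, a₄, 0, 0, 0]) ⬝ᵥ c) := by
      exact_mod_cast this
    linarith
  have q1 := pos ![0, 1, 0, 0, 0, 0, 0, 0] 1 (by simp) (by decide)
  have q2 := pos ![0, 0, 1, 0, 0, 0, 0, 0] 2 (by simp) (by decide)
  have q3 := pos ![0, 0, 0, 1, 0, 0, 0, 0] 3 (by simp) (by decide)
  have q4 := pos ![0, 0, 0, 0, 1, 0, 0, 0] 4 (by simp) (by decide)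
  rw [E₈_mulVec_D₄] at q1 q2 q3 q4
  obtain ⟨rfl, rfl, rfl, rfl⟩ := D₄_norm_28 (a := a₁) (b := a₂) (c := a₃) (d := a₄)
    (by linarith) (by linarith) (by linarith) (by linarith) (by linarith)
  have find : ∀ i ∈ ({1, 2, 3, 4} : Set (Fin 8)), ∃ j ∈ [(1 : Fin 8), 2, 3, 4], b i = b' j := by
    intro i hi
    obtain ⟨e₁, e₂, e₃, e₄, he⟩ := hb'.exists_fixed_coords (hN i hi) (hu i hi)
    have h4 := hb.frame.inner_basis_self i
    rw [he, hb'.frame.inner_vec, E₈_mulVec_D₄] at h4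
    have h2 : ⟪vec b ![0, 3, 3, 5, 3, 0, 0, 0], b i⟫_ℝ = (2 : ℤ) := by
      refine hb.frame.inner_vec_basis_eq ?_
      rcases hi with rfl | rfl | rfl | rfl <;> decide +kernel
    rw [ha, he, hb'.frame.inner_vec, Int.cast_inj, E₈_mulVec_D₄] at h2
    have h4' : 2 * ((2 * e₁ - e₃) * e₁ + (2 * e₂ - e₃) * e₂ + (2 * e₃ - e₁ - e₂ - e₄) * e₃ +
        (2 * e₄ - e₃) * e₄) = 4 := by exact_mod_cast h4
    rcases D₄_height_one (a := e₁) (b := e₂) (c := e₃) (d := e₄) (by linarith) (by linarith) with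
      ⟨rfl, rfl, rfl, rfl⟩ | ⟨rfl, rfl, rfl, rfl⟩ | ⟨rfl, rfl, rfl, rfl⟩ | ⟨rfl, rfl, rfl, rfl⟩
    · refine ⟨1, by simp, he.trans ?_⟩; rw [← vec_single b' 1]; congr 1; decide
    · refine ⟨2, by simp, he.trans ?_⟩; rw [← vec_single b' 2]; congr 1; decide
    · refine ⟨3, by simp, he.trans ?_⟩; rw [← vec_single b' 3]; congr 1; decide
    · refine ⟨4, by simp, he.trans ?_⟩; rw [← vec_single b' 4]; congr 1; decide
  obtain ⟨j₁, hj₁, e₁⟩ := find 1 (by simp)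
  obtain ⟨j₂, hj₂, e₂⟩ := find 2 (by simp)
  obtain ⟨j₃, hj₃, e₃⟩ := find 3 (by simp)
  obtain ⟨j₄, hj₄, e₄⟩ := find 4 (by simp)
  have gr : ∀ i i' j j', b i = b' j → b i' = b' j' →
      CartanMatrix.E₈ j j' = CartanMatrix.E₈ i i' := fun i i' j j' h h' => by
    have h1 := hb.frame.gram i i'
    rw [h, h', hb'.frame.gram] at h1
    exact_mod_cast mul_left_cancel₀ (two_ne_zero (α := ℝ)) h1
  obtain ⟨hp, rfl⟩ := leafPerms_complete hj₁ hj₂ hj₃ hj₄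
    ((gr 1 2 _ _ e₁ e₂).trans (by decide)) ((gr 1 4 _ _ e₁ e₄).trans (by decide))
    ((gr 2 4 _ _ e₂ e₄).trans (by decide)) ((gr 1 3 _ _ e₁ e₃).trans (by decide))
  obtain ⟨b'', hb'', h1, h2, h3, h4⟩ := hb'.relabel hp
  refine ⟨b'', hb'', ?_⟩
  rintro i (rfl | rfl | rfl | rfl)
  · rw [h1, e₁]
  · rw [h2, e₂]
  · rw [h3, e₃]
  · rw [h4, e₄]

end IsUFrame

end
end EE8Lattice

/-! ### Gluing a simple system of the eigenlattice. -/

open scoped InnerProductSpace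

namespace EE8Lattice

open Matrix

variable {V : Type*} [NormedAddCommGroup V] [InnerProductSpace ℝ V]

variable [FiniteDimensional ℝ V]

namespace IsAdapted

variable {b : Fin 8 → V} {M : Submodule ℤ V} {g u : V ≃ₗᵢ[ℝ] V} (hb : IsAdapted b M g u)
include hb

omit [FiniteDimensional ℝ V] in
theorem isUFrame : IsUFrame b M u := by
  have f1 := hb.u_fix 1 (by simp)
  have f2 := hb.u_fix 2 (by simp)
  have f3 := hb.u_fix 3 (by simp)
  have f4 := hb.u_fix 4 (by simp)
  have f6 : u (b 6) = -b 6 := by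
    have h := hb.uθ
    rw [map_vec] at h
    simp only [vec, Fin.sum_univ_eight, highest, Matrix.cons_val, f1, f2, f3, f4, hb.u0, hb.u5,
      hb.u7, zero_smul, one_smul, add_zero, zero_add] at h
    have h3 : (3 : ℝ) • u (b 6) = (3 : ℝ) • (-b 6) := by
      rw [← sub_eq_zero] at h ⊢
      rw [← h]
      module
    exact smul_right_injective V three_ne_zero h3
  refine ⟨hb.frame, fun i => ?_⟩
  fin_cases i
  · change u (b 0) = _
    rw [hb.u0]
    simp [vec, uAct, Fin.sum_univ_eight]
    module
  · exact f1.trans (by simp [vec, uAct, Fin.sum_univ_eight])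
  · exact f2.trans (by simp [vec, uAct, Fin.sum_univ_eight])
  · exact f3.trans (by simp [vec, uAct, Fin.sum_univ_eight])
  · exact f4.trans (by simp [vec, uAct, Fin.sum_univ_eight])
  · change u (b 5) = _
    rw [hb.u5]
    simp [vec, uAct, Fin.sum_univ_eight]
    module
  · exact f6.trans (by simp [vec, uAct, Fin.sum_univ_eight])
  · exact hb.u7.trans (by simp [vec, uAct, Fin.sum_univ_eight])

end IsAdapted

namespace IsSixPair

variable {Q M N : Submodule ℤ V} {g u : V ≃ₗᵢ[ℝ] V} (H : IsSixPair Q M N g u)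
include H

/-- Moving the frame of `N` by reflections in its D₄ makes the Weyl vector from `M` dominant,
without disturbing the highest root or the last member. -/
theorem exists_matching {b b' : Fin 8 → V} (hb : IsAdapted b M g u)
    (hb' : IsAdapted b' N (g ^ 2) u) :
    ∃ b'', IsUFrame b'' N u ∧ ∀ i ∈ ({1, 2, 3, 4} : Set (Fin 8)), b'' i = b i := by
  have hN : ∀ i ∈ ({1, 2, 3, 4} : Set (Fin 8)), b i ∈ N := fun i hi =>
    H.mem_N (hb.frame.mem i) (hb.u_fix i hi)
  have hx : vec b ![0, 3, 3, 5, 3, 0, 0, 0] ∈ N := by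
    simp only [vec, Fin.sum_univ_eight, Matrix.cons_val, zero_smul, zero_add, add_zero]
    exact N.add_mem (N.add_mem (N.add_mem (N.smul_mem _ (hN 1 (by simp)))
      (N.smul_mem _ (hN 2 (by simp)))) (N.smul_mem _ (hN 3 (by simp))))
      (N.smul_mem _ (hN 4 (by simp)))
  obtain ⟨c, hc, htr, hdom⟩ := hb'.frame.exists_dominant {1, 2, 3, 4} hx
  have eθ : vec c highest = vec b' highest := by
    rw [hc.eq_vec (hb'.frame.vec_mem highest) (l := Pi.single 7 1) fun j => ?_]
    · congr 1; decide +kernel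
    · rw [htr, hb'.frame.inner_highest_basis]
      intro i hi
      rw [hb'.frame.inner_highest_basis,
        Pi.single_eq_of_ne (by rintro rfl; simp at hi)]
      norm_num
  have e7 : c 7 = b' 7 := by
    rw [hc.eq_vec (hb'.frame.mem 7) (l := fun j => CartanMatrix.E₈ 7 j) fun j => ?_,
      ← vec_single c 7]
    · congr 1; decide +kernel
    · rw [htr, hb'.frame.gram]
      intro i hi
      rw [hb'.frame.gram]
      have : CartanMatrix.E₈ 7 i = 0 := by
        rcases hi with rfl | rfl | rfl | rfl <;> decide
      rw [this]; norm_num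
  have hu : ∀ i ∈ ({1, 2, 3, 4} : Set (Fin 8)), u (c i) = c i := fun i hi => by
    -- `c i - u (c i)` is orthogonal to D₄, so it pairs with `c i` as with `b' i`, that is to zero;
    -- but that pairing is half its norm.
    have h0 := htr (c i - u (c i)) (fun j hj => by
      rw [real_inner_comm]
      exact H.inner_eq_zero (hb'.u_fix j hj) (H.u_sub _)) i
    have h1 : ⟪b' i, c i - u (c i)⟫_ℝ = 0 := H.inner_eq_zero (hb'.u_fix i hi) (H.u_sub _)
    have h3 := H.inner_sub_u (x := c i) (H.u_sub (c i))
    rw [real_inner_comm (c i - u (c i)) (c i), h0, real_inner_comm (b' i), h1, mul_zero,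
      inner_self_eq_zero, sub_eq_zero] at h3
    exact h3.symm
  have hc' : IsAdapted c N (g ^ 2) u :=
    H.symm.isAdapted_of_u_fix hc (by rw [eθ, hb'.gθ]) (by rw [e7, hb'.g7]) hu
  exact hb.isUFrame.eq_of_leaves hc'.isUFrame hN hdom

/-- The part of `M` negated by `u` is fixed by `t_N`, hence orthogonal to `N`. -/
theorem inner_M_N {x y : V} (hx : x ∈ M) (hy : y ∈ N) : 2 * ⟪x, y⟫_ℝ = ⟪x + u x, y⟫_ℝ := by
  have h : ⟪x - u x, y⟫_ℝ = 0 := by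
    rw [real_inner_comm]
    refine inner_eq_zero_of_invol (M := N) (invol_apply_of_mem hy) ?_
    rw [H.prod, H.u_sub, map_neg, invol_apply_of_mem (M.sub_mem hx (H.u_mem hx)), neg_neg]
  rw [inner_sub_left] at h
  rw [inner_add_left]
  linarith

end IsSixPair

/-- A simple system of the negative eigenlattice of `u`, in coordinates with respect to a frame of
`M`. -/
def eigenM : Fin 8 → Fin 8 → ℤ :=
  ![![-2, -3, -4, -6, -5, -4, -3, -2], ![-1, 0, -1, -1, -1, -1, 0, 0], ![0, 0, 0, 0, 0, 0, 0, 1],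
    ![2, 2, 3, 4, 3, 2, 1, 0], ![-1, -1, -2, -2, -1, 0, 0, 0], 0, 0, 0]

/-- A simple system of the negative eigenlattice of `u`, in coordinates with respect to a frame of
`N`. -/
def eigenN : Fin 8 → Fin 8 → ℤ :=
  ![0, ![1, 1, 2, 3, 3, 3, 2, 1], 0, 0, ![1, 1, 2, 2, 1, 0, 0, 0],
    ![-2, -2, -3, -4, -3, -2, -1, 0], ![0, 0, 0, 0, 0, 0, 0, -1], ![0, 0, 0, 0, 0, 0, -1, 0]]

/-- Members 0, 2, 3 come from the D₄ of `M` negated by `u`, and 5, 6, 7 from that of `N`. Members 1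
and 4 glue the two. The mixed terms use `inner_vec_M_N`. -/
theorem eigen_gram : ∀ q : Fin 8 × Fin 8,
    2 * ((CartanMatrix.E₈ *ᵥ eigenM q.1) ⬝ᵥ eigenM q.2) +
      2 * ((CartanMatrix.E₈ *ᵥ eigenN q.1) ⬝ᵥ eigenN q.2) +
      (CartanMatrix.E₈ *ᵥ (eigenM q.1 + vec uAct (eigenM q.1))) ⬝ᵥ eigenN q.2 +
      (CartanMatrix.E₈ *ᵥ (eigenM q.2 + vec uAct (eigenM q.2))) ⬝ᵥ eigenN q.1 =
    2 * CartanMatrix.E₈ q.1 q.2 := by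
  decide +kernel

/-- In each member the `u`-fixed components from `M` and `N`, which lie in the shared D₄, cancel. -/
theorem eigen_neg (i : Fin 8) :
    eigenM i + vec uAct (eigenM i) + (eigenN i + vec uAct (eigenN i)) = 0 := by
  revert i; decide +kernel

theorem add_vec_uAct (c : Fin 8 → ℤ) : (c + vec uAct c) 0 = 0 ∧ (c + vec uAct c) 5 = 0 ∧
    (c + vec uAct c) 6 = 0 ∧ (c + vec uAct c) 7 = 0 := by
  obtain ⟨h0, h5, h6, h7⟩ := vec_uAct_apply c
  simp [h0, h5, h6, h7]

section Eigen

variable {Q M N : Submodule ℤ V} {g u : V ≃ₗᵢ[ℝ] V} (H : IsSixPair Q M N g u) {b b' : Fin 8 → V}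
  (hb : IsUFrame b M u) (hb' : IsUFrame b' N u)
  (h : ∀ i ∈ ({1, 2, 3, 4} : Set (Fin 8)), b' i = b i)
include H hb hb' h

omit [InnerProductSpace ℝ V] [FiniteDimensional ℝ V] H hb hb' in
theorem vec_eq_vec_of_leaves {c : Fin 8 → ℤ} (h0 : c 0 = 0) (h5 : c 5 = 0) (h6 : c 6 = 0)
    (h7 : c 7 = 0) : vec b c = vec b' c := by
  simp only [vec, Fin.sum_univ_eight, h0, h5, h6, h7, zero_smul, h 1 (by simp), h 2 (by simp),
    h 3 (by simp), h 4 (by simp)]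

theorem inner_vec_M_N (c d : Fin 8 → ℤ) :
    ⟪vec b c, vec b' d⟫_ℝ = (((CartanMatrix.E₈ *ᵥ (c + vec uAct c)) ⬝ᵥ d : ℤ) : ℝ) := by
  have h2 := H.inner_M_N (hb.frame.vec_mem c) (hb'.frame.vec_mem d)
  obtain ⟨p0, p5, p6, p7⟩ := add_vec_uAct c
  rw [hb.u_vec, ← vec_add, vec_eq_vec_of_leaves h p0 p5 p6 p7, hb'.frame.inner_vec] at h2
  push_cast at h2
  linarith

theorem isFrame_eigen :
    IsFrame (fun i => vec b (eigenM i) + vec b' (eigenN i))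
      (Submodule.span ℤ (Set.range fun i => vec b (eigenM i) + vec b' (eigenN i))) := by
  refine ⟨fun i j => ?_, rfl⟩
  rw [inner_add_left, inner_add_right, inner_add_right, real_inner_comm (vec b (eigenM j)) (vec b' (eigenN i)),
    inner_vec_M_N H hb hb' h, inner_vec_M_N H hb hb' h, hb.frame.inner_vec, hb'.frame.inner_vec]
  have := congrArg (Int.cast (R := ℝ)) (eigen_gram (i, j))
  push_cast at this ⊢
  linarith

omit [FiniteDimensional ℝ V] H in
theorem u_eigen (i : Fin 8) :
    u (vec b (eigenM i) + vec b' (eigenN i)) = -(vec b (eigenM i) + vec b' (eigenN i)) := by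
  obtain ⟨p0, p5, p6, p7⟩ := add_vec_uAct (eigenM i)
  rw [eq_neg_iff_add_eq_zero, map_add, hb.u_vec, hb'.u_vec]
  have e := vec_eq_vec_of_leaves h p0 p5 p6 p7
  have e2 : vec b' (eigenM i + vec uAct (eigenM i)) +
      vec b' (eigenN i + vec uAct (eigenN i)) = 0 := by
    rw [← vec_add, eigen_neg]; simp [vec]
  rw [← e, vec_add, vec_add] at e2
  rw [← e2]
  abel

end Eigen
end EE8Lattice

/-! ### The (-1)-eigenlattice of `u` is an EE₈-lattice. -/

open scoped InnerProductSpace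

namespace EE8Lattice

open Matrix

variable {V : Type*} [NormedAddCommGroup V] [InnerProductSpace ℝ V] [FiniteDimensional ℝ V]

/-- An `EE₈`-sublattice orthogonal to an eight-dimensional subspace of a sixteen-dimensional space
spans the orthogonal complement of this subspace. -/
theorem mem_span_of_orthogonal {Q Y : Submodule ℤ V}
    (hfin : Module.finrank ℝ (Submodule.span ℝ (Q : Set V)) = 16) (hY : IsEE8 Y) (hYQ : Y ≤ Q)
    {ι : Type*} [Fintype ι] (hι : Fintype.card ι = 8) {w : ι → V} (hw : LinearIndependent ℝ w)
    (hwQ : ∀ i, w i ∈ Submodule.span ℝ (Q : Set V)) (hYw : ∀ y ∈ Y, ∀ i, ⟪w i, y⟫_ℝ = 0) {x : V}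
    (hx : x ∈ Submodule.span ℝ (Q : Set V)) (hxw : ∀ i, ⟪w i, x⟫_ℝ = 0) :
    x ∈ Submodule.span ℝ (Y : Set V) := by
  have hK : Submodule.span ℝ (Set.range w) ≤ Submodule.span ℝ (Q : Set V) :=
    Submodule.span_le.2 (by rintro _ ⟨i, rfl⟩; exact hwQ i)
  have hdim := Submodule.finrank_add_inf_finrank_orthogonal hK
  rw [finrank_span_eq_card hw, hι, hfin] at hdim
  have mem : ∀ z, (∀ i, ⟪w i, z⟫_ℝ = 0) → z ∈ (Submodule.span ℝ (Set.range w))ᗮ := fun z hz => by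
    rw [Submodule.mem_orthogonal]
    intro v hv
    induction hv using Submodule.span_induction with
    | mem v hv => obtain ⟨i, rfl⟩ := hv; exact hz i
    | zero => simp
    | add v v' _ _ h h' => rw [inner_add_left, h, h', add_zero]
    | smul c v _ h => rw [inner_smul_left, h, mul_zero]
  have hle : Submodule.span ℝ (Y : Set V) ≤
      (Submodule.span ℝ (Set.range w))ᗮ ⊓ Submodule.span ℝ (Q : Set V) :=
    Submodule.span_le.2 fun y hy => ⟨mem y (hYw y hy), Submodule.subset_span (hYQ hy)⟩
  rw [Submodule.eq_of_le_of_finrank_eq hle (by rw [finrank_span_real hY]; omega)]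
  exact ⟨mem x hxw, hx⟩

/-- The linear map `1 + g + g²`. -/
def traceMap (g : V ≃ₗᵢ[ℝ] V) : V →ₗ[ℝ] V :=
  LinearMap.id + g.toLinearEquiv.toLinearMap + g.toLinearEquiv.toLinearMap ∘ₗ
    g.toLinearEquiv.toLinearMap

/-- The indices of the leaves and the centre of the central `D₄`-diagram. -/
def centre : Fin 4 → Fin 8 := ![1, 2, 3, 4]

theorem centre_injective : Function.Injective centre := by decide

theorem centre_mem (k : Fin 4) : centre k ∈ ({1, 2, 3, 4} : Set (Fin 8)) := by
  fin_cases k <;> simp [centre]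

theorem centre_lt (k : Fin 4) : centre k < 6 := by
  revert k; decide

namespace IsSixPair

variable {Q M N : Submodule ℤ V} {g u : V ≃ₗᵢ[ℝ] V} (H : IsSixPair Q M N g u)
include H

theorem u_trace {x : V} (hx : x ∈ Submodule.span ℝ (Q : Set V)) :
    u (x + g x + g (g x)) = -(x + g x + g (g x)) := by
  have hle : Submodule.span ℝ (Q : Set V) ≤
      LinearMap.ker (u.toLinearEquiv.toLinearMap ∘ₗ traceMap g + traceMap g) :=
    Submodule.span_le.2 fun q hq => by
      change u (q + g q + g (g q)) + (q + g q + g (g q)) = 0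
      rw [H.kill q hq, neg_add_cancel]
  exact eq_neg_of_add_eq_zero_left (hle hx)

/-- A vector in both spans satisfies `g²ux = x`, hence is fixed by both `g` and `u`. The identity
`kill` then gives `6x = 0`. -/
theorem finrank_span : Module.finrank ℝ (Submodule.span ℝ (Q : Set V)) = 16 := by
  have hN := H.invN.isEE8.image (g ^ 2)
  have e : Submodule.span ℝ (Q : Set V) = Submodule.span ℝ (M : Set V) ⊔
      Submodule.span ℝ (image (g ^ 2) N : Set V) := by
    refine le_antisymm (Submodule.span_le.2 fun q hq => ?_) (sup_le
      (Submodule.span_mono H.invM.le) (Submodule.span_mono ?_))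
    · rw [SetLike.mem_coe, ← H.sup, Submodule.mem_sup] at hq
      obtain ⟨m, hm, n, hn, rfl⟩ := hq
      exact Submodule.add_mem_sup (Submodule.subset_span hm) (Submodule.subset_span hn)
    · rw [← H.sup]; exact le_sup_right (a := M)
  have hinf : Submodule.span ℝ (M : Set V) ⊓ Submodule.span ℝ (image (g ^ 2) N : Set V) = ⊥ := by
    rw [eq_bot_iff]
    rintro x ⟨hx, hx'⟩
    have hk := H.u_trace (x := x) (by rw [e]; exact Submodule.mem_sup_left hx)
    have h1 := invol_eq_neg_iff.2 hx
    have h2 := invol_eq_neg_iff.2 hx'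
    rw [H.invol_image_sq, ← h1] at h2
    have h3 : g (g (u x)) = x := (invol M).injective h2
    have h4 : g x = x := by
      have := H.invM.cube (u (g (u x)))
      rw [H.u_g, H.u_sq] at this
      calc g x = g (g (g (u x))) := by rw [h3]
        _ = u x := H.invM.cube _
        _ = u (g (g (u x))) := by rw [h3]
        _ = g (g x) := by rw [H.u_g, H.u_g, H.u_sq]
        _ = g (g (g (g (u x)))) := by rw [h3]
        _ = g (u x) := by rw [H.invM.cube]
        _ = u (g x) := (H.u_g x).symm
        _ = u (g (g (g (u x)))) := by rw [h3]
        _ = u (u x) := by rw [H.invM.cube]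
        _ = x := H.u_sq x
    have h5 : u x = x := by
      rw [← H.u_g, ← H.u_g, h4, h4] at h3
      exact h3
    rw [h4, h4, map_add, map_add, h5] at hk
    have h6 : (6 : ℝ) • x = 0 := by
      rw [← sub_eq_zero] at hk
      rw [← hk]; module
    rw [smul_eq_zero, or_iff_right (by norm_num)] at h6
    rw [h6]; exact Submodule.zero_mem _
  have hd := Submodule.finrank_sup_add_finrank_inf_eq (Submodule.span ℝ (M : Set V))
    (Submodule.span ℝ (image (g ^ 2) N : Set V))
  rw [hinf, finrank_bot, ← e, finrank_span_real H.invM.isEE8, finrank_span_real hN] at hd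
  exact hd

theorem inner_sub_map {x y : V} (hx : x ∈ M) (hy : y ∈ M) : ⟪x, g (g y) - g y⟫_ℝ = 0 := by
  rw [inner_sub_right, sub_eq_zero, ← (invol M).inner_map_map, H.invM.conj, H.invM.conj,
    invol_apply_of_mem hx, invol_apply_of_mem hy, H.invM.cube, map_neg, inner_neg_neg]

section Adapted

variable {b : Fin 8 → V} (hb : IsAdapted b M g u)
include hb

omit [FiniteDimensional ℝ V] H in
theorem _root_.EE8Lattice.IsAdapted.linearIndependent_centre : LinearIndependent ℝ fun k => b (centre k) :=
  (linearIndependent_of_isFrame hb.frame).comp centre centre_injective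

omit [FiniteDimensional ℝ V] H in
theorem _root_.EE8Lattice.IsAdapted.linearIndependent_sub :
    LinearIndependent ℝ fun k => g (g (b (centre k))) - g (b (centre k)) := by
  refine hb.linearIndependent_centre.map (f := g.toLinearEquiv.toLinearMap ∘ₗ
    g.toLinearEquiv.toLinearMap - g.toLinearEquiv.toLinearMap) ?_
  rw [Submodule.disjoint_def]
  intro x hx hx'
  have hT : x + g x + g (g x) = 0 := by
    have hle : Submodule.span ℝ (Set.range fun k => b (centre k)) ≤ LinearMap.ker (traceMap g) :=
      Submodule.span_le.2 (by rintro _ ⟨k, rfl⟩; exact hb.trace _ (centre_lt k))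
    exact hle hx
  have h1 : g (g x) - g x = 0 := hx'
  have h2 : g x = x := g.injective (sub_eq_zero.1 h1)
  rw [h2, h2] at hT
  have h6 : (3 : ℝ) • x = 0 := by
    rw [← hT]; module
  rwa [smul_eq_zero, or_iff_right (by norm_num)] at h6

/-- An `EE₈`-sublattice centralizing the three conjugates of the central `D₄` contains all vectors
of `Q` which are negated by `u` up to real scalars. -/
theorem mem_span_of_u_eq_neg {Y : Submodule ℤ V} (hY : IsEE8 Y) (hYQ : Y ≤ Q)
    (h1 : ∀ y ∈ Y, ∀ k, ⟪b (centre k), y⟫_ℝ = 0)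
    (h2 : ∀ y ∈ Y, ∀ k, ⟪g (g (b (centre k))) - g (b (centre k)), y⟫_ℝ = 0) {x : V}
    (hx : x ∈ Submodule.span ℝ (Q : Set V)) (hu : u x = -x) :
    x ∈ Submodule.span ℝ (Y : Set V) := by
  have hub : ∀ k, u (b (centre k)) = b (centre k) := fun k => hb.u_fix _ (centre_mem k)
  have hQ : ∀ k, b (centre k) ∈ Q := fun k => H.invM.le (hb.frame.mem _)
  -- These eight vectors are fixed by `u`, and the two families of four are mutually orthogonal. By
  -- dimension `Y` spans their complement in the 16-dimensional span of `Q`.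
  have hli : LinearIndependent ℝ (Sum.elim (fun k => b (centre k))
      fun k => g (g (b (centre k))) - g (b (centre k))) := by
    refine hb.linearIndependent_centre.sum_type hb.linearIndependent_sub
      (Submodule.IsOrtho.disjoint ?_)
    rw [Submodule.isOrtho_span]
    rintro _ ⟨k, rfl⟩ _ ⟨l, rfl⟩
    exact H.inner_sub_map (hb.frame.mem _) (hb.frame.mem _)
  refine mem_span_of_orthogonal H.finrank_span hY hYQ (by simp) hli ?_ ?_ hx ?_
  · rintro (k | k)
    · exact Submodule.subset_span (hQ k)
    · exact Submodule.subset_span (Q.sub_mem (H.invM.map_mem _ (H.invM.map_mem _ (hQ k)))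
        (H.invM.map_mem _ (hQ k)))
  · rintro y hy (k | k)
    · exact h1 y hy k
    · exact h2 y hy k
  · rintro (k | k)
    · exact H.inner_eq_zero (hub k) hu
    · exact H.inner_eq_zero (by simp only [Sum.elim_inr, map_sub, H.u_g, hub]) hu

end Adapted

theorem isEE8_negEigenlattice : IsEE8 (negEigenlattice u Q) := by
  obtain ⟨b, hb⟩ := H.exists_isAdapted
  obtain ⟨b', hb'⟩ := H.symm.exists_isAdapted
  obtain ⟨c, hc, hcb⟩ := H.exists_matching hb hb'
  have hE := isFrame_eigen H hb.isUFrame hc hcb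
  set Y := Submodule.span ℤ (Set.range fun i => vec b (eigenM i) + vec c (eigenN i)) with hY
  have hYQ : Y ≤ Q := Submodule.span_le.2 (by
    rintro _ ⟨i, rfl⟩
    exact Q.add_mem (H.invM.le (hb.frame.vec_mem _)) (H.invN.le (hc.frame.vec_mem _)))
  have hYE : Y ≤ negEigenlattice u Q := Submodule.span_le.2 (by
    rintro _ ⟨i, rfl⟩
    exact ⟨hYQ (Submodule.subset_span (Set.mem_range_self i)), u_eigen hb.isUFrame hc hcb i⟩)
  have hub : ∀ k, u (b (centre k)) = b (centre k) := fun k => hb.u_fix _ (centre_mem k)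
  -- The glued lattice has rank 8 and spans all of `E`; primitivity turns this into equality.
  have e : Y = negEigenlattice u Q := by
    refine le_antisymm hYE fun x hx => ?_
    refine mem_of_invol_eq_neg H.invM.good hE.isEE8 hYQ hx.1 (invol_eq_neg_iff.2 ?_)
    exact H.mem_span_of_u_eq_neg hb hE.isEE8 hYQ
      (fun y hy k => H.inner_eq_zero (hub k) (hYE hy).2)
      (fun y hy k => H.inner_eq_zero (by simp only [map_sub, H.u_g, hub]) (hYE hy).2)
      (Submodule.subset_span hx.1) hx.2
  rw [← e]
  exact hE.isEE8

theorem eq_negEigenlattice {b : Fin 8 → V} (hb : IsAdapted b M g u) {Y : Submodule ℤ V}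
    (hY : IsEE8 Y) (hYQ : Y ≤ Q) (h : ∀ k, ∀ i : Fin 3,
      invol Y ((g ^ (i : ℕ)) (b (centre k))) = (g ^ (i : ℕ)) (b (centre k))) :
    Y = negEigenlattice u Q := by
  refine (eq_of_forall_invol_eq_neg H.invM.good hY hYQ H.isEE8_negEigenlattice (fun x hx => hx.1)
    fun x hx => invol_eq_neg_iff.2 ?_).symm
  have orth : ∀ i : Fin 3, ∀ y ∈ Y, ∀ k, ⟪(g ^ (i : ℕ)) (b (centre k)), y⟫_ℝ = 0 :=
    fun i y hy k => by
      rw [real_inner_comm]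
      exact inner_eq_zero_of_invol (invol_apply_of_mem hy) (h k i)
  refine H.mem_span_of_u_eq_neg hb hY hYQ (orth 0) (fun y hy k => ?_)
    (Submodule.subset_span hx.1) hx.2
  have h1 := orth 1 y hy k
  have h2 := orth 2 y hy k
  simp only [Fin.val_one, pow_one] at h1
  simp only [Fin.val_two, sq_apply] at h2
  rw [inner_sub_left, h1, h2, sub_zero]

end IsSixPair
end EE8Lattice

/-! ### Classification of the EE₈-sublattices in the order-twelve case. -/

open scoped InnerProductSpace

namespace EE8Lattice

open Matrix

variable {V : Type*} [NormedAddCommGroup V] [InnerProductSpace ℝ V] [FiniteDimensional ℝ V]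

namespace IsSixPair

variable {Q M N : Submodule ℤ V} {g u : V ≃ₗᵢ[ℝ] V} (H : IsSixPair Q M N g u) {b : Fin 8 → V}
  (hb : IsAdapted b M g u)
include H

theorem exists_add_eq {q : V} (hq : q ∈ Q) : ∃ m ∈ M, ∃ n ∈ N, m + g (g n) = q := by
  rw [← H.sup, Submodule.mem_sup] at hq
  obtain ⟨m, hm, n', hn', e⟩ := hq
  obtain ⟨n, hn, rfl⟩ := mem_image.1 hn'
  exact ⟨m, hm, n, hn, by rwa [sq_apply] at e⟩

/-- For `q = m + g²n` the `M`-part contributes nothing, and the `N`-part contributes `(3/2)⟨x, n⟩`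
with `⟨x, n⟩` even because `x` also lies in `N`. -/
theorem exists_inner_eq_three_mul {x q : V} (hx : x ∈ M) (hu : u x = x)
    (hT : x + g x + g (g x) = 0) (hq : q ∈ Q) : ∃ n : ℤ, ⟪g (g x) - g x, q⟫_ℝ = 3 * n := by
  obtain ⟨m, hm, n, hn, rfl⟩ := H.exists_add_eq hq
  obtain ⟨k, hk⟩ := (isEE8_iff_exists_isFrame.1 H.invN.isEE8).choose_spec.exists_even_inner
    (H.mem_N hx hu) hn
  refine ⟨k, ?_⟩
  rw [inner_add_right, real_inner_comm, H.inner_sub_map hm hx, zero_add, inner_sub_left,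
    g.inner_map_map, g.inner_map_map, g.inner_map_map, H.invN.inner_map_right,
    (H.invN.inner_map_left (H.mem_N hx hu) hT hn).2, hk]
  ring

/-- Such an `x` pairs evenly with `M` and to zero with `g²N`, hence evenly with all of `Q`. -/
theorem invol_fixed {x : V} (hx : x ∈ M) (h4 : ⟪x, x⟫_ℝ = 4) (hg : g x = x) (hu : u x = -x)
    {Y : Submodule ℤ V} (hY : IsEE8 Y) (hYQ : Y ≤ Q) : invol Y x = x ∨ invol Y x = -x := by
  refine invol_eq_or_eq_neg (Q := Q) hY hYQ h4 fun q hq => ?_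
  obtain ⟨m, hm, n, hn, rfl⟩ := H.exists_add_eq hq
  obtain ⟨k, hk⟩ := (isEE8_iff_exists_isFrame.1 H.invM.isEE8).choose_spec.exists_even_inner hx hm
  refine ⟨k, ?_⟩
  have h0 := H.inner_M_N hx hn
  rw [hu, add_neg_cancel, inner_zero_left] at h0
  have h1 : ⟪x, g (g n)⟫_ℝ = 0 := by
    rw [H.invM.inner_map_right, H.invM.inner_map_right, H.invM.cube, hg]
    linarith
  rw [inner_add_right, hk, h1, add_zero]

include hb

/-- An `EE₈`-sublattice either contains or is orthogonal to the vectors fixed by `g`. -/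
theorem invol_fixed_pair {Y : Submodule ℤ V} (hY : IsEE8 Y) (hYQ : Y ≤ Q) :
    (invol Y (vec b highest) = -vec b highest ∧ invol Y (b 7) = -b 7) ∨
      (invol Y (vec b highest) = vec b highest ∧ invol Y (b 7) = b 7) := by
  have h := hb.frame.inner_highest_basis 7
  rw [Pi.single_eq_same] at h
  rcases H.invol_fixed (hb.frame.vec_mem _) hb.frame.inner_highest_self hb.gθ hb.uθ hY hYQ with
    h1 | h1 <;>
  rcases H.invol_fixed (hb.frame.mem 7) (hb.frame.inner_basis_self 7) hb.g7 hb.u7 hY hYQ with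
    h2 | h2
  · exact Or.inr ⟨h1, h2⟩
  · rw [real_inner_comm, inner_eq_zero_of_invol h2 h1] at h
    norm_num at h
  · rw [inner_eq_zero_of_invol h1 h2] at h
    norm_num at h
  · exact Or.inl ⟨h1, h2⟩

/-- The D₄ and √2A₂ span six dimensions. Two further roots of `M` have projections to that span of
norm above 2, which forces them into `Y` and completes a frame. -/
theorem eq_of_fixed_mem {Y : Submodule ℤ V} (hY : IsEE8 Y) (hYQ : Y ≤ Q)
    (hD : ∀ i ∈ ({1, 2, 3, 4} : Set (Fin 8)), b i ∈ Y)
    (hθ : vec b highest ∈ Submodule.span ℝ (Y : Set V))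
    (h7 : b 7 ∈ Submodule.span ℝ (Y : Set V)) : Y = M := by
  have hspan : ∀ (n : ℤ) (d : Fin 8 → ℤ), d 0 = 0 → d 5 = 0 → d 6 = 0 →
      vec b (n • highest + d) ∈ Submodule.span ℝ (Y : Set V) := fun n d h0 h5 h6 => by
    have hD' : ∀ i ∈ ({1, 2, 3, 4} : Set (Fin 8)), b i ∈ Submodule.span ℝ (Y : Set V) :=
      fun i hi => Submodule.subset_span (hD i hi)
    have hz : ∀ (k : ℤ) {x : V}, x ∈ Submodule.span ℝ (Y : Set V) →
        k • x ∈ Submodule.span ℝ (Y : Set V) := fun k x hx => zsmul_mem hx k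
    rw [vec_add, vec_smul]
    refine add_mem (hz _ hθ) ?_
    simp only [vec, Fin.sum_univ_eight, h0, h5, h6, zero_smul, zero_add, add_zero]
    exact add_mem (add_mem (add_mem (add_mem (hz _ (hD' 1 (by simp))) (hz _ (hD' 2 (by simp))))
      (hz _ (hD' 3 (by simp)))) (hz _ (hD' 4 (by simp)))) (hz _ h7)
  have key : ∀ x d : Fin 8 → ℤ, d 0 = 0 → d 5 = 0 → d 6 = 0 →
      2 * ((CartanMatrix.E₈ *ᵥ x) ⬝ᵥ x) = 4 →
      2 * (2 * ((CartanMatrix.E₈ *ᵥ ((2 : ℤ) • highest + d)) ⬝ᵥ ((2 : ℤ) • highest + d))) <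
        (2 * ((CartanMatrix.E₈ *ᵥ x) ⬝ᵥ ((2 : ℤ) • highest + d))) ^ 2 →
      vec b x ∈ Submodule.span ℝ (Y : Set V) := fun x d h0 h5 h6 hx h => by
    refine Submodule.subset_span (mem_of_lt_inner_sq H.invM.good hY hYQ
      (H.invM.le (hb.frame.vec_mem x)) (hb.frame.inner_vec_eq hx) (hspan 2 d h0 h5 h6) ?_)
    rw [hb.frame.inner_vec, hb.frame.inner_vec]
    exact_mod_cast h
  -- In both applications the auxiliary vector is six times the projection of the root, whose norm
  -- is 4/3 from √2A₂ plus 2 from D₄.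
  have k1 := key ![0, 0, 0, 0, 0, 1, 1, 0] ![0, -3, -3, -6, -6, 0, 0, -4] rfl rfl rfl
    (by decide) (by decide +kernel)
  have k2 := key ![1, 0, 1, 1, 1, 1, 1, 0] ![0, -6, -3, -6, -3, 0, 0, -4] rfl rfl rfl
    (by decide) (by decide +kernel)
  have k3 := hspan 1 ![0, -3, -4, -6, -5, 0, 0, -2] rfl rfl rfl
  have low : ∀ d : Fin 8 → ℤ, d 0 = 0 → d 5 = 0 → d 6 = 0 →
      vec b d ∈ Submodule.span ℝ (Y : Set V) := fun d h0 h5 h6 => by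
    have := hspan 0 d h0 h5 h6
    rwa [zero_smul, zero_add] at this
  have m0 : b 0 ∈ Submodule.span ℝ (Y : Set V) := by
    have := sub_mem (sub_mem k2 k1) (low ![0, 0, 1, 1, 1, 0, 0, 0] rfl rfl rfl)
    rw [← vec_sub, ← vec_sub] at this
    rw [← vec_single b 0]
    convert this using 2
    decide +kernel
  have m5 : b 5 ∈ Submodule.span ℝ (Y : Set V) := by
    have := sub_mem (sub_mem k3 (zsmul_mem k1 3)) (zsmul_mem m0 2)
    rw [← vec_single b 0, ← vec_smul, ← vec_smul, ← vec_sub, ← vec_sub] at this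
    rw [← vec_single b 5]
    convert this using 2
    decide +kernel
  have m6 : b 6 ∈ Submodule.span ℝ (Y : Set V) := by
    have := sub_mem k1 m5
    rw [← vec_single b 5, ← vec_sub] at this
    rw [← vec_single b 6]
    convert this using 2
    decide +kernel
  have hD' : ∀ i ∈ ({1, 2, 3, 4} : Set (Fin 8)), b i ∈ Submodule.span ℝ (Y : Set V) :=
    fun i hi => Submodule.subset_span (hD i hi)
  refine hb.frame.eq_of_mem_span H.invM.good H.invM.le hY hYQ fun i => ?_
  fin_cases i
  exacts [m0, hD' 1 (by simp), hD' 2 (by simp), hD' 3 (by simp), hD' 4 (by simp), m5, m6, h7]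

/-- The two copies of √2A₂ and the vectors `g²b - gb` fill eight dimensions orthogonal to `Y` and to
the E₆ of `M`. So E₆ lies in the span of `Y`, and `b 6` then has an impossible inner product with
its image. -/
theorem not_orthogonal_fixed {b' : Fin 8 → V} (hb' : IsAdapted b' N (g ^ 2) u)
    {Y : Submodule ℤ V} (hY : IsEE8 Y) (hYQ : Y ≤ Q)
    (hD : ∀ k, ∀ y ∈ Y, ⟪g (g (b (centre k))) - g (b (centre k)), y⟫_ℝ = 0)
    (hθ : invol Y (vec b highest) = vec b highest) (h7 : invol Y (b 7) = b 7)
    (hθ' : invol Y (vec b' highest) = vec b' highest) (h7' : invol Y (b' 7) = b' 7) : False := by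
  have hub : ∀ k, u (b (centre k)) = b (centre k) := fun k => hb.u_fix _ (centre_mem k)
  have hsub : ∀ k, u (g (g (b (centre k))) - g (b (centre k))) =
      g (g (b (centre k))) - g (b (centre k)) := fun k => by simp only [map_sub, H.u_g, hub]
  have pair : ∀ {c : Fin 8 → V} {L : Submodule ℤ V} (_ : IsFrame c L),
      LinearIndependent ℝ ![vec c highest, c 7] := fun {c L} hc => by
    rw [LinearIndependent.pair_iff]
    intro s t h
    have h1 := congrArg (fun x => ⟪vec c highest, x⟫_ℝ) h
    have h2 := congrArg (fun x => ⟪x, c 7⟫_ℝ) h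
    have h3 := hc.inner_highest_basis 7
    rw [Pi.single_eq_same] at h3
    simp only [inner_add_right, inner_smul_right, inner_zero_right, hc.inner_highest_self, h3,
      inner_add_left, inner_smul_left, inner_zero_left, hc.inner_basis_self, conj_trivial] at h1 h2
    push_cast at h1 h2
    constructor <;> linarith
  have oMN : ∀ x ∈ M, u x = -x → ∀ y ∈ N, ⟪x, y⟫_ℝ = 0 := fun x hx hu y hy => by
    have := H.inner_M_N hx hy
    rw [hu, add_neg_cancel, inner_zero_left] at this
    linarith
  have oN : ∀ y ∈ N, u y = -y → ∀ x ∈ M, ⟪y, x⟫_ℝ = 0 := fun y hy hu x hx => by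
    rw [real_inner_comm]
    have h1 := H.inner_M_N hx hy
    rw [H.inner_eq_zero (x := x + u x) (by rw [map_add, H.u_sq, add_comm]) hu] at h1
    linarith
  have hli : LinearIndependent ℝ (Sum.elim (Sum.elim ![vec b highest, b 7]
      ![vec b' highest, b' 7]) fun k => g (g (b (centre k))) - g (b (centre k))) := by
    refine LinearIndependent.sum_type (LinearIndependent.sum_type (pair hb.frame) (pair hb'.frame)
      (Submodule.IsOrtho.disjoint ?_)) hb.linearIndependent_sub (Submodule.IsOrtho.disjoint ?_)
    · rw [Submodule.isOrtho_span]
      rintro _ ⟨i, rfl⟩ _ ⟨j, rfl⟩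
      fin_cases i <;> fin_cases j
      exacts [oMN _ (hb.frame.vec_mem _) hb.uθ _ (hb'.frame.vec_mem _),
        oMN _ (hb.frame.vec_mem _) hb.uθ _ (hb'.frame.mem _),
        oMN _ (hb.frame.mem _) hb.u7 _ (hb'.frame.vec_mem _),
        oMN _ (hb.frame.mem _) hb.u7 _ (hb'.frame.mem _)]
    · rw [Submodule.isOrtho_span]
      rintro _ ⟨i, rfl⟩ _ ⟨k, rfl⟩
      rw [real_inner_comm]
      refine H.inner_eq_zero (hsub k) ?_
      rcases i with i | i <;> fin_cases i
      exacts [hb.uθ, hb.u7, hb'.uθ, hb'.u7]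
  have hmem : ∀ j < 6, invol Y (b j) = -b j := fun j hj => by
    refine invol_eq_neg_iff.2 (mem_span_of_orthogonal H.finrank_span hY hYQ (by simp) hli ?_ ?_
      (Submodule.subset_span (H.invM.le (hb.frame.mem j))) ?_)
    · rintro ((i | i) | k)
      · refine Submodule.subset_span (H.invM.le ?_)
        fin_cases i
        exacts [hb.frame.vec_mem _, hb.frame.mem _]
      · refine Submodule.subset_span (H.invN.le ?_)
        fin_cases i
        exacts [hb'.frame.vec_mem _, hb'.frame.mem _]
      · have hQ := H.invM.le (hb.frame.mem (centre k))
        exact Submodule.subset_span (Q.sub_mem (H.invM.map_mem _ (H.invM.map_mem _ hQ))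
          (H.invM.map_mem _ hQ))
    · rintro y hy ((i | i) | k)
      · rw [real_inner_comm]
        refine inner_eq_zero_of_invol (invol_apply_of_mem hy) ?_
        fin_cases i
        exacts [hθ, h7]
      · rw [real_inner_comm]
        refine inner_eq_zero_of_invol (invol_apply_of_mem hy) ?_
        fin_cases i
        exacts [hθ', h7']
      · exact hD k y hy
    · rintro ((i | i) | k)
      · fin_cases i
        · change ⟪vec b highest, b j⟫_ℝ = 0
          rw [hb.frame.inner_highest_basis, Pi.single_eq_of_ne (by
            rintro rfl; exact absurd hj (by decide))]
          simp
        · change ⟪b 7, b j⟫_ℝ = 0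
          have : CartanMatrix.E₈ 7 j = 0 := by
            clear * - hj
            revert j; decide +kernel
          rw [hb.frame.gram, this]; simp
      · fin_cases i
        exacts [oN _ (hb'.frame.vec_mem _) hb'.uθ _ (hb.frame.mem _),
          oN _ (hb'.frame.mem _) hb'.u7 _ (hb.frame.mem _)]
      · change ⟪g (g (b (centre k))) - g (b (centre k)), b j⟫_ℝ = 0
        rw [real_inner_comm]
        exact H.inner_sub_map (hb.frame.mem _) (hb.frame.mem _)
  have hZ : invol Y (vec b ![2, 3, 4, 6, 5, 4, 0, 0]) = -vec b ![2, 3, 4, 6, 5, 4, 0, 0] := by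
    rw [map_vec]
    simp only [vec, Fin.sum_univ_eight, hmem 0 (by decide), hmem 1 (by decide),
      hmem 2 (by decide), hmem 3 (by decide), hmem 4 (by decide), hmem 5 (by decide)]
    simp
    abel
  have hW : invol Y (vec b (highest - ![0, 0, 0, 0, 0, 0, 0, 2])) =
      vec b (highest - ![0, 0, 0, 0, 0, 0, 0, 2]) := by
    have e : vec b ![0, 0, 0, 0, 0, 0, 0, 2] = (2 : ℤ) • b 7 := by
      simp [vec, Fin.sum_univ_eight]
    rw [vec_sub, map_sub, hθ, e, map_zsmul, h7]
  have e3 : (3 : ℤ) • b 6 = vec b (highest - ![0, 0, 0, 0, 0, 0, 0, 2]) -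
      vec b ![2, 3, 4, 6, 5, 4, 0, 0] := by
    rw [← vec_sub, ← vec_single b 6, ← vec_smul]
    congr 1
    decide +kernel
  have e4 : (3 : ℤ) • invol Y (b 6) = vec b (highest - ![0, 0, 0, 0, 0, 0, 0, 2]) +
      vec b ![2, 3, 4, 6, 5, 4, 0, 0] := by
    rw [← map_zsmul, e3, map_sub, hZ, hW, sub_neg_eq_add]
  -- Since `3 b₆ = W - Z` and `t_Y` sends it to `W + Z`, with norms 12 and 24, the inner product of
  -- `b₆` with its image is -4/3.
  have e5 := congrArg₂ (fun x y => ⟪x, y⟫_ℝ) e3 e4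
  simp only [inner_zsmul_left, inner_zsmul_right, inner_sub_left, inner_add_right] at e5
  rw [hb.frame.inner_vec_eq (c := highest - ![0, 0, 0, 0, 0, 0, 0, 2])
    (d := highest - ![0, 0, 0, 0, 0, 0, 0, 2]) (n := 12) (by decide +kernel),
    hb.frame.inner_vec_eq (c := ![2, 3, 4, 6, 5, 4, 0, 0])
    (d := ![2, 3, 4, 6, 5, 4, 0, 0]) (n := 24) (by decide +kernel),
    real_inner_comm (vec b ![2, 3, 4, 6, 5, 4, 0, 0])] at e5
  push_cast at e5
  rcases mem_or_inner_invol H.invM.good hY hYQ (H.invM.le (hb.frame.mem 6))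
    (hb.frame.inner_basis_self 6) with h | h | h | h
  · rw [invol_apply_of_mem h, inner_neg_right, hb.frame.inner_basis_self] at e5
    linarith
  all_goals
    rw [h] at e5
    linarith

/-- The `EE₈`-sublattices containing the central `D₄`. -/
theorem eq_or_eq_of_centre_mem {b' : Fin 8 → V} (hb' : IsAdapted b' N (g ^ 2) u)
    {Y : Submodule ℤ V} (hY : IsEE8 Y) (hYQ : Y ≤ Q)
    (hD : ∀ i ∈ ({1, 2, 3, 4} : Set (Fin 8)), b i ∈ Y)
    (hD' : ∀ i ∈ ({1, 2, 3, 4} : Set (Fin 8)),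
      invol Y (g (g (b i)) - g (b i)) = g (g (b i)) - g (b i)) : Y = M ∨ Y = N := by
  rcases H.invol_fixed_pair hb hY hYQ with ⟨h1, h2⟩ | ⟨h1, h2⟩
  · exact Or.inl (H.eq_of_fixed_mem hb hY hYQ hD (invol_eq_neg_iff.1 h1) (invol_eq_neg_iff.1 h2))
  rcases H.symm.invol_fixed_pair hb' hY hYQ with ⟨h1', h2'⟩ | ⟨h1', h2'⟩
  · refine Or.inr (H.symm.eq_of_fixed_mem hb' hY hYQ (fun i hi => ?_) (invol_eq_neg_iff.1 h1')
      (invol_eq_neg_iff.1 h2'))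
    have hM := H.symm.mem_N (hb'.frame.mem i) (hb'.u_fix i hi)
    obtain ⟨a₁, a₂, a₃, a₄, e⟩ := hb.isUFrame.exists_fixed_coords hM (hb'.u_fix i hi)
    rw [e]
    simp only [vec, Fin.sum_univ_eight, Matrix.cons_val, zero_smul, zero_add, add_zero]
    exact Y.add_mem (Y.add_mem (Y.add_mem (Y.smul_mem _ (hD 1 (by simp)))
      (Y.smul_mem _ (hD 2 (by simp)))) (Y.smul_mem _ (hD 3 (by simp))))
      (Y.smul_mem _ (hD 4 (by simp)))
  · refine (H.not_orthogonal_fixed hb hb' hY hYQ (fun k y hy => ?_) h1 h2 h1' h2').elim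
    rw [real_inner_comm]
    exact inner_eq_zero_of_invol (invol_apply_of_mem hy) (hD' _ (centre_mem k))

omit hb in
theorem classification {Y : Submodule ℤ V} (hY : IsEE8 Y) (hYQ : Y ≤ Q) :
    Y = negEigenlattice u Q ∨
      ∃ i : Fin 3, Y = image (g ^ (i : ℕ)) M ∨ Y = image (g ^ (i : ℕ)) N := by
  obtain ⟨b, hb⟩ := H.exists_isAdapted
  obtain ⟨b', hb'⟩ := H.symm.exists_isAdapted
  have lt : ∀ k ∈ ({1, 2, 3, 4} : Set (Fin 8)), k < 6 := by
    rintro i (rfl | rfl | rfl | rfl) <;> decide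
  have hT : ∀ k ∈ ({1, 2, 3, 4} : Set (Fin 8)), b k + g (b k) + g (g (b k)) = 0 :=
    fun k hk => hb.trace k (lt k hk)
  rcases H.invM.typeAt_family hY hYQ hb.frame {1, 2, 3, 4} (fun p => connected_D₄) hT
    (fun k hk q hq => H.exists_inner_eq_three_mul (hb.frame.mem k) (hb.u_fix k hk) (hT k hk) hq)
    with h | ⟨i, h⟩
  · exact Or.inl (H.eq_negEigenlattice hb hY hYQ fun k i => h _ (centre_mem k) i)
  · refine Or.inr ⟨i, ?_⟩
    have hYQ' := H.invM.image_pow_inv_le i hYQ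
    have h' := fun k hk => (h k hk).image_inv
    rcases H.eq_or_eq_of_centre_mem hb hb' (hY.image (g ^ (i : ℕ))⁻¹) hYQ'
      (fun k hk => mem_of_invol_eq_neg H.invM.good (hY.image _) hYQ'
        (H.invM.le (hb.frame.mem k)) (by simpa using (h' k hk).1))
      (fun k hk => by simpa using (h' k hk).2) with e | e
    · exact Or.inl (eq_image_of_image_inv_eq e)
    · exact Or.inr (eq_image_of_image_inv_eq e)

omit hb in
theorem mem_ee8Sublattices_iff {Y : Submodule ℤ V} : Y ∈ ee8Sublattices Q ↔
    Y = negEigenlattice u Q ∨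
      ∃ i : Fin 3, Y = image (g ^ (i : ℕ)) M ∨ Y = image (g ^ (i : ℕ)) N := by
  refine ⟨fun h => H.classification h.2 h.1, ?_⟩
  have le : ∀ {L : Submodule ℤ V} (i : ℕ), L ≤ Q → image (g ^ i) L ≤ Q := fun {L} i hL y hy => by
    obtain ⟨x, hx, rfl⟩ := mem_image.1 hy
    exact H.invM.map_pow_mem i (hL hx)
  rintro (rfl | ⟨i, rfl | rfl⟩)
  · exact ⟨fun x hx => hx.1, H.isEE8_negEigenlattice⟩
  · exact ⟨le i H.invM.le, H.invM.isEE8.image _⟩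
  · exact ⟨le i H.invN.le, H.invN.isEE8.image _⟩

end IsSixPair
end EE8Lattice

/-! ### From an arbitrary generating pair to the classification. -/

open scoped InnerProductSpace

namespace EE8Lattice

open Matrix

section Group

variable {G : Type*} [Group G] {s t g u : G}

theorem mul_mul_pow_of_involutions (hs : s * s = 1) (ht : t * t = 1) (n : ℕ) :
    t * (t * s) ^ n = ((t * s) ^ n)⁻¹ * t := by
  have h1 : t * (t * s) * t⁻¹ = (t * s)⁻¹ := by
    rw [_root_.mul_inv_rev, ← mul_assoc, ht, one_mul, inv_eq_of_mul_eq_one_left hs]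
  rw [← inv_pow, ← h1, conj_pow, inv_mul_cancel_right]

/-- The product of a conjugate of `t` and a conjugate of `t * u` under powers of `g`. -/
theorem conj_mul_conj_eq (hgt : t * g = g⁻¹ * t) (hug : u * g = g * u) (ht : t * t = 1)
    (i j : ℕ) :
    (g ^ i * t * (g ^ i)⁻¹) * (g ^ j * (t * u) * (g ^ j)⁻¹) = u * (g ^ i * (g ^ j)⁻¹) ^ 2 := by
  have h1 : ∀ n : ℕ, t * g ^ n = (g ^ n)⁻¹ * t := fun n => by
    have : t * g * t⁻¹ = g⁻¹ := by rw [hgt, mul_inv_cancel_right]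
    rw [← inv_pow, ← this, conj_pow, inv_mul_cancel_right]
  have h2 : ∀ n : ℕ, t * (g ^ n)⁻¹ = g ^ n * t := fun n => by
    rw [← mul_right_inj (a := (g ^ n)⁻¹), ← mul_assoc, ← h1, mul_assoc, mul_inv_cancel, mul_one,
      inv_mul_cancel_left]
  have h3 : ∀ n : ℕ, u * g ^ n = g ^ n * u := fun n => (Commute.pow_right hug n).eq
  have h4 : ∀ n : ℕ, u * (g ^ n)⁻¹ = (g ^ n)⁻¹ * u := fun n =>
    ((Commute.pow_right hug n).inv_right).eq
  have hc : Commute (g ^ i) (g ^ j)⁻¹ := ((Commute.refl g).pow_pow i j).inv_right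
  have hc' : Commute u (g ^ i * (g ^ j)⁻¹) :=
    Commute.mul_right (h3 i) (h4 j)
  calc (g ^ i * t * (g ^ i)⁻¹) * (g ^ j * (t * u) * (g ^ j)⁻¹)
      = g ^ i * (t * (g ^ i)⁻¹) * g ^ j * t * (u * (g ^ j)⁻¹) := by group
    _ = g ^ i * g ^ i * (t * g ^ j) * t * ((g ^ j)⁻¹ * u) := by rw [h2, h4]; group
    _ = g ^ i * g ^ i * (g ^ j)⁻¹ * (t * t) * (g ^ j)⁻¹ * u := by rw [h1]; group
    _ = (g ^ i * (g ^ j)⁻¹) ^ 2 * u := by rw [ht, hc.mul_pow]; group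
    _ = u * (g ^ i * (g ^ j)⁻¹) ^ 2 := ((hc'.pow_right 2).eq).symm

/-- With `k = gⁱg⁻ʲ` of order 3 the product is `uk²`, whose square is `k` and whose cube is `u`. -/
theorem pow_of_conj_mul_conj (hgt : t * g = g⁻¹ * t) (hug : u * g = g * u) (ht : t * t = 1) (hg : g ^ 3 = 1) (hu : u ^ 2 = 1) (hu1 : u ≠ 1) {i j : ℕ}
    (hij : g ^ i ≠ g ^ j) :
    let h := (g ^ i * t * (g ^ i)⁻¹) * (g ^ j * (t * u) * (g ^ j)⁻¹)
    h ^ 6 = 1 ∧ h ^ 2 ≠ 1 ∧ h ^ 3 ≠ 1 := by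
  intro h
  have hc : Commute (g ^ i) (g ^ j)⁻¹ := ((Commute.refl g).pow_pow i j).inv_right
  have hk3 : (g ^ i * (g ^ j)⁻¹) ^ 3 = 1 := by
    rw [hc.mul_pow, inv_pow, ← pow_mul, ← pow_mul, mul_comm i, mul_comm j, pow_mul, pow_mul, hg,
      one_pow, one_pow, inv_one, one_mul]
  have hk1 : g ^ i * (g ^ j)⁻¹ ≠ 1 := fun e => hij (mul_inv_eq_one.1 e)
  have hc' : Commute u (g ^ i * (g ^ j)⁻¹) :=
    Commute.mul_right (Commute.pow_right hug i) (Commute.pow_right hug j).inv_right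
  have e : h = u * (g ^ i * (g ^ j)⁻¹) ^ 2 := conj_mul_conj_eq hgt hug ht i j
  generalize g ^ i * (g ^ j)⁻¹ = k at *
  have h2 : h ^ 2 = k := by
    rw [e, (hc'.pow_right 2).mul_pow, hu, one_mul, ← pow_mul, show 2 * 2 = 3 + 1 by norm_num,
      pow_succ, hk3, one_mul]
  have h3 : h ^ 3 = u := by
    rw [pow_succ, h2, e, ← mul_assoc, ← hc'.eq, mul_assoc,
      ← pow_succ', hk3, mul_one]
  refine ⟨?_, by rw [h2]; exact hk1, by rw [h3]; exact hu1⟩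
  rw [show 6 = 2 * 3 by norm_num, pow_mul, h2, hk3]

end Group

variable {V : Type*} [NormedAddCommGroup V] [InnerProductSpace ℝ V] [FiniteDimensional ℝ V]

theorem invol_image_eq (f : V ≃ₗᵢ[ℝ] V) (M : Submodule ℤ V) :
    invol (image f M) = f * invol M * f⁻¹ := by
  rw [eq_mul_inv_iff_mul_eq]
  exact LinearIsometryEquiv.ext (invol_image f M)

/-- Replacing `N` by `h²N` makes its involution `t_M h³`, which commutes with `t_M`. The identity
`kill` says that the sum of the powers of `h` vanishes on `M + N`: its values on `M` and on `N` are
fixed by `h` and negated by both involutions, so they lie in `M ∩ N = 0`. -/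
theorem isSixPair_of_pow {M N : Submodule ℤ V} (hM : IsEE8 M) (hN : IsEE8 N)
    (hi : IsIntegral (M ⊔ N)) (hr : IsRootless (M ⊔ N)) (hinf : M ⊓ N = ⊥) {h : V ≃ₗᵢ[ℝ] V}
    (hh : h = invol M * invol N) (h6 : h ^ 6 = 1) (h2 : h ^ 2 ≠ 1) (h3 : h ^ 3 ≠ 1) :
    IsSixPair (M ⊔ N) M (image (h ^ 2) N) (h ^ 2) (h ^ 3) := by
  have hQ := isGood_sup hM hN hi hr
  have hMQ : M ≤ M ⊔ N := le_sup_left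
  have hNQ : N ≤ M ⊔ N := le_sup_right
  have hhQ : ∀ x ∈ M ⊔ N, h x ∈ M ⊔ N := fun x hx => by
    rw [hh]
    exact invol_mem hQ.integral hM hMQ (invol_mem hQ.integral hN hNQ hx)
  have hth : ∀ n : ℕ, invol M * h ^ n = (h ^ n)⁻¹ * invol M := fun n => by
    rw [hh]; exact mul_mul_pow_of_involutions (invol_mul_self N) (invol_mul_self M) n
  have hinv : (h ^ 2)⁻¹ = (h ^ 2) ^ 2 := inv_eq_of_mul_eq_one_left (by
    rw [← pow_succ, ← pow_mul]; exact h6)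
  have hN' : invol N = invol M * h := by
    rw [hh, ← mul_assoc, invol_mul_self, one_mul]
  have prod : invol (image (h ^ 2) N) = invol M * h ^ 3 := by
    have h2t : h ^ 2 * invol M = invol M * (h ^ 2)⁻¹ := by
      rw [eq_mul_inv_iff_mul_eq, mul_assoc, hth, mul_inv_cancel_left]
    calc invol (image (h ^ 2) N) = h ^ 2 * invol M * h * (h ^ 2)⁻¹ := by
          rw [invol_image_eq, hN', ← mul_assoc]
      _ = invol M * h ^ 3 * (h ^ 6)⁻¹ := by rw [h2t]; group
      _ = invol M * h ^ 3 := by rw [h6, inv_one, mul_one]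
  have p2 : ∀ x, (h ^ 2) x = h (h x) := sq_apply h
  have p3 : ∀ x, (h ^ 3) x = h (h (h x)) := fun x => rfl
  have p6 : ∀ x, h (h (h (h (h (h x))))) = x := fun x => DFunLike.congr_fun h6 x
  have conj : ∀ x, invol M ((h ^ 2) x) = (h ^ 2) ((h ^ 2) (invol M x)) := fun x => by
    rw [← sq_apply (h ^ 2), ← hinv]
    exact DFunLike.congr_fun (hth 2) x
  have hu_M : ∀ x, invol M ((h ^ 3) x) = (h ^ 3) (invol M x) := fun x => by
    have e3 : (h ^ 3)⁻¹ = h ^ 3 := inv_eq_of_mul_eq_one_left (by rw [← pow_add]; exact h6)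
    have := DFunLike.congr_fun (hth 3) x
    rw [e3] at this
    exact this
  have hmap : ∀ x ∈ M ⊔ N, (h ^ 2) x ∈ M ⊔ N := fun x hx => by
    rw [p2]; exact hhQ _ (hhQ _ hx)
  have hcube : ∀ x, (h ^ 2) ((h ^ 2) ((h ^ 2) x)) = x := fun x => by
    simp only [p2, p6]
  have kill : ∀ x ∈ M ⊔ N, x + h x + h (h x) + h (h (h x)) + h (h (h (h x))) +
      h (h (h (h (h x)))) = 0 := fun x hx => by
    have hS : ∀ {L : Submodule ℤ V}, (∀ y, invol L (h y) = h⁻¹ (invol L y)) → ∀ x ∈ L,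
        invol L (x + h x + h (h x) + h (h (h x)) + h (h (h (h x))) + h (h (h (h (h x))))) =
          -(x + h x + h (h x) + h (h (h x)) + h (h (h (h x))) + h (h (h (h (h x))))) := by
      intro L hL x hx
      have i1 : ∀ y, h⁻¹ y = h (h (h (h (h y)))) := fun y => by
        have := congrArg (⇑(h⁻¹)) (p6 y)
        rw [← this]
        exact h.symm_apply_apply _
      simp only [map_add, hL, i1, p6, invol_apply_of_mem hx, map_neg]
      abel
    have fixS : ∀ x, h (x + h x + h (h x) + h (h (h x)) + h (h (h (h x))) +
        h (h (h (h (h x))))) = x + h x + h (h x) + h (h (h x)) + h (h (h (h x))) +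
        h (h (h (h (h x)))) := fun x => by
      simp only [map_add, p6]; abel
    have hSQ : ∀ x ∈ M ⊔ N, x + h x + h (h x) + h (h (h x)) + h (h (h (h x))) +
        h (h (h (h (h x)))) ∈ M ⊔ N := fun x hx => by
      have q1 := hhQ _ hx
      have q2 := hhQ _ q1
      have q3 := hhQ _ q2
      have q4 := hhQ _ q3
      exact add_mem (add_mem (add_mem (add_mem (add_mem hx q1) q2) q3) q4) (hhQ _ q4)
    have zero : ∀ y ∈ M ⊔ N, h y = y → (invol M y = -y ∨ invol N y = -y) → y = 0 := by
      intro y hy hyh hor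
      have hts : invol M (invol N y) = y := by
        rw [hh] at hyh; exact hyh
      have hst : invol N y = invol M y := by rw [← hts, invol_invol, hts]
      have h1 : invol M y = -y := by
        rcases hor with h1 | h1
        · exact h1
        · rw [← hst, h1]
      have : y ∈ M ⊓ N := ⟨mem_of_invol_eq_neg hQ hM hMQ hy h1,
        mem_of_invol_eq_neg hQ hN hNQ hy (hst.trans h1)⟩
      rwa [hinf, Submodule.mem_bot] at this
    have hinvh : h⁻¹ = invol N * invol M := by
      rw [hh]
      exact inv_eq_of_mul_eq_one_left (by
        rw [mul_assoc, ← mul_assoc (invol M), invol_mul_self, one_mul, invol_mul_self])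
    obtain ⟨m, hm, n, hn, rfl⟩ := Submodule.mem_sup.1 hx
    have zm := zero _ (hSQ m (hMQ hm)) (fixS m) (Or.inl (hS (fun y => by
      rw [hinvh, hh]
      change invol M (invol M (invol N y)) = invol N (invol M (invol M y))
      rw [invol_invol, invol_invol]) m hm))
    have zn := zero _ (hSQ n (hNQ hn)) (fixS n) (Or.inr (hS (fun y => by
      rw [hinvh, hh]
      rfl) n hn))
    simp only [map_add]
    rw [← add_zero (0 : V)]
    nth_rewrite 1 [← zm]
    rw [← zn]
    abel
  refine ⟨⟨hQ, hM, hMQ, hmap, hcube, conj⟩, ⟨hQ, hN.image _, ?_, hmap, hcube, fun x => ?_⟩,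
    fun x => ?_, fun x => ?_, hu_M, fun x => ?_, ?_, fun x hx => ?_, h2, h3⟩
  · intro y hy
    obtain ⟨x, hx, rfl⟩ := mem_image.1 hy
    exact hmap x (hNQ hx)
  · rw [prod]
    change invol M ((h ^ 3) ((h ^ 2) x)) = (h ^ 2) ((h ^ 2) (invol M ((h ^ 3) x)))
    rw [← conj]
    rfl
  · simp only [p3, p6]
  · simp only [p3, p2]
  · rw [prod]; rfl
  · rw [← image_mul, ← pow_succ, ← pow_mul, h6, image_one]
  · simp only [p3, p2, map_add, p6]
    have := kill x hx
    rw [eq_neg_iff_add_eq_zero, ← this]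
    abel

/-- Two `EE₈`-sublattices with trivial intersection have involutions whose product has order
six. -/
theorem IsSixPair.pow_of_inf_eq_bot {Q M N : Submodule ℤ V} {g u : V ≃ₗᵢ[ℝ] V}
    (H : IsSixPair Q M N g u) {X Y : Submodule ℤ V} (hX : X ∈ ee8Sublattices Q)
    (hY : Y ∈ ee8Sublattices Q) (hinf : X ⊓ Y = ⊥) :
    (invol X * invol Y) ^ 6 = 1 ∧ (invol X * invol Y) ^ 2 ≠ 1 ∧ (invol X * invol Y) ^ 3 ≠ 1 := by
  obtain ⟨b, hb⟩ := H.exists_isAdapted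
  obtain ⟨b', hb'⟩ := H.symm.exists_isAdapted
  have meet : ∀ {x : V} {X Y : Submodule ℤ V}, X ⊓ Y = ⊥ → ⟪x, x⟫_ℝ = 4 → x ∈ X → x ∉ Y := by
    intro x X Y hXY h4 hx hy
    have : x ∈ X ⊓ Y := ⟨hx, hy⟩
    rw [hXY, Submodule.mem_bot] at this
    rw [this, inner_zero_left] at h4
    norm_num at h4
  have fixed : ∀ {x : V} (_ : g x = x) (i : ℕ), (g ^ i) x = x := fun {x} hx i => by
    induction i with
    | zero => rfl
    | succ i ih => rw [pow_succ]; exact (congrArg (g ^ i) hx).trans ih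
  have gθ' : g (vec b' highest) = vec b' highest := by
    have := hb'.gθ
    rw [sq_apply] at this
    have h3 := H.invM.cube (vec b' highest)
    rw [this] at h3
    exact h3
  have mM : ∀ i : ℕ, vec b highest ∈ image (g ^ i) M := fun i =>
    mem_image.2 ⟨_, hb.frame.vec_mem _, fixed hb.gθ i⟩
  have mN : ∀ i : ℕ, vec b' highest ∈ image (g ^ i) N := fun i =>
    mem_image.2 ⟨_, hb'.frame.vec_mem _, fixed gθ' i⟩
  have mE : vec b highest ∈ negEigenlattice u Q := ⟨H.invM.le (hb.frame.vec_mem _), hb.uθ⟩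
  have mE' : vec b' highest ∈ negEigenlattice u Q := ⟨H.invN.le (hb'.frame.vec_mem _), hb'.uθ⟩
  have main : ∀ i j : Fin 3, image (g ^ (i : ℕ)) M ⊓ image (g ^ (j : ℕ)) N = ⊥ →
      (invol (image (g ^ (i : ℕ)) M) * invol (image (g ^ (j : ℕ)) N)) ^ 6 = 1 ∧
      (invol (image (g ^ (i : ℕ)) M) * invol (image (g ^ (j : ℕ)) N)) ^ 2 ≠ 1 ∧
      (invol (image (g ^ (i : ℕ)) M) * invol (image (g ^ (j : ℕ)) N)) ^ 3 ≠ 1 := by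
    intro i j hij
    have eN : invol N = invol M * u := LinearIsometryEquiv.ext H.prod
    rw [invol_image_eq, invol_image_eq, eN]
    refine pow_of_conj_mul_conj ?_ (LinearIsometryEquiv.ext H.u_g) (invol_mul_self M)
      H.invM.pow_three (LinearIsometryEquiv.ext fun x => by rw [sq_apply]; exact H.u_sq x) H.u_ne
      fun e => ?_
    · have : g⁻¹ = g ^ 2 := inv_eq_of_mul_eq_one_left (by
        rw [← pow_succ]; exact H.invM.pow_three)
      rw [this]
      exact LinearIsometryEquiv.ext fun x => by
        change invol M (g x) = (g ^ 2) (invol M x)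
        rw [sq_apply, H.invM.conj]
    · refine meet hij (x := (g ^ (i : ℕ)) (b 1)) ?_ (mem_image_of_mem _ (hb.frame.mem 1)) ?_
      · rw [LinearIsometryEquiv.inner_map_map, hb.frame.inner_basis_self]
      · rw [e]
        exact mem_image_of_mem _ (H.mem_N (hb.frame.mem 1) (hb.u_fix 1 (by simp)))
  have fθ := hb.frame.inner_highest_self
  have fθ' := hb'.frame.inner_highest_self
  -- The highest root of `M` lies in `E` and every `gⁱM`, that of `N` in `E` and every `gⁱN`, and
  -- `gⁱM` meets `gⁱN` in a copy of D₄. Only `gⁱM` and `gʲN` with `gⁱ ≠ gʲ` can meet trivially.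
  rcases H.mem_ee8Sublattices_iff.1 hX with rfl | ⟨i, rfl | rfl⟩ <;>
  rcases H.mem_ee8Sublattices_iff.1 hY with rfl | ⟨j, rfl | rfl⟩
  · exact absurd mE (meet hinf fθ mE)
  · exact absurd (mM j) (meet hinf fθ mE)
  · exact absurd (mN j) (meet hinf fθ' mE')
  · exact absurd mE (meet hinf fθ (mM i))
  · exact absurd (mM j) (meet hinf fθ (mM i))
  · exact main i j hinf
  · exact absurd mE' (meet hinf fθ' (mN i))
  · rw [inf_comm] at hinf
    obtain ⟨h6, h2, h3⟩ := main j i hinf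
    have e : invol (image (g ^ (i : ℕ)) N) * invol (image (g ^ (j : ℕ)) M) =
        (invol (image (g ^ (j : ℕ)) M) * invol (image (g ^ (i : ℕ)) N))⁻¹ :=
      (inv_eq_of_mul_eq_one_left (by
        rw [mul_assoc, ← mul_assoc (invol (image (g ^ (j : ℕ)) M)), invol_mul_self, one_mul,
          invol_mul_self])).symm
    rw [e, inv_pow, inv_pow, inv_pow, h6, inv_one]
    exact ⟨rfl, fun h => h2 (inv_eq_one.1 h), fun h => h3 (inv_eq_one.1 h)⟩
  · exact absurd (mN j) (meet hinf fθ' (mN i))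

omit [FiniteDimensional ℝ V] in
theorem inf_eq_bot_of_finrank {M N : Submodule ℤ V} (hM : IsEE8 M) (hN : IsEE8 N)
    (h : Module.finrank ℤ ↥(M ⊔ N) = 16) : M ⊓ N = ⊥ := by
  have : Module.IsTorsionFree ℤ V := Module.IsTorsionFree.trans ℝ
  have := finite_of_le_isEE8 hM (inf_le_left : M ⊓ N ≤ M)
  have h16 := finrank_inf_add_finrank_sup hM hN
  exact Submodule.finrank_eq_zero.1 (by omega)

/-- The pair supplied by the type need not be the given one. It provides a classification that shows
the given pair, which meets trivially by rank, to have a product of order six, and the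
classification is then applied to that pair. -/
theorem mem_ee8Sublattices_iff {Q M N : Submodule ℤ V} (hQ : IsDIH 12 16 Q) (hM : IsEE8 M)
    (hN : IsEE8 N) (hMN : M ⊔ N = Q) (Y : Submodule ℤ V) :
    Y ∈ ee8Sublattices Q ↔ Y = negEigenlattice ((invol M * invol N) ^ 3) Q ∨
      ∃ i : Fin 3, Y = image (((invol M * invol N) ^ 2) ^ (i : ℕ)) M ∨
        Y = image (((invol M * invol N) ^ 2) ^ (i : ℕ)) N := by
  obtain ⟨hi, hr, h16, M₀, N₀, hM₀, hN₀, rfl, m, hm, ⟨e⟩⟩ := hQ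
  obtain rfl : m = 6 := by omega
  obtain ⟨h6, h2, h3⟩ := pow_of_mulEquiv_dihedralGroup_six (invol_mul_self M₀)
    (invol_mul_self N₀) e
  have H₀ := isSixPair_of_pow hM₀ hN₀ hi hr (inf_eq_bot_of_finrank hM₀ hN₀ h16) rfl h6 h2 h3
  have hinf : M ⊓ N = ⊥ := inf_eq_bot_of_finrank hM hN (by rw [hMN, h16])
  obtain ⟨h6, h2, h3⟩ := H₀.pow_of_inf_eq_bot ⟨hMN ▸ le_sup_left, hM⟩ ⟨hMN ▸ le_sup_right, hN⟩
    hinf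
  rw [← hMN] at hi hr ⊢
  have H := isSixPair_of_pow hM hN hi hr hinf rfl h6 h2 h3
  rw [H.mem_ee8Sublattices_iff]
  generalize invol M * invol N = h at h6 ⊢
  have c3 : (h ^ 2) ^ 3 = 1 := by rw [← pow_mul]; exact h6
  -- The six-pair involves `h²N` instead of `N`; the orbit under `h²` is the same.
  have shift : (∃ i : Fin 3, Y = image ((h ^ 2) ^ (i : ℕ)) (image (h ^ 2) N)) ↔
      ∃ i : Fin 3, Y = image ((h ^ 2) ^ (i : ℕ)) N := by
    simp only [← image_mul, ← pow_succ, Fin.exists_fin_succ]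
    simp [c3, image_one]
    tauto
  simp only [exists_or]
  rw [shift]

end EE8Lattice

theorem mainTheorem12 {V : Type*} [NormedAddCommGroup V] [InnerProductSpace ℝ V]
    [FiniteDimensional ℝ V] :
    (∀ Q' M N : Submodule ℤ V,
      EE8Lattice.IsDIH 12 16 Q' → EE8Lattice.IsEE8 M → EE8Lattice.IsEE8 N → M ⊔ N = Q' →
      ∀ h g u : V ≃ₗᵢ[ℝ] V,
        h = EE8Lattice.invol M * EE8Lattice.invol N → g = h ^ 2 → u = h ^ 3 →
        ∀ Y : Submodule ℤ V,
          Y ∈ EE8Lattice.ee8Sublattices Q' ↔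
            Y = EE8Lattice.negEigenlattice u Q' ∨
              ∃ i : Fin 3, Y = EE8Lattice.image (g ^ (i : ℕ)) M ∨
                Y = EE8Lattice.image (g ^ (i : ℕ)) N) ∧
    (∀ Q : Submodule ℤ V, EE8Lattice.IsDIH 6 14 Q →
      (EE8Lattice.ee8Sublattices Q).ncard = 3) := by
  refine ⟨fun Q' M N hQ hM hN hMN h g u hh hg hu Y => ?_, fun Q hQ =>
    EE8Lattice.ncard_ee8Sublattices hQ⟩
  rw [hg, hu, hh]
  exact EE8Lattice.mem_ee8Sublattices_iff hQ hM hN hMN Y
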